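/- **Setting.** Let $\Sigma$ be a finite set of function symbols of arity $\ge 1$, $\Sigma_A\subseteq\Sigma$ its set of associative symbols, and $C_0$ a finite set of constants with a total precedence. Symbols in $\Sigma_A$ are variadic with admissible arities $2,3,\dots$; the others have a fixed arity. $T(\Sigma,K)$ is the set of ground terms over $\Sigma$ and a set of constants $K$. Equations $s\approx t$ are unordered pairs of terms. $A$ is the set of axioms $f(x_1,\dots,x_m,f(y_1,\dots,y_i),z_1,\dots,z_n)\approx f(x_1,\dots,x_m,y_1,\dots,y_i,z_1,\dots,z_n)$ with $f\in\Sigma_A$, all arities admissible. A term is flattened associatively by applying these axioms from left to right as long as possible; $s\approx_A t$ means that $s$ and $t$ are equal modulo $A$, equivalently, that their flattened forms coincide. Let $E$ be a finite set of equations between terms of $T(\Sigma,C_0)$. $CC^A(E)$ is the smallest relation on $T(\Sigma,C_0)$ that contains $E$ and all ground instances of $A$ and is closed under reflexivity, symmetry, transitivity and congruence. We write $s\approx_E^A t$ if $s$ and $t$ have the same value in all models of $E\cup A$. **Flattening.** Let $W=\{c_1,c_2,\dots\}$ be an infinite set of new constants. For a string $u=u_1\cdots u_n$ of constants write $f(u)$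 for $f(u_1,\dots,u_n)$, and let $\bar f(u)$ be $f(u)$ if $|u|\ge2$ and $u$ if $|u|=1$. An equation is flat if it has one of the forms $c\approx d$ (constant), $g(u)\approx c$ ($D$-flat, $g\in\Sigma$), $f(u)\approx f(v)$ ($A$-flat, $f\in\Sigma_A$), with $c,d$ constants and $u,v$ strings of constants. $S(E)$ is any set of flat equations that is obtained from $E$ by flattening all terms associatively and then, finitely often, replacing in an equation that is not $A$-flat one occurrence of a term $t=g(u)$ by a constant $c\in W$, where either $c$ does not occur yet and $t\approx c$ is added, or $t\approx c$ is already present as another equation. **Completion.** Order constants by: the precedence on $C_0$; $c\succ c'$ for $c\in W$, $c'\in C_0$; $c_i\succ c_j$ for $i<j$. Moreover $t\succ c$ if $t$ is headed by a function symbol and $c$ is a constant, and $f(u)\succ f(v)$ if $f\in\Sigma_A$ and $u$ is greater than $v$ in the length-lexicographic ordering. The inference rules are as follows; in the first two, $f\in\Sigma_A$, and for $t=\bar f(v)$, $s=\bar f(w)$ the strings $u_1t$, $su_3$, $u_1tu_3$ stand for $u_1v$, $wu_3$, $u_1vu_3$. * DEDUCE: if $f(u_1u_2)\approx s$ and $f(u_2u_3)\approx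 t$ are present, $f(u_1u_2)\succ s$, $f(u_2u_3)\succ t$ and $u_1,u_2,u_3$ are nonempty, add $f(u_1t)\approx f(su_3)$. * SIMPLIFY: if $f(u_1u_2u_3)\approx s$ and $f(u_2)\approx t$ are present, $f(u_2)\succ t$, and $s\succ t$ in case $|u_1u_3|=0$, replace $f(u_1u_2u_3)\approx s$ by $\bar f(u_1tu_3)\approx s$. * COLLAPSE: if $s[u]\approx t$ and $u\approx d$ are present, $s[u]\succ t$, $u\succ d$, $d$ is a constant, $u$ is not headed by a symbol of $\Sigma_A$, and $t\succ d$ in case $s[u]=u$, replace $s[u]\approx t$ by $s[d]\approx t$. * COMPOSE: if $t\approx c$ and $c\approx d$ are present with $c,d$ constants and $t\succ c\succ d$, replace $t\approx c$ by $t\approx d$. * DELETE: remove an equation $s\approx s$. A derivation is a finite or infinite sequence $S_0\vdash S_1\vdash\cdots$ in which each set arises from the previous one by an instance of a rule (a finite one is continued by repeating its last set). It is fair if every rule instance that is enabled (its premises are present and applying it changes the set) at all stages from some stage on is applied at some stage. Put $S_\infty(E)=\bigcup_i\bigcap_{j\ge i}S_j$ for a fair derivation with $S_0=S(E)$, and let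 $S_\infty^\succ(E)$ be the set of rules $l\to r$ with $l\approx r\in S_\infty(E)$ and $l\succ r$. For a set $R$ of rules, $p\to_{R/A}q$ means that $p\approx_A s\to_R t\approx_A q$ for some terms $s,t$. **Statement.** For every choice of $S(E)$ and of the fair derivation: 1. For all $s_0,t_0\in T(\Sigma,C_0)$: $s_0\approx t_0\in CC^A(E)$ if and only if $s_0$ and $t_0$ have the same normal form with respect to $S_\infty^\succ(E)/A$, that is, both have a normal form and every normal form of $s_0$ equals every normal form of $t_0$ modulo $A$. 2. If $S_\infty(E)$ is finite, then the word problem for $E$ modulo $A$ is decidable: there is an algorithm that decides for $s_0,t_0\in T(\Sigma,C_0)$, given as words, whether $s_0\approx_E^A t_0$. -/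

import Mathlib

/-- A finite signature is a type `Op` of function symbols (constants are kept apart) together with
the set of its associative symbols and the arity of the other symbols. -/
structure Signature (Op : Type) where
  assoc : Set Op
  arity : Op → ℕ
  arity_pos : ∀ g, 0 < arity g

/-- `F.ArityOK g n`: the symbol `g` may take `n` arguments.  Associative symbols are variadic,
with admissible arities 2, 3, 4, …; all other symbols have their fixed arity. -/
def Signature.ArityOK {Op : Type} (F : Signature Op) (g : Op) (n : ℕ) : Prop :=
  (g ∈ F.assoc ∧ 2 ≤ n) ∨ (g ∉ F.assoc ∧ n = F.arity g)

/-- Raw ground terms over function symbols `Op` and constants `K`. -/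
inductive Term (Op K : Type) : Type
  | const : K → Term Op K
  | app : Op → List (Term Op K) → Term Op K

/-- The ground terms proper: those in which every symbol has an admissible number of arguments.
`{t : Term Op K | F.WF t}` is the set `T(F, K)`. -/
inductive Signature.WF {Op K : Type} (F : Signature Op) : Term Op K → Prop
  | const (c : K) : F.WF (Term.const c)
  | app (g : Op) (ts : List (Term Op K)) (har : F.ArityOK g ts.length)
      (hts : ∀ t ∈ ts, F.WF t) : F.WF (Term.app g ts)

/-- An equation is an unordered pair of terms; `s(p, q)` stands for `p ≈ q`. -/
abbrev Eqn (Op K : Type) : Type := Sym2 (Term Op K)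

namespace Term

mutual
/-- Renaming of constants. -/
def map {Op K K' : Type} (h : K → K') : Term Op K → Term Op K'
  | const c => const (h c)
  | app g ts => app g (mapArgs h ts)
/-- Renaming of constants in a list of terms. -/
def mapArgs {Op K K' : Type} (h : K → K') : List (Term Op K) → List (Term Op K')
  | [] => []
  | t :: ts => map h t :: mapArgs h ts
end

open Classical in
/-- The list of arguments that the (already flattened) term `t` contributes below the symbol `g`:
if `g` is associative and `t = g(u₁, …, uᵢ)` these are `u₁, …, uᵢ`, otherwise it is `t` alone. -/
noncomputable def splice {Op K : Type} (F : Signature Op) (g : Op) :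
    Term Op K → List (Term Op K)
  | const c => [const c]
  | app g' us => if g' = g ∧ g ∈ F.assoc then us else [app g' us]

mutual
/-- Associative flattening of a term: its normal form for the rules
`f(x⃗, f(y⃗), z⃗) → f(x⃗, y⃗, z⃗)`, `f` associative. -/
noncomputable def flatten {Op K : Type} (F : Signature Op) : Term Op K → Term Op K
  | const c => const c
  | app g ts => app g (flattenArgs F g ts)
/-- The flattened argument list below the symbol `g`. -/
noncomputable def flattenArgs {Op K : Type} (F : Signature Op) (g : Op) :
    List (Term Op K) → List (Term Op K)
  | [] => []
  | t :: ts => splice F g (flatten F t) ++ flattenArgs F g ts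
end

/-- `HasConst c t`: the constant `c` occurs in `t`. -/
inductive HasConst {Op K : Type} (c : K) : Term Op K → Prop
  | here : HasConst c (const c)
  | arg (g : Op) (ts : List (Term Op K)) (t : Term Op K) (ht : t ∈ ts) (h : HasConst c t) :
      HasConst c (app g ts)

/-- `Replace u v s s'`: `s = s[u]` and `s' = s[v]`, that is, `s'` arises from `s` by replacing one
occurrence of the subterm `u` by `v` (the occurrence may be `s` itself). -/
inductive Replace {Op K : Type} (u v : Term Op K) : Term Op K → Term Op K → Prop
  | top : Replace u v u v
  | arg (g : Op) (xs ys : List (Term Op K)) (a b : Term Op K) (h : Replace u v a b) :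
      Replace u v (app g (xs ++ a :: ys)) (app g (xs ++ b :: ys))

/-- The term `f(w) = f(w₁, …, wₙ)` for a string `w` of constants. -/
def ofString {Op K : Type} (f : Op) (w : List K) : Term Op K := app f (w.map const)

/-- The term `f̄(w)`: the constant `c` if `w` is the one-letter string `c`, and `f(w)` otherwise. -/
def ofStringBar {Op K : Type} (f : Op) : List K → Term Op K
  | [c] => const c
  | w => ofString f w

mutual
/-- A term written as a word: `g(t₁, …, tₙ)` is the symbol `g`, followed by the words of
`t₁, …, tₙ`, followed by a closing bracket, the letter `Sum.inr (Sum.inr ())`. -/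
def word {Op K : Type} : Term Op K → List (Op ⊕ K ⊕ Unit)
  | const c => [Sum.inr (Sum.inl c)]
  | app g ts => Sum.inl g :: (wordArgs ts ++ [Sum.inr (Sum.inr ())])
/-- The concatenation of the words of a list of terms. -/
def wordArgs {Op K : Type} : List (Term Op K) → List (Op ⊕ K ⊕ Unit)
  | [] => []
  | t :: ts => word t ++ wordArgs ts
end

end Term

/-! ### Congruence closure modulo associativity, and semantic consequence -/

/-- `CC F E` is `CC^A(E)`: the smallest relation on the ground terms that contains `E`, contains
all ground instances of the associativity axioms
`f(x₁,…,xₘ, f(y₁,…,yᵢ), z₁,…,zₙ) ≈ f(x₁,…,xₘ, y₁,…,yᵢ, z₁,…,zₙ)`, `f` associative, and is closed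
under reflexivity, symmetry, transitivity and congruence. -/
inductive CC {Op K : Type} (F : Signature Op) (E : Set (Eqn Op K)) :
    Term Op K → Term Op K → Prop
  | base (s t : Term Op K) (h : s(s, t) ∈ E) : CC F E s t
  | assoc (f : Op) (xs ys zs : List (Term Op K)) (hf : f ∈ F.assoc)
      (hl : F.WF (Term.app f (xs ++ Term.app f ys :: zs))) :
      CC F E (Term.app f (xs ++ Term.app f ys :: zs)) (Term.app f (xs ++ ys ++ zs))
  | refl (s : Term Op K) (h : F.WF s) : CC F E s s
  | symm (s t : Term Op K) (h : CC F E s t) : CC F E t s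
  | trans (s t u : Term Op K) (h₁ : CC F E s t) (h₂ : CC F E t u) : CC F E s u
  | congr (g : Op) (ss ts : List (Term Op K)) (har : F.ArityOK g ss.length)
      (hlen : ss.length = ts.length)
      (h : ∀ (i : ℕ) (hi : i < ss.length), CC F E ss[i] (ts[i]'(hlen ▸ hi))) :
      CC F E (Term.app g ss) (Term.app g ts)

/-- Equality of ground terms modulo associativity. -/
def EqA {Op K : Type} (F : Signature Op) (s t : Term Op K) : Prop := CC F ∅ s t

/-- An algebra: a carrier with an interpretation of the constants and of the function symbols.
(The value of `op g` matters only on lists of an admissible length.) -/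
structure Alg (Op K : Type) where
  carrier : Type
  cst : K → carrier
  op : Op → List carrier → carrier

mutual
/-- The value of a ground term in an algebra. -/
def Alg.eval {Op K : Type} (M : Alg Op K) : Term Op K → M.carrier
  | Term.const c => M.cst c
  | Term.app g ts => M.op g (Alg.evalArgs M ts)
/-- The values of a list of ground terms. -/
def Alg.evalArgs {Op K : Type} (M : Alg Op K) : List (Term Op K) → List M.carrier
  | [] => []
  | t :: ts => Alg.eval M t :: Alg.evalArgs M ts
end

/-- `M` satisfies the associativity axioms of all associative symbols. -/
def Alg.ModelsA {Op K : Type} (F : Signature Op) (M : Alg Op K) : Prop :=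
  ∀ f ∈ F.assoc, ∀ xs ys zs : List M.carrier,
    2 ≤ ys.length → 2 ≤ xs.length + zs.length + 1 →
      M.op f (xs ++ M.op f ys :: zs) = M.op f (xs ++ ys ++ zs)

/-- `Follows F E s t` is `s ≈_E^A t`: `s` and `t` have the same value in every model of `E ∪ A`. -/
def Follows {Op K : Type} (F : Signature Op) (E : Set (Eqn Op K)) (s t : Term Op K) : Prop :=
  ∀ M : Alg Op K, M.ModelsA F → (∀ p q : Term Op K, s(p, q) ∈ E → M.eval p = M.eval q) →
    M.eval s = M.eval t

/-- A relation on ground terms is decidable if some computable predicate on pairs of words agrees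
with it on the words of ground terms. -/
def DecidableOnTerms {Op K : Type} [Primcodable Op] [Primcodable K] (F : Signature Op)
    (R : Term Op K → Term Op K → Prop) : Prop :=
  ∃ P : List (Op ⊕ K ⊕ Unit) × List (Op ⊕ K ⊕ Unit) → Prop, ComputablePred P ∧
    ∀ s t : Term Op K, F.WF s → F.WF t → (P (s.word, t.word) ↔ R s t)

/-! ### Flattening with new constants -/

/-- The constants available: the original ones, `C₀`, and new ones `c₀, c₁, c₂, …`.  The order is
the precedence: an original constant is smaller than every new one, and `cⱼ < cᵢ` if `i < j`. -/
abbrev Const (C₀ : Type) : Type := C₀ ⊕ₗ ℕᵒᵈ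

/-- The new constant `cᵢ`. -/
def newConst {C₀ : Type} (i : ℕ) : Const C₀ := Sum.inrₗ (OrderDual.toDual i)

/-- A term over the original constants, read as a term over all constants. -/
def lift {Op C₀ : Type} (t : Term Op C₀) : Term Op (Const C₀) := t.map Sum.inlₗ

/-- Equations between two constants. -/
def ConstEqn {Op K : Type} (e : Eqn Op K) : Prop :=
  ∃ c d : K, e = s(Term.const c, Term.const d)

/-- `D`-flat equations `g(c₁, …, cₙ) ≈ c`. -/
def DFlatEqn {Op K : Type} (e : Eqn Op K) : Prop :=
  ∃ (g : Op) (u : List K) (c : K), e = s(Term.ofString g u, Term.const c)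

/-- `A`-flat equations `f(c₁, …, cₘ) ≈ f(d₁, …, dₙ)`, `f` associative. -/
def AFlatEqn {Op K : Type} (F : Signature Op) (e : Eqn Op K) : Prop :=
  ∃ f ∈ F.assoc, ∃ u v : List K, e = s(Term.ofString f u, Term.ofString f v)

/-- One step of flattening a set of equations.  In an equation that is not `A`-flat, one occurrence
of a flat term `t = g(c₁, …, cₙ)` is replaced by a new constant `c`: either by one that does not
occur yet, in which case `t ≈ c` is added, or by one for which `t ≈ c` is already present as
another equation. -/
inductive FlattenStep {Op C₀ : Type} (F : Signature Op) :
    Set (Eqn Op (Const C₀)) → Set (Eqn Op (Const C₀)) → Prop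
  | name (S : Set (Eqn Op (Const C₀))) (p p' q : Term Op (Const C₀)) (g : Op)
      (u : List (Const C₀)) (i : ℕ) (he : s(p, q) ∈ S) (hA : ¬ AFlatEqn F s(p, q))
      (hfresh : ∀ e ∈ S, ∀ t ∈ e, ¬ Term.HasConst (newConst i) t)
      (hp : Term.Replace (Term.ofString g u) (Term.const (newConst i)) p p') :
      FlattenStep F S
        ((S \ {s(p, q)}) ∪ {s(p', q), s(Term.ofString g u, Term.const (newConst i))})
  | reuse (S : Set (Eqn Op (Const C₀))) (p p' q : Term Op (Const C₀)) (g : Op)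
      (u : List (Const C₀)) (i : ℕ) (he : s(p, q) ∈ S) (hA : ¬ AFlatEqn F s(p, q))
      (hmem : s(Term.ofString g u, Term.const (newConst i)) ∈ S)
      (hne : s(p, q) ≠ s(Term.ofString g u, Term.const (newConst i)))
      (hp : Term.Replace (Term.ofString g u) (Term.const (newConst i)) p p') :
      FlattenStep F S ((S \ {s(p, q)}) ∪ {s(p', q)})

/-- `FlatteningOf F E S`: the set `S` is a possible value of `S(E)`.  The terms of `E` are first
flattened associatively; then flattening steps are made until only constant, `D`-flat and
`A`-flat equations are left. -/
def FlatteningOf {Op C₀ : Type} (F : Signature Op) (E : Set (Eqn Op C₀))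
    (S : Set (Eqn Op (Const C₀))) : Prop :=
  Relation.ReflTransGen (FlattenStep F)
    (Sym2.map (fun t : Term Op C₀ => (lift t).flatten F) '' E) S ∧
  ∀ e ∈ S, ConstEqn e ∨ DFlatEqn e ∨ AFlatEqn F e

/-! ### Ground completion -/

/-- The ordering `s ≻ t` on flat ground terms: constants are compared by precedence, a term headed
by a function symbol is greater than every constant, and for an associative `f` the terms `f(u)`,
`f(v)` are compared by the length-lexicographic ordering of the strings `u`, `v`. -/
inductive TermGT {Op K : Type} [LinearOrder K] (F : Signature Op) :
    Term Op K → Term Op K → Prop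
  | const (c d : K) (h : d < c) : TermGT F (Term.const c) (Term.const d)
  | app (g : Op) (ts : List (Term Op K)) (c : K) : TermGT F (Term.app g ts) (Term.const c)
  | string (f : Op) (u v : List K) (hf : f ∈ F.assoc) (hu : 2 ≤ u.length) (hv : 2 ≤ v.length)
      (h : v.length < u.length ∨ (v.length = u.length ∧ List.Lex (· < ·) v u)) :
      TermGT F (Term.ofString f u) (Term.ofString f v)

/-- The instances of the inference rules.  `Inference F P D N` means that some rule has an instance
with set of premises `P` that deletes the equations in `D` and adds those in `N`.
A nonempty string `v` stands for the flat term `f̄(v)`, which is a constant or of the form `f(v)`,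
so that `f(u₁t)` with `t = f̄(v)` is `f(u₁v)`. -/
inductive Inference {Op K : Type} [LinearOrder K] (F : Signature Op) :
    Set (Eqn Op K) → Set (Eqn Op K) → Set (Eqn Op K) → Prop
  | deduce (f : Op) (u₁ u₂ u₃ v w : List K) (hf : f ∈ F.assoc)
      (h₁ : u₁ ≠ []) (h₂ : u₂ ≠ []) (h₃ : u₃ ≠ []) (hv : v ≠ []) (hw : w ≠ [])
      (hgt₁ : TermGT F (Term.ofString f (u₁ ++ u₂)) (Term.ofStringBar f w))
      (hgt₂ : TermGT F (Term.ofString f (u₂ ++ u₃)) (Term.ofStringBar f v)) :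
      Inference F
        {s(Term.ofString f (u₁ ++ u₂), Term.ofStringBar f w),
          s(Term.ofString f (u₂ ++ u₃), Term.ofStringBar f v)}
        ∅
        {s(Term.ofString f (u₁ ++ v), Term.ofString f (w ++ u₃))}
  | simplify (f : Op) (u₁ u₂ u₃ v : List K) (s : Term Op K) (hf : f ∈ F.assoc)
      (h₂ : 2 ≤ u₂.length) (hv : v ≠ [])
      (hgt : TermGT F (Term.ofString f u₂) (Term.ofStringBar f v))
      (htop : u₁ ++ u₃ = [] → TermGT F s (Term.ofStringBar f v)) :
      Inference F
        {s(Term.ofString f (u₁ ++ u₂ ++ u₃), s), s(Term.ofString f u₂, Term.ofStringBar f v)}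
        {s(Term.ofString f (u₁ ++ u₂ ++ u₃), s)}
        {s(Term.ofStringBar f (u₁ ++ v ++ u₃), s)}
  | collapse (s s' t u : Term Op K) (d : K) (hs : Term.Replace u (Term.const d) s s')
      (hgt₁ : TermGT F s t) (hgt₂ : TermGT F u (Term.const d))
      (hu : ∀ f ∈ F.assoc, ∀ ts : List (Term Op K), u ≠ Term.app f ts)
      (htop : s = u → TermGT F t (Term.const d)) :
      Inference F {s(s, t), s(u, Term.const d)} {s(s, t)} {s(s', t)}
  | compose (t : Term Op K) (c d : K) (hgt₁ : TermGT F t (Term.const c))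
      (hgt₂ : TermGT F (Term.const c : Term Op K) (Term.const d)) :
      Inference F {s(t, Term.const c), s(Term.const c, Term.const d)} {s(t, Term.const c)}
        {s(t, Term.const d)}
  | delete (s : Term Op K) : Inference F {s(s, s)} {s(s, s)} ∅

/-- A derivation `S 0 ⊢ S 1 ⊢ S 2 ⊢ ⋯`.  Steps that do nothing are allowed, so that finite
derivations are included (the last set being repeated forever). -/
def IsDerivation {Op K : Type} [LinearOrder K] (F : Signature Op)
    (S : ℕ → Set (Eqn Op K)) : Prop :=
  ∀ i, S (i + 1) = S i ∨
    ∃ P D N : Set (Eqn Op K), Inference F P D N ∧ P ⊆ S i ∧ S (i + 1) = (S i \ D) ∪ N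

/-- A derivation is fair if every instance of a rule that is enabled at all stages from some stage
on (its premises are present and its application has an effect) is applied at some stage. -/
def IsFair {Op K : Type} [LinearOrder K] (F : Signature Op) (S : ℕ → Set (Eqn Op K)) : Prop :=
  ∀ P D N : Set (Eqn Op K), Inference F P D N →
    (∃ i, ∀ j ≥ i, P ⊆ S j ∧ (S j \ D) ∪ N ≠ S j) →
    ∃ j, P ⊆ S j ∧ S (j + 1) = (S j \ D) ∪ N

/-- The set `⋃ᵢ ⋂_{j ≥ i} S j` of persisting equations. -/
def persisting {Op K : Type} (S : ℕ → Set (Eqn Op K)) : Set (Eqn Op K) :=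
  {e | ∃ i, ∀ j ≥ i, e ∈ S j}

/-- The rewrite system that consists of the rules `l → r` with `l ≈ r` in `S` and `l ≻ r`. -/
def orient {Op K : Type} [LinearOrder K] (F : Signature Op) (S : Set (Eqn Op K)) :
    Set (Term Op K × Term Op K) :=
  {ρ | s(ρ.1, ρ.2) ∈ S ∧ TermGT F ρ.1 ρ.2}

/-! ### Rewriting modulo associativity -/

/-- The rewrite relation `R/A` of a ground rewrite system `R`: `p →_{R/A} q` if there are `s`, `t`
with `p ≈_A s →_R t ≈_A q`. -/
def RewriteModA {Op K : Type} (F : Signature Op) (R : Set (Term Op K × Term Op K))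
    (p q : Term Op K) : Prop :=
  ∃ s t : Term Op K, EqA F p s ∧ (∃ ρ ∈ R, Term.Replace ρ.1 ρ.2 s t) ∧ EqA F t q

/-- `q` is a normal form of `p` with respect to `R/A`. -/
def IsNormalFormOf {Op K : Type} (F : Signature Op) (R : Set (Term Op K × Term Op K))
    (p q : Term Op K) : Prop :=
  Relation.ReflTransGen (RewriteModA F R) p q ∧ ∀ r : Term Op K, ¬ RewriteModA F R q r

/-- `p` and `q` have the same `R/A`-normal form: both have a normal form, and each normal form
of `p` equals each normal form of `q` modulo associativity. -/
def SameNormalForm {Op K : Type} (F : Signature Op) (R : Set (Term Op K × Term Op K))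
    (p q : Term Op K) : Prop :=
  (∃ p', IsNormalFormOf F R p p') ∧ (∃ q', IsNormalFormOf F R q q') ∧
    ∀ p' q', IsNormalFormOf F R p p' → IsNormalFormOf F R q q' → EqA F p' q'

/-! ### Basic facts about terms -/

-- The proof turns rewriting modulo $A$ into string rewriting. A term is written as a word
-- (`Term.enc`) in which each letter carries the symbol above it as a tag and nested occurrences of
-- the same associative symbol share one pair of brackets. Two terms are equal modulo $A$ exactly
-- when their words coincide (`EqA.enc`, `eqA_of_enc`). Thanks to the tags, a rule $f(u)\to\bar
-- f(v)$ becomes the plain string rule $u\to v$ on letters tagged $f$; auxiliary rules erase the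
-- brackets around a single constant, which such a step may leave behind.
--
-- Although the precedence on new constants descends forever, only a finite set `Z` of constants
-- occurs after flattening, and completion adds none. Hence these constants can be digits in a base
-- `B`, and the numerical value of a word is a weight that realises the length-lexicographic order
-- and is strictly monotone in contexts. Every word step lowers it, so the system terminates.
--
-- Confluence follows by connectedness below: a terminating system has unique normal forms if the
-- ends of each peak are linked through elements lighter than the peak (`normal_unique`). Two facts
-- provide these links. First, every equation that is ever present has a proof by persisting rules
-- through words no heavier than its heavier side (`IsDerivation.hasProof`), by induction on the
-- pair of weights of its sides in the multiset order: a deleted equation is replaced by smaller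
-- ones. Second, fairness makes the conclusion of each inference between persisting rules appear at
-- some stage. COLLAPSE and SIMPLIFY take care of nested left-hand sides (`inclusion_linked`),
-- DEDUCE of proper overlaps (`overlap_linked`).
--
-- So congruent terms have the same normal form. The converse is semantic: a model of $E\cup A$
-- extends to the new constants, inferences and rewriting preserve values, and a term algebra shows
-- that equality in all models is $CC^A(E)$ (`follows_iff_cc`). If finitely many equations persist,
-- the word rules form a finite terminating string rewriting system, and comparing normal forms of
-- words is primitive recursive.

theorem Term.induction {Op K : Type} {P : Term Op K → Prop} (hc : ∀ c, P (Term.const c))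
    (ha : ∀ g ts, (∀ t ∈ ts, P t) → P (Term.app g ts)) (t : Term Op K) : P t := by
  refine Term.rec (motive_1 := P) (motive_2 := fun ts => ∀ t ∈ ts, P t) hc
    (fun g ts h => ha g ts h) (by simp) (fun t ts h hs => ?_) t
  simpa using ⟨h, hs⟩

section Basics

variable {Op K : Type} {F : Signature Op}

theorem Signature.WF.app_iff {g : Op} {ts : List (Term Op K)} :
    F.WF (Term.app g ts) ↔ F.ArityOK g ts.length ∧ ∀ t ∈ ts, F.WF t := by
  constructor
  · rintro (_ | ⟨_, _, h, h'⟩)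
    exact ⟨h, h'⟩
  · rintro ⟨h, h'⟩
    exact .app _ _ h h'

theorem arityOK_assoc {f : Op} (hf : f ∈ F.assoc) {n : ℕ} : F.ArityOK f n ↔ 2 ≤ n := by
  simp [Signature.ArityOK, hf]

theorem Term.flattenArgs_eq (g : Op) (ts : List (Term Op K)) :
    Term.flattenArgs F g ts = ts.flatMap fun t => Term.splice F g (Term.flatten F t) := by
  induction ts with
  | nil => simp [Term.flattenArgs]
  | cons t ts ih => simp [Term.flattenArgs, ih]

theorem Term.mapArgs_eq {K' : Type} (h : K → K') (ts : List (Term Op K)) :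
    Term.mapArgs h ts = ts.map (Term.map h) := by
  induction ts with
  | nil => simp [Term.mapArgs]
  | cons t ts ih => simp [Term.mapArgs, ih]

theorem Term.wordArgs_eq (ts : List (Term Op K)) :
    Term.wordArgs ts = ts.flatMap Term.word := by
  induction ts with
  | nil => simp [Term.wordArgs]
  | cons t ts ih => simp [Term.wordArgs, ih]

theorem Alg.evalArgs_eq (M : Alg Op K) (ts : List (Term Op K)) :
    Alg.evalArgs M ts = ts.map M.eval := by
  induction ts with
  | nil => simp [Alg.evalArgs]
  | cons t ts ih => simp [Alg.evalArgs, ih]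

theorem Alg.eval_app (M : Alg Op K) (g : Op) (ts : List (Term Op K)) :
    M.eval (Term.app g ts) = M.op g (ts.map M.eval) := by
  rw [Alg.eval, Alg.evalArgs_eq]

theorem Alg.eval_ofString (M : Alg Op K) (g : Op) (u : List K) :
    M.eval (Term.ofString g u) = M.op g (u.map M.cst) := by
  rw [Term.ofString, Alg.eval_app, List.map_map]
  rfl

theorem wf_ofString {g : Op} {u : List K} :
    F.WF (Term.ofString g u) ↔ F.ArityOK g u.length := by
  rw [Term.ofString, Signature.WF.app_iff, List.length_map]
  refine ⟨fun h => h.1, fun h => ⟨h, fun t ht => ?_⟩⟩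
  obtain ⟨c, _, rfl⟩ := List.mem_map.1 ht
  exact .const c

theorem Term.map_wf {K' : Type} (h : K → K') {t : Term Op K} (ht : F.WF t) :
    F.WF (t.map h) := by
  induction t using Term.induction with
  | hc c => simpa [Term.map] using .const _
  | ha g ts ih =>
    rw [Signature.WF.app_iff] at ht
    rw [Term.map, Term.mapArgs_eq, Signature.WF.app_iff]
    simpa using ⟨ht.1, fun t h' => ih t h' (ht.2 t h')⟩

theorem Term.Replace.wf {u v s s' : Term Op K} (h : Term.Replace u v s s') (hs : F.WF s)
    (hv : F.WF v) : F.WF s' := by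
  induction h with
  | top => exact hv
  | arg g xs ys a b h ih =>
    rw [Signature.WF.app_iff] at hs ⊢
    simp only [List.mem_append, List.mem_cons, List.length_append, List.length_cons] at hs ⊢
    refine ⟨hs.1, ?_⟩
    rintro t (ht | rfl | ht)
    · exact hs.2 t (.inl ht)
    · exact ih (hs.2 a (.inr (.inl rfl)))
    · exact hs.2 t (.inr (.inr ht))

theorem Term.Replace.wf_sub {u v s s' : Term Op K} (h : Term.Replace u v s s') (hs : F.WF s) :
    F.WF u := by
  induction h with
  | top => exact hs
  | arg g xs ys a b h ih =>
    rw [Signature.WF.app_iff] at hs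
    exact ih (hs.2 a (by simp))

theorem Alg.eval_replace (M : Alg Op K) {u v s s' : Term Op K} (h : Term.Replace u v s s')
    (huv : M.eval u = M.eval v) : M.eval s = M.eval s' := by
  induction h with
  | top => exact huv
  | arg g xs ys a b h ih => simp [Alg.eval_app, ih]

end Basics

/-! ### Congruence closure -/

section Closure

variable {Op K : Type} {F : Signature Op} {E : Set (Eqn Op K)}

theorem CC.wf (hE : ∀ e ∈ E, ∀ t ∈ e, F.WF t) {s t : Term Op K} (h : CC F E s t) :
    F.WF s ∧ F.WF t := by
  induction h with
  | base s t h => exact ⟨hE _ h _ (by simp), hE _ h _ (by simp)⟩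
  | assoc f xs ys zs hf hl =>
    refine ⟨hl, ?_⟩
    rw [Signature.WF.app_iff, arityOK_assoc hf] at hl ⊢
    have h2 := hl.2 (Term.app f ys) (by simp)
    rw [Signature.WF.app_iff, arityOK_assoc hf] at h2
    simp only [List.length_append, List.length_cons, List.mem_append, List.mem_cons] at hl ⊢
    refine ⟨by omega, ?_⟩
    rintro t ((ht | ht) | ht)
    · exact hl.2 t (.inl ht)
    · exact h2.2 t ht
    · exact hl.2 t (.inr (.inr ht))
  | refl s h => exact ⟨h, h⟩
  | symm s t h ih => exact ih.symm
  | trans s t u h₁ h₂ ih₁ ih₂ => exact ⟨ih₁.1, ih₂.2⟩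
  | congr g ss ts har hlen h ih =>
    refine ⟨.app _ _ har fun t ht => ?_, .app _ _ (hlen ▸ har) fun t ht => ?_⟩
    · obtain ⟨i, hi, rfl⟩ := List.mem_iff_getElem.1 ht
      exact (ih i hi).1
    · obtain ⟨i, hi, rfl⟩ := List.mem_iff_getElem.1 ht
      exact (ih i (hlen ▸ hi)).2

theorem EqA.wf {s t : Term Op K} (h : EqA F s t) : F.WF s ∧ F.WF t := CC.wf (by simp) h

theorem EqA.symm {s t : Term Op K} (h : EqA F s t) : EqA F t s := CC.symm _ _ h

theorem EqA.trans {s t u : Term Op K} (h : EqA F s t) (h' : EqA F t u) : EqA F s u :=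
  CC.trans _ _ _ h h'

theorem EqA.refl {s : Term Op K} (h : F.WF s) : EqA F s s := CC.refl _ h

theorem CC.mono {E' : Set (Eqn Op K)} (h : ∀ p q, s(p, q) ∈ E → CC F E' p q)
    {s t : Term Op K} (hst : CC F E s t) : CC F E' s t := by
  induction hst with
  | base s t hs => exact h s t hs
  | assoc f xs ys zs hf hl => exact .assoc f xs ys zs hf hl
  | refl s hs => exact .refl s hs
  | symm s t _ ih => exact .symm _ _ ih
  | trans s t u _ _ ih₁ ih₂ => exact .trans _ _ _ ih₁ ih₂
  | congr g ss ts har hlen _ ih => exact .congr g ss ts har hlen ih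

theorem EqA.cc {s t : Term Op K} (h : EqA F s t) : CC F E s t := CC.mono (by simp) h

theorem CC.congr_map {α : Type} (g : Op) (l : List α) (x y : α → Term Op K)
    (har : F.ArityOK g l.length) (h : ∀ a ∈ l, CC F E (x a) (y a)) :
    CC F E (Term.app g (l.map x)) (Term.app g (l.map y)) := by
  refine .congr g _ _ (by simpa using har) (by simp) fun i hi => ?_
  simp only [List.getElem_map]
  exact h _ (List.getElem_mem _)

theorem CC.congr_arg (g : Op) (xs ys : List (Term Op K)) {a b : Term Op K} (h : CC F E a b)
    (hwf : F.WF (Term.app g (xs ++ a :: ys))) :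
    CC F E (Term.app g (xs ++ a :: ys)) (Term.app g (xs ++ b :: ys)) := by
  rw [Signature.WF.app_iff] at hwf
  refine .congr g _ _ hwf.1 (by simp) fun i hi => ?_
  rcases lt_trichotomy i xs.length with hlt | rfl | hgt
  · rw [List.getElem_append_left hlt, List.getElem_append_left hlt]
    exact .refl _ (hwf.2 _ (by simp))
  · simpa using h
  · obtain ⟨k, rfl⟩ := Nat.exists_eq_add_of_lt hgt
    have hk : k < ys.length := by simp at hi; omega
    have e : ∀ c : Term Op K, ∀ h, (xs ++ c :: ys)[xs.length + k + 1]'h = ys[k] := by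
      intro c h
      rw [List.getElem_append_right (by omega)]
      simp [show xs.length + k + 1 - xs.length = k + 1 by omega]
    rw [e, e]
    exact .refl _ (hwf.2 _ (by simp))

theorem CC.replace {u v s s' : Term Op K} (h : Term.Replace u v s s') (huv : CC F E u v)
    (hs : F.WF s) : CC F E s s' := by
  induction h with
  | top => exact huv
  | arg g xs ys a b h ih =>
    refine CC.congr_arg g xs ys (ih ?_) hs
    rw [Signature.WF.app_iff] at hs
    exact hs.2 a (by simp)

/-- The prefix `xs` holds the arguments already treated. Each further argument headed by an
associative `g` costs one instance of the axiom; every other argument moves into the prefix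
unchanged. -/
theorem eqA_splice (g : Op) (us : List (Term Op K)) (xs : List (Term Op K))
    (h : F.WF (Term.app g (xs ++ us))) :
    EqA F (Term.app g (xs ++ us)) (Term.app g (xs ++ us.flatMap (Term.splice F g))) := by
  induction us generalizing xs with
  | nil => simpa using EqA.refl h
  | cons u us ih =>
    have hkeep : Term.splice F g u = [u] →
        EqA F (Term.app g (xs ++ u :: us))
          (Term.app g (xs ++ (u :: us).flatMap (Term.splice F g))) := by
      intro hu
      have := ih (xs ++ [u]) (by simpa using h)
      simpa [hu] using this
    cases u with
    | const c => exact hkeep rfl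
    | app g' ys =>
      by_cases hg : g' = g ∧ g ∈ F.assoc
      · obtain ⟨rfl, hg'⟩ := hg
        have h1 : EqA F _ _ := CC.assoc (E := ∅) g' xs ys us hg' h
        have := ih (xs ++ ys) (by simpa using h1.wf.2)
        refine h1.trans ?_
        simpa [Term.splice, hg'] using this
      · exact hkeep (by simp [Term.splice, hg])

theorem eqA_flatten {t : Term Op K} (ht : F.WF t) : EqA F t (t.flatten F) := by
  induction t using Term.induction with
  | hc c => simpa [Term.flatten] using EqA.refl ht
  | ha g ts ih =>
    rw [Signature.WF.app_iff] at ht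
    have h1 : EqA F (Term.app g (ts.map id)) (Term.app g (ts.map (Term.flatten F))) :=
      CC.congr_map g ts _ _ ht.1 fun a ha => ih a ha (ht.2 a ha)
    have h2 := eqA_splice (F := F) g (ts.map (Term.flatten F)) [] (by simpa using h1.wf.2)
    simp only [List.map_id] at h1
    refine h1.trans ?_
    rw [Term.flatten, Term.flattenArgs_eq]
    simpa [List.flatMap_map] using h2

theorem CC.eval {s t : Term Op K} (h : CC F E s t) (M : Alg Op K) (hM : M.ModelsA F)
    (hE : ∀ p q : Term Op K, s(p, q) ∈ E → M.eval p = M.eval q) : M.eval s = M.eval t := by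
  induction h with
  | base s t h => exact hE _ _ h
  | assoc f xs ys zs hf hl =>
    rw [Signature.WF.app_iff, arityOK_assoc hf] at hl
    have h2 := hl.2 (Term.app f ys) (by simp)
    rw [Signature.WF.app_iff, arityOK_assoc hf] at h2
    have h1 := hl.1
    simp only [List.length_append, List.length_cons] at h1
    have := hM f hf (xs.map M.eval) (ys.map M.eval) (zs.map M.eval) (by simpa using h2.1)
      (by simp; omega)
    simpa [Alg.eval_app] using this
  | refl s h => rfl
  | symm s t h ih => exact ih.symm
  | trans s t u h₁ h₂ ih₁ ih₂ => exact ih₁.trans ih₂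
  | congr g ss ts har hlen h ih =>
    rw [Alg.eval_app, Alg.eval_app]
    congr 1
    refine List.ext_getElem (by simpa using hlen) fun i h1 h2 => ?_
    simpa using ih i (by simpa using h1)

theorem EqA.eval {s t : Term Op K} (h : EqA F s t) (M : Alg Op K) (hM : M.ModelsA F) :
    M.eval s = M.eval t := CC.eval h M hM (by simp)

/-- Congruence modulo `CC F E` on the ground terms. -/
def termSetoid (F : Signature Op) (E : Set (Eqn Op K)) : Setoid {t : Term Op K // F.WF t} where
  r s t := CC F E s.1 t.1
  iseqv := ⟨fun s => .refl _ s.2, fun h => .symm _ _ h, fun h h' => .trans _ _ _ h h'⟩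

open Classical in
/-- The algebra of ground terms modulo `CC F E`; `d` is the value of ill-formed applications. -/
noncomputable def termAlg (F : Signature Op) (E : Set (Eqn Op K))
    (d : {t : Term Op K // F.WF t}) : Alg Op K where
  carrier := Quotient (termSetoid F E)
  cst c := Quotient.mk (termSetoid F E) ⟨Term.const c, .const c⟩
  op g l := if h : F.ArityOK g l.length then
      Quotient.mk (termSetoid F E) ⟨Term.app g (l.map fun q => q.out.1), by
        rw [Signature.WF.app_iff]
        refine ⟨by simpa using h, fun t ht => ?_⟩
        obtain ⟨q, _, rfl⟩ := List.mem_map.1 ht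
        exact q.out.2⟩
    else Quotient.mk (termSetoid F E) d

/-- The element of the term algebra that is represented by a ground term. -/
def termCls (F : Signature Op) (E : Set (Eqn Op K)) (d : {t : Term Op K // F.WF t})
    (t : {t : Term Op K // F.WF t}) : (termAlg F E d).carrier :=
  Quotient.mk (termSetoid F E) t

theorem termCls_eq {d s t : {t : Term Op K // F.WF t}} :
    termCls F E d s = termCls F E d t ↔ CC F E s.1 t.1 :=
  ⟨fun h => Quotient.exact (s := termSetoid F E) h,
    fun h => Quotient.sound (s := termSetoid F E) h⟩

theorem exists_termCls {d : {t : Term Op K // F.WF t}} (x : (termAlg F E d).carrier) :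
    ∃ t, termCls F E d t = x := Quotient.exists_rep (s := termSetoid F E) x

theorem exists_termCls_list {d : {t : Term Op K // F.WF t}}
    (l : List (termAlg F E d).carrier) : ∃ l' : List _, l'.map (termCls F E d) = l := by
  induction l with
  | nil => exact ⟨[], rfl⟩
  | cons x l ih =>
    obtain ⟨l', rfl⟩ := ih
    obtain ⟨t, rfl⟩ := exists_termCls x
    exact ⟨t :: l', rfl⟩

/-- The operations are defined through chosen representatives, so independence of the choice has to
be proved; it is closure under congruence. -/
theorem termAlg_op (d : {t : Term Op K // F.WF t}) (g : Op)
    (l : List {t : Term Op K // F.WF t}) (h : F.WF (Term.app g (l.map Subtype.val))) :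
    (termAlg F E d).op g (l.map (termCls F E d)) =
      termCls F E d ⟨Term.app g (l.map Subtype.val), h⟩ := by
  have har := (Signature.WF.app_iff.1 h).1
  simp only [List.length_map] at har
  have har' : F.ArityOK g (l.map (termCls F E d)).length := by simpa using har
  refine (dif_pos har').trans ?_
  refine Quotient.sound (s := termSetoid F E) ?_
  change CC F E (Term.app g (List.map _ (List.map (Quotient.mk (termSetoid F E)) l)))
    (Term.app g (l.map Subtype.val))
  rw [List.map_map]
  refine CC.congr_map g l _ _ har fun a _ => ?_
  exact Quotient.exact (s := termSetoid F E) (Quotient.out_eq (Quotient.mk (termSetoid F E) a))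

theorem termAlg_eval (d : {t : Term Op K // F.WF t}) (t : Term Op K) (ht : F.WF t) :
    (termAlg F E d).eval t = termCls F E d ⟨t, ht⟩ := by
  induction t using Term.induction with
  | hc c => rw [Alg.eval]; rfl
  | ha g ts ih =>
    have h' := (Signature.WF.app_iff.1 ht).2
    rw [Alg.eval_app]
    have e1 : ts = (ts.attach.map fun x => (⟨x.1, h' x.1 x.2⟩ : {t : Term Op K // F.WF t})).map
        Subtype.val := by simp
    have e2 : ts.map (termAlg F E d).eval =
        (ts.attach.map fun x => (⟨x.1, h' x.1 x.2⟩ : {t : Term Op K // F.WF t})).map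
          (termCls F E d) := by
      rw [List.map_map]
      conv_lhs => rw [← List.attach_map_subtype_val ts, List.map_map]
      refine List.map_congr_left fun x _ => ?_
      exact ih x.1 x.2 (h' x.1 x.2)
    rw [e2, termAlg_op d g _ (e1 ▸ ht)]
    congr 2
    rw [← e1]

theorem termAlg_modelsA (d : {t : Term Op K // F.WF t}) : (termAlg F E d).ModelsA F := by
  intro f hf xs ys zs hy hx
  obtain ⟨xs, rfl⟩ := exists_termCls_list xs
  obtain ⟨ys, rfl⟩ := exists_termCls_list ys
  obtain ⟨zs, rfl⟩ := exists_termCls_list zs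
  have wf : ∀ l : List {t : Term Op K // F.WF t}, 2 ≤ l.length →
      F.WF (Term.app f (l.map Subtype.val)) := by
    intro l hl
    rw [Signature.WF.app_iff, arityOK_assoc hf]
    refine ⟨by simpa using hl, fun t ht => ?_⟩
    obtain ⟨q, _, rfl⟩ := List.mem_map.1 ht
    exact q.2
  simp only [List.length_map] at hy hx
  rw [termAlg_op d f ys (wf ys hy)]
  have h1 := termAlg_op (E := E) d f
    (xs ++ ⟨Term.app f (ys.map Subtype.val), wf ys hy⟩ :: zs) (wf _ (by simp; omega))
  have h2 := termAlg_op (E := E) d f (xs ++ ys ++ zs) (wf _ (by simp; omega))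
  rw [← List.map_cons, ← List.map_append, ← List.map_append, ← List.map_append, h1, h2,
    termCls_eq]
  have := wf (xs ++ ⟨Term.app f (ys.map Subtype.val), wf ys hy⟩ :: zs) (by simp; omega)
  simp only [List.map_append, List.map_cons] at this ⊢
  exact CC.assoc f _ _ _ hf this

/-- Birkhoff's argument: the ground terms modulo `CC F E` form a model of $E\cup A$ in which every
term denotes its own class. The term `s` also serves as the irrelevant default value. -/
theorem follows_iff_cc (hE : ∀ e ∈ E, ∀ t ∈ e, F.WF t) {s t : Term Op K} (hs : F.WF s)
    (ht : F.WF t) : Follows F E s t ↔ CC F E s t := by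
  refine ⟨fun h => ?_, fun h M hM hME => h.eval M hM hME⟩
  have := h (termAlg F E ⟨s, hs⟩) (termAlg_modelsA _) fun p q hpq => by
    rw [termAlg_eval _ p (hE _ hpq _ (by simp)), termAlg_eval _ q (hE _ hpq _ (by simp)),
      termCls_eq]
    exact CC.base p q hpq
  rwa [termAlg_eval _ s hs, termAlg_eval _ t ht, termCls_eq] at this

end Closure

/-! ### Terms as tagged words -/

/-- The letters of the words that encode terms modulo associativity: a constant or an opening
symbol, each tagged with the symbol above it (`none` at the root), and a closing bracket. -/
abbrev Letter (Op K : Type) : Type := Option (Option Op × (K ⊕ Op))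

namespace Letter

/-- The constant `c` below the symbol `τ`. -/
abbrev cst {Op K : Type} (τ : Option Op) (c : K) : Letter Op K := some (τ, Sum.inl c)

/-- The opening symbol `g` below the symbol `τ`. -/
abbrev opn {Op K : Type} (τ : Option Op) (g : Op) : Letter Op K := some (τ, Sum.inr g)

/-- The closing bracket. -/
abbrev cls {Op K : Type} : Letter Op K := none

end Letter

open Classical in
mutual
/-- The word of a term below the symbol `τ`; nested associative symbols are merged. -/
noncomputable def Term.enc {Op K : Type} (F : Signature Op) :
    Option Op → Term Op K → List (Letter Op K)
  | τ, Term.const c => [Letter.cst τ c]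
  | τ, Term.app g ts => if g ∈ F.assoc ∧ τ = some g then Term.encArgs F g ts
      else Letter.opn τ g :: (Term.encArgs F g ts ++ [Letter.cls])
/-- The word of an argument list below the symbol `g`. -/
noncomputable def Term.encArgs {Op K : Type} (F : Signature Op) (g : Op) :
    List (Term Op K) → List (Letter Op K)
  | [] => []
  | t :: ts => Term.enc F (some g) t ++ Term.encArgs F g ts
end

section Encoding

variable {Op K : Type} {F : Signature Op}

theorem Term.encArgs_eq (g : Op) (ts : List (Term Op K)) :
    Term.encArgs F g ts = ts.flatMap (Term.enc F (some g)) := by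
  induction ts with
  | nil => simp [Term.encArgs]
  | cons t ts ih => simp [Term.encArgs, ih]

theorem Term.enc_const (τ : Option Op) (c : K) :
    (Term.const c).enc F τ = [Letter.cst τ c] := by simp [Term.enc]

theorem Term.enc_app_merge {f : Op} (hf : f ∈ F.assoc) (ts : List (Term Op K)) :
    (Term.app f ts).enc F (some f) = ts.flatMap (Term.enc F (some f)) := by
  simp [Term.enc, hf, Term.encArgs_eq]

theorem Term.enc_app {g : Op} {τ : Option Op} (h : ¬ (g ∈ F.assoc ∧ τ = some g))
    (ts : List (Term Op K)) : (Term.app g ts).enc F τ =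
      Letter.opn τ g :: (ts.flatMap (Term.enc F (some g)) ++ [Letter.cls]) := by
  rw [Term.enc, if_neg h, Term.encArgs_eq]

/-- The word of a term is that of its argument list up to a prefix and a suffix. -/
theorem Term.exists_enc_app (g : Op) (τ : Option Op) : ∃ A B : List (Letter Op K), ∀ ts,
    (Term.app g ts).enc F τ = A ++ ts.flatMap (Term.enc F (some g)) ++ B := by
  by_cases h : g ∈ F.assoc ∧ τ = some g
  · obtain ⟨h, rfl⟩ := h
    exact ⟨[], [], fun ts => by simp [Term.enc_app_merge h]⟩
  · exact ⟨[Letter.opn τ g], [Letter.cls], fun ts => by simp [Term.enc_app h]⟩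

theorem Term.flatMap_const (τ : Option Op) (u : List K) :
    (u.map Term.const).flatMap (Term.enc F τ) = u.map (Letter.cst τ) := by
  induction u with
  | nil => rfl
  | cons c u ih => simp [Term.enc_const, ih]

theorem Term.Replace.enc {u v s s' : Term Op K} (h : Term.Replace u v s s') (τ : Option Op) :
    ∃ τ' A B, s.enc F τ = A ++ u.enc F τ' ++ B ∧ s'.enc F τ = A ++ v.enc F τ' ++ B := by
  induction h generalizing τ with
  | top => exact ⟨τ, [], [], by simp, by simp⟩
  | arg g xs ys a b h ih =>
    obtain ⟨τ', A, B, h₁, h₂⟩ := ih (some g)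
    obtain ⟨A', B', hAB⟩ := Term.exists_enc_app (F := F) (K := K) g τ
    refine ⟨τ', A' ++ xs.flatMap (Term.enc F (some g)) ++ A,
      B ++ ys.flatMap (Term.enc F (some g)) ++ B', ?_, ?_⟩ <;> simp [hAB, h₁, h₂]

/-- The words of terms that are congruent modulo `E` and associativity are related by every
congruence of words that relates the words of the equations in `E`. -/
theorem CC.enc {E : Set (Eqn Op K)} {r : List (Letter Op K) → List (Letter Op K) → Prop}
    (hr : Equivalence r) (hctx : ∀ a b x y, r x y → r (a ++ x ++ b) (a ++ y ++ b))
    (hbase : ∀ p q : Term Op K, s(p, q) ∈ E → ∀ τ, r (p.enc F τ) (q.enc F τ))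
    {s t : Term Op K} (h : CC F E s t) (τ : Option Op) : r (s.enc F τ) (t.enc F τ) := by
  induction h generalizing τ with
  | base s t h => exact hbase s t h τ
  | assoc f xs ys zs hf hl =>
    obtain ⟨A, B, hAB⟩ := Term.exists_enc_app (F := F) (K := K) f τ
    rw [hAB, hAB]
    -- Below `f` the inner `f` writes no brackets, so both sides of the axiom have literally the
    -- same word.
    simpa [Term.enc_app_merge hf] using hr.refl _
  | refl s h => exact hr.refl _
  | symm s t h ih => exact hr.symm (ih τ)
  | trans s t u h₁ h₂ ih₁ ih₂ => exact hr.trans (ih₁ τ) (ih₂ τ)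
  | congr g ss ts har hlen h ih =>
    obtain ⟨A, B, hAB⟩ := Term.exists_enc_app (F := F) (K := K) g τ
    rw [hAB, hAB]
    apply hctx
    have hall : List.Forall₂ (fun s t => r (Term.enc F (some g) s) (Term.enc F (some g) t))
        ss ts := List.forall₂_iff_get.2 ⟨hlen, fun i h₁ h₂ => by simpa using ih i h₁ (some g)⟩
    clear h ih har hlen
    induction hall with
    | nil => exact hr.refl _
    | @cons s t ss ts h₁ h₂ ih =>
      simp only [List.flatMap_cons]
      have e₁ := hctx [] (ss.flatMap (Term.enc F (some g))) _ _ h₁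
      have e₂ := hctx (t.enc F (some g)) [] _ _ ih
      simp only [List.nil_append, List.append_nil] at e₁ e₂
      exact hr.trans e₁ e₂

theorem EqA.enc {s t : Term Op K} (h : EqA F s t) (τ : Option Op) : s.enc F τ = t.enc F τ :=
  CC.enc (r := Eq) eq_equivalence (by rintro a b x _ rfl; rfl) (by simp) h τ

/-! ### Decoding -/

/-- `Decodes σ w σ'`: reading the word `w` takes the decoder from the stack `σ` to `σ'`.  An entry
of the stack holds a symbol and those of its arguments that have been read so far. -/
inductive Decodes : List (Option Op × List (Term Op K)) → List (Letter Op K) →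
    List (Option Op × List (Term Op K)) → Prop
  | nil (σ) : Decodes σ [] σ
  | cst (τ ts σ c w σ') (h : Decodes ((τ, ts ++ [Term.const c]) :: σ) w σ') :
      Decodes ((τ, ts) :: σ) (Letter.cst τ c :: w) σ'
  | opn (τ ts σ g w σ') (h : Decodes ((some g, []) :: (τ, ts) :: σ) w σ') :
      Decodes ((τ, ts) :: σ) (Letter.opn τ g :: w) σ'
  | cls (τ ts g us σ w σ') (h : Decodes ((τ, ts ++ [Term.app g us]) :: σ) w σ') :
      Decodes ((some g, us) :: (τ, ts) :: σ) (Letter.cls :: w) σ'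

theorem Decodes.append {σ σ' σ'' : List (Option Op × List (Term Op K))}
    {w w' : List (Letter Op K)} (h : Decodes σ w σ') (h' : Decodes σ' w' σ'') :
    Decodes σ (w ++ w') σ'' := by
  induction h with
  | nil => exact h'
  | cst τ ts σ c w σ' h ih => exact .cst _ _ _ _ _ _ (ih h')
  | opn τ ts σ g w σ' h ih => exact .opn _ _ _ _ _ _ (ih h')
  | cls τ ts g us σ w σ' h ih => exact .cls _ _ _ _ _ _ _ (ih h')

theorem Decodes.split {w w' : List (Letter Op K)} {σ σ'' : List (Option Op × List (Term Op K))}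
    (h : Decodes σ (w ++ w') σ'') : ∃ σ', Decodes σ w σ' ∧ Decodes σ' w' σ'' := by
  induction w generalizing σ with
  | nil => exact ⟨σ, .nil _, h⟩
  | cons a w ih =>
    rw [List.cons_append] at h
    cases h with
    | cst τ ts σ c w σ' h => exact (ih h).imp fun _ h => ⟨.cst _ _ _ _ _ _ h.1, h.2⟩
    | opn τ ts σ g w σ' h => exact (ih h).imp fun _ h => ⟨.opn _ _ _ _ _ _ h.1, h.2⟩
    | cls τ ts g us σ w σ' h => exact (ih h).imp fun _ h => ⟨.cls _ _ _ _ _ _ _ h.1, h.2⟩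

/-- The decoder is deterministic: the next letter decides which rule applies, and with the stack it
fixes the result. -/
theorem Decodes.unique {w : List (Letter Op K)} {σ σ₁ σ₂ : List (Option Op × List (Term Op K))}
    (h₁ : Decodes σ w σ₁) (h₂ : Decodes σ w σ₂) : σ₁ = σ₂ := by
  induction h₁ with
  | nil => cases h₂; rfl
  | cst τ ts σ c w σ' h ih => cases h₂ with | cst _ _ _ _ _ _ h => exact ih h
  | opn τ ts σ g w σ' h ih => cases h₂ with | opn _ _ _ _ _ _ h => exact ih h
  | cls τ ts g us σ w σ' h ih => cases h₂ with | cls _ _ _ _ _ _ _ h => exact ih h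

/-- The argument list that a flattened term contributes below `τ`. -/
noncomputable def spliceBelow (F : Signature Op) : Option Op → Term Op K → List (Term Op K)
  | none, t => [t]
  | some g, t => Term.splice F g t

/-- Decoding rebuilds the flattened term: the arguments of a merged symbol go directly to the open
entry of the same symbol, while a bracketed symbol opens its own entry. This is what makes words
faithful modulo $A$. -/
theorem decodes_enc (t : Term Op K) (τ : Option Op) (ts : List (Term Op K))
    (σ : List (Option Op × List (Term Op K))) :
    Decodes ((τ, ts) :: σ) (t.enc F τ) ((τ, ts ++ spliceBelow F τ (t.flatten F)) :: σ) := by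
  induction t using Term.induction generalizing τ ts σ with
  | hc c =>
    rw [Term.enc_const]
    cases τ <;> exact .cst _ _ _ _ _ _ (.nil _)
  | ha g us ih =>
    have hargs : ∀ (τ ts) (σ : List (Option Op × List (Term Op K))), τ = some g →
        Decodes ((τ, ts) :: σ) (us.flatMap (Term.enc F (some g)))
          ((τ, ts ++ us.flatMap fun t => Term.splice F g (t.flatten F)) :: σ) := by
      rintro τ ts σ rfl
      induction us generalizing ts with
      | nil => simpa using .nil _
      | cons u us ih' =>
        have h₁ := ih u (by simp) (some g) ts σ
        have h₂ := ih' (fun t ht => ih t (by simp [ht])) (ts ++ Term.splice F g (u.flatten F))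
        simpa using h₁.append h₂
    by_cases h : g ∈ F.assoc ∧ τ = some g
    · obtain ⟨hg, rfl⟩ := h
      rw [Term.enc_app_merge hg, Term.flatten, Term.flattenArgs_eq]
      simpa [spliceBelow, Term.splice, hg] using hargs (some g) ts σ rfl
    · rw [Term.enc_app h, Term.flatten, Term.flattenArgs_eq]
      refine .opn _ _ _ _ _ _ ((hargs _ _ _ rfl).append ?_)
      have : spliceBelow F τ (Term.app g (us.flatMap fun t => Term.splice F g (t.flatten F))) =
          [Term.app g (us.flatMap fun t => Term.splice F g (t.flatten F))] := by
        cases τ with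
        | none => rfl
        | some f =>
          simp only [spliceBelow, Term.splice]
          refine if_neg ?_
          rintro ⟨rfl, h'⟩
          exact h ⟨h', rfl⟩
      rw [this, List.nil_append]
      exact .cls _ _ _ _ _ _ _ (.nil _)

theorem eqA_of_enc {s t : Term Op K} (hs : F.WF s) (ht : F.WF t)
    (h : s.enc F none = t.enc F none) : EqA F s t := by
  have h₁ := decodes_enc (F := F) s none [] []
  rw [h] at h₁
  have h₂ := h₁.unique (decodes_enc t none [] [])
  simp only [spliceBelow, List.nil_append, List.cons.injEq, Prod.mk.injEq, and_true,
    true_and] at h₂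
  exact (eqA_flatten hs).trans (h₂ ▸ (eqA_flatten ht).symm)

/-- `Subterm s t`: the term `s` is a subterm of `t`. -/
inductive Subterm (s : Term Op K) : Term Op K → Prop
  | refl : Subterm s s
  | arg (g : Op) (ts : List (Term Op K)) (t : Term Op K) (ht : t ∈ ts) (h : Subterm s t) :
      Subterm s (Term.app g ts)

theorem Subterm.wf {s t : Term Op K} (h : Subterm s t) (ht : F.WF t) : F.WF s := by
  induction h with
  | refl => exact ht
  | arg g ts t h' h ih => exact ih ((Signature.WF.app_iff.1 ht).2 t h')

/-- The decoder never discards anything: terms stay in their entry or are wrapped when it closes. -/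
theorem Decodes.subterm {s : Term Op K} {w : List (Letter Op K)}
    {σ σ' : List (Option Op × List (Term Op K))} (h : Decodes σ w σ')
    (hs : ∃ e ∈ σ, ∃ t ∈ e.2, Subterm s t) : ∃ e ∈ σ', ∃ t ∈ e.2, Subterm s t := by
  induction h with
  | nil => exact hs
  | cst τ ts σ c w σ' h ih =>
    obtain ⟨e, he, t, ht, hst⟩ := hs
    refine ih ?_
    rcases List.mem_cons.1 he with rfl | he
    · exact ⟨_, List.mem_cons_self, t, List.mem_append_left _ ht, hst⟩
    · exact ⟨e, List.mem_cons_of_mem _ he, t, ht, hst⟩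
  | opn τ ts σ g w σ' h ih =>
    obtain ⟨e, he, t, ht, hst⟩ := hs
    exact ih ⟨e, List.mem_cons_of_mem _ he, t, ht, hst⟩
  | cls τ ts g us σ w σ' h ih =>
    obtain ⟨e, he, t, ht, hst⟩ := hs
    refine ih ?_
    rcases List.mem_cons.1 he with rfl | he
    · exact ⟨_, List.mem_cons_self, _, List.mem_append_right _ (List.mem_singleton_self _),
        .arg _ _ t ht hst⟩
    rcases List.mem_cons.1 he with rfl | he
    · exact ⟨_, List.mem_cons_self, t, List.mem_append_left _ ht, hst⟩
    · exact ⟨e, List.mem_cons_of_mem _ he, t, ht, hst⟩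

/-- An open entry only gains arguments on the right. If it closes, it becomes a term, which then
survives as a subterm. -/
theorem Decodes.entry {g : Op} {args : List (Term Op K)} {w : List (Letter Op K)}
    {σ σ' : List (Option Op × List (Term Op K))} (h : Decodes σ w σ')
    (hs : ∃ more, (some g, args ++ more) ∈ σ) :
    (∃ more, (some g, args ++ more) ∈ σ') ∨
      ∃ more, ∃ e ∈ σ', ∃ t ∈ e.2, Subterm (Term.app g (args ++ more)) t := by
  induction h with
  | nil => exact .inl hs
  | cst τ ts σ c w σ' h ih =>
    obtain ⟨more, hm⟩ := hs
    refine ih ?_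
    rcases List.mem_cons.1 hm with he | he
    · obtain ⟨rfl, rfl⟩ := Prod.mk.inj he
      exact ⟨more ++ [Term.const c], by simp⟩
    · exact ⟨more, List.mem_cons_of_mem _ he⟩
  | opn τ ts σ g w σ' h ih =>
    obtain ⟨more, hm⟩ := hs
    exact ih ⟨more, List.mem_cons_of_mem _ hm⟩
  | cls τ ts g' us σ w σ' h ih =>
    obtain ⟨more, hm⟩ := hs
    rcases List.mem_cons.1 hm with he | he
    · obtain ⟨h₁, rfl⟩ := Prod.mk.inj he
      obtain rfl := Option.some.inj h₁
      exact .inr ⟨more, h.subterm ⟨_, List.mem_cons_self, _,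
        List.mem_append_right _ (List.mem_singleton_self _), .refl⟩⟩
    refine ih ?_
    rcases List.mem_cons.1 he with he | he
    · obtain ⟨rfl, rfl⟩ := Prod.mk.inj he
      exact ⟨more ++ [Term.app g' us], by simp⟩
    · exact ⟨more, List.mem_cons_of_mem _ he⟩

/-- A constant is readable only if its tag is the symbol on top of the stack, so the first letter
already identifies the entry to which the whole string is appended. -/
theorem Decodes.string {τ : Option Op} {u : List K} (hu : u ≠ [])
    {σ σ' : List (Option Op × List (Term Op K))} (h : Decodes σ (u.map (Letter.cst τ)) σ') :
    ∃ ts σ₁, σ = (τ, ts) :: σ₁ ∧ σ' = (τ, ts ++ u.map Term.const) :: σ₁ := by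
  induction u generalizing σ with
  | nil => exact absurd rfl hu
  | cons c u ih =>
    rw [List.map_cons] at h
    cases h with
    | cst _ ts σ c w σ' h =>
      refine ⟨ts, σ, rfl, ?_⟩
      by_cases hu' : u = []
      · subst hu'
        cases h
        rfl
      · obtain ⟨ts', σ₁, e₁, e₂⟩ := ih hu' h
        simp only [List.cons.injEq, Prod.mk.injEq, true_and] at e₁
        obtain ⟨rfl, rfl⟩ := e₁
        simpa using e₂

/-- A stretch of constants in the word of a term comes from the argument list of a subterm of its
flattened form. -/
theorem exists_subterm_of_string {t : Term Op K} {f : Op} {u : List K} (hu : u ≠ [])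
    {a b : List (Letter Op K)} (h : t.enc F none = a ++ u.map (Letter.cst (some f)) ++ b) :
    ∃ xs ys, Subterm (Term.app f (xs ++ u.map Term.const ++ ys)) (t.flatten F) := by
  have hd := decodes_enc (F := F) t none [] []
  rw [h] at hd
  obtain ⟨σ₂, hd, hb⟩ := hd.split
  obtain ⟨σ₁, ha, hl⟩ := hd.split
  obtain ⟨ts, σ, rfl, rfl⟩ := hl.string hu
  rcases hb.entry ⟨[], by rw [List.append_nil]; exact List.mem_cons_self⟩ with
    ⟨more, hm⟩ | ⟨more, e, he, t', ht, hs⟩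
  -- The final stack consists of the root entry alone, tagged `none`, so an entry of `f` cannot
  -- still be open.
  · simp at hm
  · simp only [List.mem_singleton] at he
    subst he
    simp only [spliceBelow, List.nil_append, List.mem_singleton] at ht
    subst ht
    exact ⟨ts, more, hs⟩

theorem exists_subterm_of_cst {t : Term Op K} {τ : Option Op} {c : K}
    {a b : List (Letter Op K)} (h : t.enc F none = a ++ [Letter.cst τ c] ++ b) :
    Subterm (Term.const c) (t.flatten F) := by
  have hd := decodes_enc (F := F) t none [] []
  rw [h] at hd
  obtain ⟨σ₂, hd, hb⟩ := hd.split
  obtain ⟨σ₁, ha, hl⟩ := hd.split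
  obtain ⟨ts, σ, rfl, rfl⟩ := hl.string (u := [c]) (by simp)
  obtain ⟨e, he, t', ht, hs⟩ := hb.subterm ⟨_, List.mem_cons_self, Term.const c, by simp, .refl⟩
  simp only [List.mem_singleton] at he
  subst he
  simp only [spliceBelow, List.nil_append, List.mem_singleton] at ht
  exact ht ▸ hs

theorem exists_subterm_of_bracket {t : Term Op K} {τ : Option Op} {g : Op} {u : List K}
    (hu : u ≠ []) {a b : List (Letter Op K)} (h : t.enc F none =
      a ++ (Letter.opn τ g :: (u.map (Letter.cst (some g)) ++ [Letter.cls])) ++ b) :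
    Subterm (Term.ofString g u) (t.flatten F) := by
  have hd := decodes_enc (F := F) t none [] []
  rw [h] at hd
  obtain ⟨σ₂, hd, hb⟩ := hd.split
  obtain ⟨σ₁, ha, hl⟩ := hd.split
  cases hl with
  | opn _ ts σ g w σ' hl =>
    obtain ⟨σ₃, hl, hc⟩ := hl.split
    obtain ⟨ts', σ₄, e, rfl⟩ := hl.string hu
    simp only [List.cons.injEq, Prod.mk.injEq, true_and] at e
    obtain ⟨rfl, rfl⟩ := e
    cases hc with
    | cls _ _ _ _ _ _ _ hc =>
      cases hc
      obtain ⟨e, he, t', ht, hs⟩ := hb.subterm (s := Term.ofString g u)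
        ⟨_, List.mem_cons_self, _, List.mem_append_right _ (List.mem_singleton_self _), .refl⟩
      simp only [List.mem_singleton] at he
      subst he
      simp only [spliceBelow, List.nil_append, List.mem_singleton] at ht
      exact ht ▸ hs

end Encoding

/-! ### Weights of words -/

section Weight

variable {α : Type} (B : ℕ) (d : α → ℕ)

/-- The value of a word as a numeral in base `B`, the letter `a` being the digit `d a`. -/
def wordWeight : List α → ℕ
  | [] => 0
  | a :: w => d a * B ^ w.length + wordWeight w

theorem wordWeight_append (x y : List α) :
    wordWeight B d (x ++ y) = wordWeight B d x * B ^ y.length + wordWeight B d y := by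
  induction x with
  | nil => simp [wordWeight]
  | cons a x ih => simp [wordWeight, ih, pow_add]; ring

theorem wordWeight_map {β : Type} (φ : β → α) (w : List β) :
    wordWeight B d (w.map φ) = wordWeight B (fun b => d (φ b)) w := by
  induction w with
  | nil => rfl
  | cons a w ih => simp [wordWeight, ih]

variable {B d}

theorem wordWeight_lt_pow (hd : ∀ a, d a < B) (w : List α) :
    wordWeight B d w < B ^ w.length := by
  induction w with
  | nil => simp [wordWeight]
  | cons a w ih =>
    calc d a * B ^ w.length + wordWeight B d w < d a * B ^ w.length + B ^ w.length := by omega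
      _ = (d a + 1) * B ^ w.length := by ring
      _ ≤ B * B ^ w.length := Nat.mul_le_mul_right _ (hd a)
      _ = B ^ (a :: w).length := by rw [List.length_cons, pow_succ]; ring

theorem wordWeight_lt_of_length (hd : ∀ a, d a < B) (hd₀ : ∀ a, 0 < d a) {x y : List α}
    (h : x.length < y.length) : wordWeight B d x < wordWeight B d y := by
  cases y with
  | nil => simp at h
  | cons a y =>
    have hB : 0 < B := (hd₀ a).trans (hd a)
    calc wordWeight B d x < B ^ x.length := wordWeight_lt_pow hd x
      _ ≤ B ^ y.length := Nat.pow_le_pow_right hB (by simpa using Nat.lt_succ_iff.1 h)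
      _ ≤ d a * B ^ y.length := Nat.le_mul_of_pos_left _ (hd₀ a)
      _ ≤ _ := by simp [wordWeight]

/-- Without zero digits a longer numeral is larger. This controls the shift `B ^ length` of a prefix
when a factor to its right is exchanged, and so gives monotonicity in contexts. -/
theorem length_le_of_wordWeight (hd : ∀ a, d a < B) (hd₀ : ∀ a, 0 < d a) {x y : List α}
    (h : wordWeight B d x ≤ wordWeight B d y) : x.length ≤ y.length := by
  by_contra hlt
  exact absurd (wordWeight_lt_of_length hd hd₀ (not_le.1 hlt)) (not_lt.2 h)

theorem wordWeight_context_le (hd : ∀ a, d a < B) (hd₀ : ∀ a, 0 < d a) (a b : List α)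
    {x y : List α} (h : wordWeight B d x ≤ wordWeight B d y) :
    wordWeight B d (a ++ x ++ b) ≤ wordWeight B d (a ++ y ++ b) := by
  cases a with
  | nil =>
    simp only [List.nil_append, wordWeight_append]
    gcongr
  | cons c a =>
    have hB : 0 < B := (hd₀ c).trans (hd c)
    simp only [wordWeight_append]
    gcongr
    exact length_le_of_wordWeight hd hd₀ h

theorem wordWeight_context_lt (hd : ∀ a, d a < B) (hd₀ : ∀ a, 0 < d a) (a b : List α)
    {x y : List α} (h : wordWeight B d x < wordWeight B d y) :
    wordWeight B d (a ++ x ++ b) < wordWeight B d (a ++ y ++ b) := by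
  have hB : 0 < B := by
    cases y with
    | nil => simp [wordWeight] at h
    | cons c y => exact (hd₀ c).trans (hd c)
  have hlen := length_le_of_wordWeight hd hd₀ h.le
  simp only [wordWeight_append]
  have h₁ : wordWeight B d a * B ^ x.length ≤ wordWeight B d a * B ^ y.length := by gcongr
  have h₂ : (wordWeight B d a * B ^ x.length + wordWeight B d x) * B ^ b.length <
      (wordWeight B d a * B ^ y.length + wordWeight B d y) * B ^ b.length :=
    Nat.mul_lt_mul_of_pos_right (by omega) (by positivity)
  omega

theorem wordWeight_lt_of_lex {r : α → α → Prop} (hd : ∀ a, d a < B) {x y : List α}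
    (hr : ∀ a ∈ x, ∀ b ∈ y, r a b → d a < d b) (hlen : x.length = y.length)
    (h : List.Lex r x y) : wordWeight B d x < wordWeight B d y := by
  induction h with
  | nil => simp at hlen
  | @rel a x b y hab =>
    have h₁ := hr a (by simp) b (by simp) hab
    have h₂ := wordWeight_lt_pow hd x
    simp only [List.length_cons, Nat.add_right_cancel_iff] at hlen
    simp only [wordWeight]
    calc d a * B ^ x.length + wordWeight B d x < d a * B ^ x.length + B ^ x.length := by omega
      _ = (d a + 1) * B ^ y.length := by rw [hlen]; ring
      _ ≤ d b * B ^ y.length := Nat.mul_le_mul_right _ h₁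
      _ ≤ _ := Nat.le_add_right _ _
  | @cons a x y h ih =>
    simp only [List.length_cons, Nat.add_right_cancel_iff] at hlen
    have := ih (fun a ha b hb => hr a (by simp [ha]) b (by simp [hb])) hlen
    simpa [wordWeight, hlen] using this

end Weight

/-! ### Confluence from connectedness below -/

section Confluence

variable {W : Type} {Q : W → W → Prop} {μ : W → ℕ}

/-- `Linked Q μ m x y`: the elements `x` and `y` are equivalent modulo `Q` through elements of
weight less than `m`. -/
def Linked (Q : W → W → Prop) (μ : W → ℕ) (m : ℕ) : W → W → Prop :=
  Relation.ReflTransGen fun x y => (Q x y ∨ Q y x) ∧ μ x < m ∧ μ y < m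

theorem Linked.refl (m : ℕ) (x : W) : Linked Q μ m x x := Relation.ReflTransGen.refl

theorem Linked.trans {m : ℕ} {x y z : W} (h : Linked Q μ m x y) (h' : Linked Q μ m y z) :
    Linked Q μ m x z := Relation.ReflTransGen.trans h h'

theorem Linked.symm {m : ℕ} {x y : W} (h : Linked Q μ m x y) : Linked Q μ m y x := by
  induction h with
  | refl => exact Relation.ReflTransGen.refl
  | tail _ h ih => exact .head ⟨h.1.symm, h.2.2, h.2.1⟩ ih

theorem Linked.of_rel {m : ℕ} {x y : W} (h : Q x y) (hx : μ x < m) (hy : μ y < m) :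
    Linked Q μ m x y := Relation.ReflTransGen.single ⟨.inl h, hx, hy⟩

theorem Linked.mono {m m' : ℕ} (hm : m ≤ m') {x y : W} (h : Linked Q μ m x y) :
    Linked Q μ m' x y := by
  induction h with
  | refl => exact Relation.ReflTransGen.refl
  | tail _ h ih => exact .tail ih ⟨h.1, h.2.1.trans_le hm, h.2.2.trans_le hm⟩

theorem Linked.map {m m' : ℕ} (φ : W → W) (hφ : ∀ x y, Q x y → Q (φ x) (φ y))
    (hμ : ∀ x, μ x < m → μ (φ x) < m') {x y : W} (h : Linked Q μ m x y) :
    Linked Q μ m' (φ x) (φ y) := by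
  induction h with
  | refl => exact Relation.ReflTransGen.refl
  | tail _ h ih => exact .tail ih ⟨h.1.imp (hφ _ _) (hφ _ _), hμ _ h.2.1, hμ _ h.2.2⟩

theorem exists_normal (hdec : ∀ x y, Q x y → μ y < μ x) (x : W) :
    ∃ n, Relation.ReflTransGen Q x n ∧ ∀ y, ¬ Q n y := by
  induction h : μ x using Nat.strong_induction_on generalizing x with
  | _ k ih =>
    by_cases hx : ∃ y, Q x y
    · obtain ⟨y, hy⟩ := hx
      obtain ⟨n, hn, hn'⟩ := ih _ (h ▸ hdec x y hy) y rfl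
      exact ⟨n, .head hy hn, hn'⟩
    · exact ⟨x, .refl, not_exists.1 hx⟩

/-- If the ends of every peak are linked below the peak, then normal forms are unique. -/
theorem normal_unique (hdec : ∀ x y, Q x y → μ y < μ x)
    (hpeak : ∀ x y z, Q x y → Q x z → Linked Q μ (μ x) y z) {x n n' : W}
    (hn : Relation.ReflTransGen Q x n) (hn₀ : ∀ y, ¬ Q n y)
    (hn' : Relation.ReflTransGen Q x n') (hn₀' : ∀ y, ¬ Q n' y) : n = n' := by
  induction h : μ x using Nat.strong_induction_on generalizing x n n' with
  | _ k ih =>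
    subst h
    rcases hn.cases_head with rfl | ⟨y, hxy, hy⟩
    · rcases hn'.cases_head with rfl | ⟨z, hxz, hz⟩
      · rfl
      · exact absurd hxz (hn₀ z)
    rcases hn'.cases_head with rfl | ⟨z, hxz, hz⟩
    · exact absurd hxy (hn₀' y)
    have hlink := hpeak x y z hxy hxz
    -- All elements of the link lie below `x`, so the induction hypothesis gives each of them a
    -- unique normal form; neighbours share theirs, and `n` is transported along the link.
    have key : ∀ z, Linked Q μ (μ x) y z → ∀ n', Relation.ReflTransGen Q z n' →
        (∀ w, ¬ Q n' w) → n = n' := by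
      intro z hz
      induction hz with
      | refl => exact fun n' h₁ h₂ => ih _ (hdec _ _ hxy) hy hn₀ h₁ h₂ rfl
      | @tail a b _ hab ih' =>
        intro n' h₁ h₂
        rcases hab.1 with hq | hq
        · exact ih' n' (.head hq h₁) h₂
        · obtain ⟨p, hp, hp'⟩ := exists_normal hdec a
          rw [ih' p hp hp']
          exact ih _ hab.2.2 (.head hq hp) hp' h₁ h₂ rfl
    exact key z hlink n' hz hn₀'

theorem normal_eq_of_eqvGen (hdec : ∀ x y, Q x y → μ y < μ x)
    (hpeak : ∀ x y z, Q x y → Q x z → Linked Q μ (μ x) y z) {x y n n' : W}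
    (h : Relation.EqvGen Q x y) (hn : Relation.ReflTransGen Q x n) (hn₀ : ∀ y, ¬ Q n y)
    (hn' : Relation.ReflTransGen Q y n') (hn₀' : ∀ y, ¬ Q n' y) : n = n' := by
  induction h generalizing n n' with
  | rel x y h => exact normal_unique hdec hpeak hn hn₀ (.head h hn') hn₀'
  | refl x => exact normal_unique hdec hpeak hn hn₀ hn' hn₀'
  | symm x y _ ih => exact (ih hn' hn₀' hn hn₀).symm
  | trans x y z _ _ ih₁ ih₂ =>
    obtain ⟨p, hp, hp'⟩ := exists_normal hdec y
    exact (ih₁ hn hn₀ hp hp').trans (ih₂ hp hp' hn' hn₀')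

theorem Linked.eqvGen {m : ℕ} {x y : W} (h : Linked Q μ m x y) : Relation.EqvGen Q x y := by
  induction h with
  | refl => exact .refl _
  | tail _ h ih => exact ih.trans _ _ _ (h.1.elim (.rel _ _) fun h => .symm _ _ (.rel _ _ h))

end Confluence

/-! ### Flat equations -/

section Flat

variable {Op K : Type} {F : Signature Op} {Z : Set K}

/-- Flat ground terms over the constants in `Z`. -/
inductive FlatTerm (F : Signature Op) (Z : Set K) : Term Op K → Prop
  | const (c : K) (hc : c ∈ Z) : FlatTerm F Z (Term.const c)
  | app (g : Op) (u : List K) (har : F.ArityOK g u.length) (hu : ∀ c ∈ u, c ∈ Z) :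
      FlatTerm F Z (Term.ofString g u)

/-- Two terms one of which is a constant, or which are headed by the same associative symbol. -/
inductive SameSort (F : Signature Op) : Term Op K → Term Op K → Prop
  | left (c : K) (t : Term Op K) : SameSort F (Term.const c) t
  | right (t : Term Op K) (c : K) : SameSort F t (Term.const c)
  | app (f : Op) (us vs : List (Term Op K)) (hf : f ∈ F.assoc) :
      SameSort F (Term.app f us) (Term.app f vs)

theorem SameSort.symm {p q : Term Op K} (h : SameSort F p q) : SameSort F q p := by
  cases h with
  | left c t => exact .right _ _
  | right t c => exact .left _ _
  | app f us vs hf => exact .app _ _ _ hf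

theorem SameSort.head_eq {g g' : Op} {us vs : List (Term Op K)}
    (h : SameSort F (Term.app g us) (Term.app g' vs)) : g' = g ∧ g ∈ F.assoc := by
  cases h with
  | app f us vs hf => exact ⟨rfl, hf⟩

/-- All equations in the set are constant, `D`-flat or `A`-flat, with constants from `Z`. -/
def FlatSet (F : Signature Op) (Z : Set K) (S : Set (Eqn Op K)) : Prop :=
  ∀ p q : Term Op K, s(p, q) ∈ S → FlatTerm F Z p ∧ FlatTerm F Z q ∧ SameSort F p q

theorem FlatTerm.wf {t : Term Op K} (h : FlatTerm F Z t) : F.WF t := by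
  cases h with
  | const c hc => exact .const c
  | app g u har hu => exact wf_ofString.2 har

theorem flatTerm_ofString {g : Op} {u : List K} :
    FlatTerm F Z (Term.ofString g u) ↔ F.ArityOK g u.length ∧ ∀ c ∈ u, c ∈ Z := by
  refine ⟨fun h => ?_, fun h => .app g u h.1 h.2⟩
  generalize ht : Term.ofString g u = t at h
  cases h with
  | const c hc => simp [Term.ofString] at ht
  | app g' u' har hu =>
    simp only [Term.ofString, Term.app.injEq] at ht
    obtain ⟨rfl, h⟩ := ht
    have : u = u' := List.map_injective_iff.2 (fun a b h => by simpa using h) h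
    exact this ▸ ⟨har, hu⟩

theorem flatTerm_const {c : K} : FlatTerm (Op := Op) F Z (Term.const c) ↔ c ∈ Z := by
  refine ⟨fun h => ?_, fun h => .const c h⟩
  generalize ht : Term.const c = t at h
  cases h with
  | const c' hc => simp only [Term.const.injEq] at ht; exact ht ▸ hc
  | app g' u' har hu => simp [Term.ofString] at ht

theorem ofStringBar_of_two_le {f : Op} {u : List K} (h : 2 ≤ u.length) :
    Term.ofStringBar f u = Term.ofString f u := by
  match u, h with
  | a :: b :: u, _ => rfl

theorem flatTerm_ofStringBar {f : Op} (hf : f ∈ F.assoc) {u : List K} (hu : u ≠ []) :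
    FlatTerm F Z (Term.ofStringBar f u) ↔ ∀ c ∈ u, c ∈ Z := by
  match u, hu with
  | [c], _ => simp [Term.ofStringBar, flatTerm_const]
  | a :: b :: u, _ =>
    rw [ofStringBar_of_two_le (by simp), flatTerm_ofString, arityOK_assoc hf]
    simp

theorem ofStringBar_cases (f : Op) (u : List K) (hu : u ≠ []) :
    (∃ c, u = [c] ∧ Term.ofStringBar f u = Term.const c) ∨
      2 ≤ u.length ∧ Term.ofStringBar f u = Term.ofString f u := by
  match u, hu with
  | [c], _ => exact .inl ⟨c, rfl, rfl⟩
  | a :: b :: u, _ => exact .inr ⟨by simp, rfl⟩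

theorem sameSort_ofStringBar {f : Op} (hf : f ∈ F.assoc) {u v : List K} (hu : u ≠ [])
    (hv : v ≠ []) : SameSort F (Term.ofStringBar f u) (Term.ofStringBar f v) := by
  rcases ofStringBar_cases f u hu with ⟨c, _, h⟩ | ⟨_, h⟩
  · exact h ▸ .left _ _
  rcases ofStringBar_cases f v hv with ⟨c, _, h'⟩ | ⟨_, h'⟩
  · exact h' ▸ .right _ _
  · rw [h, h']
    exact .app _ _ _ hf

/-- A flat term of the same sort as `f(u)`, `f` associative, is `f̄(v)` for some string `v`. -/
theorem exists_ofStringBar {f : Op} (hf : f ∈ F.assoc) {us : List (Term Op K)} {t : Term Op K}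
    (ht : FlatTerm F Z t) (h : SameSort F (Term.app f us) t) :
    ∃ v, v ≠ [] ∧ t = Term.ofStringBar f v := by
  cases ht with
  | const c hc => exact ⟨[c], by simp, rfl⟩
  | app g v har hv =>
    have : g = f := h.head_eq.1
    subst this
    have h2 : 2 ≤ v.length := (arityOK_assoc hf).1 har
    exact ⟨v, by rintro rfl; simp at h2, (ofStringBar_of_two_le h2).symm⟩

/-- A replacement in a flat term is at the root or replaces a constant argument. -/
theorem FlatTerm.replace_cases {s s' u v : Term Op K} (hs : FlatTerm F Z s)
    (h : Term.Replace u v s s') : (s = u ∧ s' = v) ∨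
      ∃ g xs c ys, u = Term.const c ∧ s = Term.ofString g (xs ++ c :: ys) ∧
        s' = Term.app g (xs.map Term.const ++ v :: ys.map Term.const) := by
  cases h with
  | top => exact .inl ⟨rfl, rfl⟩
  | arg g xs ys a b h =>
    right
    generalize hq : Term.app g (xs ++ a :: ys) = q at hs
    cases hs with
    | const c hc => simp at hq
    | app g' w har hw =>
      simp only [Term.ofString, Term.app.injEq] at hq
      obtain ⟨rfl, hq⟩ := hq
      obtain ⟨w₁, w', rfl, rfl, h₂⟩ := List.map_eq_append_iff.1 hq.symm
      obtain ⟨c, w₂, rfl, rfl, rfl⟩ := List.map_eq_cons_iff.1 h₂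
      generalize hc : Term.const c = x at h
      cases h with
      | top => exact ⟨g, w₁, c, w₂, hc.symm, rfl, rfl⟩
      | arg => simp at hc

theorem FlatSet.mono {S S' : Set (Eqn Op K)} (h : FlatSet F Z S) (h' : S' ⊆ S) :
    FlatSet F Z S' := fun p q hpq => h p q (h' hpq)

variable [LinearOrder K]

/-- Inferences only rearrange constants of their premises, so the same `Z` serves for the whole
derivation. For SIMPLIFY, `SameSort` forces the untouched side to be $\bar f$ of a string, which
keeps the equation flat when the other side shrinks to a constant. -/
theorem Inference.flatSet {P D N : Set (Eqn Op K)} (h : Inference F P D N)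
    (hP : FlatSet F Z P) : FlatSet F Z N := by
  have hsymm : ∀ {p q p' q' : Term Op K}, s(p, q) ∈ ({s(p', q')} : Set (Eqn Op K)) →
      FlatTerm F Z p' ∧ FlatTerm F Z q' ∧ SameSort F p' q' →
      FlatTerm F Z p ∧ FlatTerm F Z q ∧ SameSort F p q := by
    intro p q p' q' h h'
    rcases Sym2.eq_iff.1 (Set.mem_singleton_iff.1 h) with ⟨rfl, rfl⟩ | ⟨rfl, rfl⟩
    · exact h'
    · exact ⟨h'.2.1, h'.1, h'.2.2.symm⟩
  intro p q hpq
  cases h with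
  | deduce f u₁ u₂ u₃ v w hf h₁ h₂ h₃ hv hw hgt₁ hgt₂ =>
    refine hsymm hpq ?_
    obtain ⟨a₁, a₂, -⟩ := hP _ _ (Set.mem_insert _ _)
    obtain ⟨b₁, b₂, -⟩ := hP _ _ (Set.mem_insert_of_mem _ (Set.mem_singleton _))
    rw [flatTerm_ofString] at a₁ b₁
    rw [flatTerm_ofStringBar hf hw] at a₂
    rw [flatTerm_ofStringBar hf hv] at b₂
    have l₁ := List.length_pos_of_ne_nil h₁
    have l₃ := List.length_pos_of_ne_nil h₃
    have lv := List.length_pos_of_ne_nil hv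
    have lw := List.length_pos_of_ne_nil hw
    rw [flatTerm_ofString, flatTerm_ofString, arityOK_assoc hf, arityOK_assoc hf]
    refine ⟨⟨by simp; omega, fun c hc => ?_⟩, ⟨by simp; omega, fun c hc => ?_⟩, .app _ _ _ hf⟩
    · rcases List.mem_append.1 hc with hc | hc
      · exact a₁.2 c (by simp [hc])
      · exact b₂ c hc
    · rcases List.mem_append.1 hc with hc | hc
      · exact a₂ c hc
      · exact b₁.2 c (by simp [hc])
  | simplify f u₁ u₂ u₃ v s hf h₂ hv hgt htop =>
    refine hsymm hpq ?_
    obtain ⟨a₁, a₂, a₃⟩ := hP _ _ (Set.mem_insert _ _)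
    obtain ⟨b₁, b₂, -⟩ := hP _ _ (Set.mem_insert_of_mem _ (Set.mem_singleton _))
    rw [flatTerm_ofString] at a₁ b₁
    rw [flatTerm_ofStringBar hf hv] at b₂
    have hne : u₁ ++ v ++ u₃ ≠ [] := by simp [hv]
    obtain ⟨w, hw, rfl⟩ := exists_ofStringBar hf a₂ a₃
    refine ⟨(flatTerm_ofStringBar hf hne).2 fun c hc => ?_, a₂, sameSort_ofStringBar hf hne hw⟩
    simp only [List.mem_append] at hc
    rcases hc with (hc | hc) | hc
    · exact a₁.2 c (by simp [hc])
    · exact b₂ c hc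
    · exact a₁.2 c (by simp [hc])
  | collapse s s' t u d hs hgt₁ hgt₂ hu htop =>
    refine hsymm hpq ?_
    obtain ⟨a₁, a₂, a₃⟩ := hP _ _ (Set.mem_insert _ _)
    obtain ⟨b₁, b₂, -⟩ := hP _ _ (Set.mem_insert_of_mem _ (Set.mem_singleton _))
    rcases a₁.replace_cases hs with ⟨rfl, rfl⟩ | ⟨g, xs, c, ys, rfl, rfl, rfl⟩
    · exact ⟨b₂, a₂, .left _ _⟩
    · have e : Term.app g (xs.map Term.const ++ Term.const d :: ys.map Term.const) =
        Term.ofString g (xs ++ d :: ys) := by simp [Term.ofString]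
      rw [e, flatTerm_ofString]
      rw [flatTerm_ofString] at a₁
      rw [flatTerm_const] at b₂
      refine ⟨⟨by simpa using a₁.1, fun x hx => ?_⟩, a₂, ?_⟩
      · simp only [List.mem_append, List.mem_cons] at hx
        rcases hx with hx | rfl | hx
        · exact a₁.2 x (by simp [hx])
        · exact b₂
        · exact a₁.2 x (by simp [hx])
      · generalize hp : Term.ofString g (xs ++ c :: ys) = p at a₃
        cases a₃ with
        | left => simp [Term.ofString] at hp
        | right => exact .right _ _
        | app f us vs hf =>
          simp only [Term.ofString, Term.app.injEq] at hp
          obtain ⟨rfl, -⟩ := hp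
          exact .app _ _ _ hf
  | compose t c d hgt₁ hgt₂ =>
    refine hsymm hpq ?_
    obtain ⟨a₁, -⟩ := hP _ _ (Set.mem_insert _ _)
    obtain ⟨-, b₂, -⟩ := hP _ _ (Set.mem_insert_of_mem _ (Set.mem_singleton _))
    exact ⟨a₁, b₂, .right _ _⟩
  | delete s => simp at hpq

theorem IsDerivation.flatSet {S : ℕ → Set (Eqn Op K)} (hder : IsDerivation F S)
    (h₀ : FlatSet F Z (S 0)) (i : ℕ) : FlatSet F Z (S i) := by
  induction i with
  | zero => exact h₀
  | succ i ih =>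
    rcases hder i with h | ⟨P, D, N, hinf, hP, h⟩
    · exact h ▸ ih
    · rw [h]
      rintro p q (hpq | hpq)
      · exact ih p q hpq.1
      · exact hinf.flatSet (ih.mono hP) p q hpq

/-- The ordering is partial, but total on the two sides of any flat equation. Hence every nontrivial
persisting equation yields a rule. -/
theorem termGT_trichotomy {p q : Term Op K} (hp : FlatTerm F Z p) (hq : FlatTerm F Z q)
    (h : SameSort F p q) : TermGT F p q ∨ p = q ∨ TermGT F q p := by
  cases hp with
  | const c hc =>
    cases hq with
    | const d hd =>
      rcases lt_trichotomy c d with h | rfl | h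
      · exact .inr (.inr (.const _ _ h))
      · exact .inr (.inl rfl)
      · exact .inl (.const _ _ h)
    | app g v har hv => exact .inr (.inr (.app _ _ _))
  | app g u har hu =>
    cases hq with
    | const d hd => exact .inl (.app _ _ _)
    | app g' v har' hv =>
      obtain ⟨rfl, hf⟩ := SameSort.head_eq h
      rw [arityOK_assoc hf] at har har'
      rcases lt_trichotomy u.length v.length with hl | hl | hl
      · exact .inr (.inr (.string _ _ _ hf har' har (.inl hl)))
      · rcases lt_trichotomy u v with h' | rfl | h'
        · exact .inr (.inr (.string _ _ _ hf har' har (.inr ⟨hl, h'⟩)))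
        · exact .inr (.inl rfl)
        · exact .inl (.string _ _ _ hf har har' (.inr ⟨hl.symm, h'⟩))
      · exact .inl (.string _ _ _ hf har har' (.inl hl))

end Flat

/-! ### Words of flat terms and their weights -/

section FlatWords

variable {Op K : Type} {F : Signature Op} {Z : Set K}

/-- The symbol `τ` can stand above an equation with the side `t`: if `t` is headed by an
associative symbol, that symbol is `τ`. -/
def Fits (F : Signature Op) (τ : Option Op) (t : Term Op K) : Prop :=
  ∀ f ∈ F.assoc, ∀ ts, t = Term.app f ts → τ = some f

theorem fits_const (τ : Option Op) (c : K) : Fits F τ (Term.const c) := by simp [Fits]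

theorem fits_app {g : Op} {τ : Option Op} {ts : List (Term Op K)} :
    Fits F τ (Term.app g ts) ↔ (g ∈ F.assoc → τ = some g) := by
  constructor
  · exact fun h hg => h g hg ts rfl
  · rintro h f hf us hfu
    simp only [Term.app.injEq] at hfu
    obtain ⟨rfl, -⟩ := hfu
    exact h hf

theorem fits_ofStringBar (f : Op) (u : List K) :
    Fits F (some f) (Term.ofStringBar f u) := by
  have : Fits F (some f) (Term.ofString f u) := fits_app.2 fun _ => rfl
  match u with
  | [] => exact this
  | [c] => exact fits_const _ _
  | a :: b :: u => exact this

theorem enc_ofString_assoc {f : Op} (hf : f ∈ F.assoc) (u : List K) :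
    (Term.ofString f u).enc F (some f) = u.map (Letter.cst (some f)) := by
  rw [Term.ofString, Term.enc_app_merge hf, Term.flatMap_const]

theorem enc_ofStringBar {f : Op} (hf : f ∈ F.assoc) {u : List K} (hu : u ≠ []) :
    (Term.ofStringBar f u).enc F (some f) = u.map (Letter.cst (some f)) := by
  rcases ofStringBar_cases f u hu with ⟨c, rfl, h⟩ | ⟨_, h⟩
  · rw [h, Term.enc_const]; rfl
  · rw [h, enc_ofString_assoc hf]

theorem enc_ofString {g : Op} {τ : Option Op} (hg : ¬ (g ∈ F.assoc ∧ τ = some g))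
    (u : List K) : (Term.ofString g u).enc F τ =
      Letter.opn τ g :: (u.map (Letter.cst (some g)) ++ [Letter.cls]) := by
  rw [Term.ofString, Term.enc_app hg, Term.flatMap_const]

theorem FlatTerm.two_le_length_enc {g : Op} {ts : List (Term Op K)}
    (h : FlatTerm F Z (Term.app g ts)) (τ : Option Op) :
    2 ≤ ((Term.app g ts).enc F τ).length := by
  generalize ht : Term.app g ts = t at h
  cases h with
  | const c hc => simp at ht
  | app g' u har hu =>
    by_cases hg : g' ∈ F.assoc ∧ τ = some g'
    · obtain ⟨hg, rfl⟩ := hg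
      rw [enc_ofString_assoc hg]
      simpa using (arityOK_assoc hg).1 har
    · rw [enc_ofString hg]
      simp

/-- The digit of a letter: that of its constant, and `1` for the other letters. -/
def letterDigit (δ : K → ℕ) : Letter Op K → ℕ
  | some (_, Sum.inl c) => δ c
  | some (_, Sum.inr _) => 1
  | none => 1

/-- `δ` assigns nonzero digits in base `B` to the constants, strictly monotonically on `Z`. -/
structure IsDigit [LinearOrder K] (Z : Set K) (B : ℕ) (δ : K → ℕ) : Prop where
  one_lt : 1 < B
  pos : ∀ c, 0 < δ c
  lt : ∀ c, δ c < B
  mono : ∀ c ∈ Z, ∀ d ∈ Z, c < d → δ c < δ d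

variable [LinearOrder K] {B : ℕ} {δ : K → ℕ}

theorem IsDigit.letter_pos (hδ : IsDigit Z B δ) (a : Letter Op K) : 0 < letterDigit δ a := by
  rcases a with _ | ⟨_, c | g⟩
  · exact one_pos
  · exact hδ.pos c
  · exact one_pos

theorem IsDigit.letter_lt (hδ : IsDigit Z B δ) (a : Letter Op K) : letterDigit δ a < B := by
  rcases a with _ | ⟨_, c | g⟩
  · exact hδ.one_lt
  · exact hδ.lt c
  · exact hδ.one_lt

/-- A term headed by a symbol has at least two letters, a constant has one. For two strings under
`f`, `Fits` ensures that no brackets are written, and the length-lexicographic order is that of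
numerals. -/
theorem TermGT.weight_lt (hδ : IsDigit Z B δ) {p q : Term Op K} (h : TermGT F p q)
    (hp : FlatTerm F Z p) (hq : FlatTerm F Z q) {τ : Option Op} (hfit : Fits F τ p) :
    wordWeight B (letterDigit δ) (q.enc F τ) < wordWeight B (letterDigit δ) (p.enc F τ) := by
  cases h with
  | const c d h =>
    rw [flatTerm_const] at hp hq
    simpa [Term.enc_const, wordWeight, letterDigit] using hδ.mono d hq c hp h
  | app g ts c =>
    refine wordWeight_lt_of_length hδ.letter_lt hδ.letter_pos ?_
    have := hp.two_le_length_enc τ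
    rw [Term.enc_const, List.length_singleton]
    omega
  | string f u v hf hu hv h =>
    obtain rfl : τ = some f := fits_app.1 hfit hf
    rw [enc_ofString_assoc hf, enc_ofString_assoc hf]
    rw [flatTerm_ofString] at hp hq
    rcases h with h | ⟨hl, h⟩
    · exact wordWeight_lt_of_length hδ.letter_lt hδ.letter_pos (by simpa using h)
    · rw [wordWeight_map, wordWeight_map]
      refine wordWeight_lt_of_lex (fun a => hδ.letter_lt _) (fun a ha b hb hab => ?_) hl h
      exact hδ.mono a (hq.2 a ha) b (hp.2 b hb) hab

end FlatWords

/-! ### The string rewriting system of a set of flat rules -/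

section WordRules

variable {Op K : Type} {F : Signature Op} {Z : Set K}

/-- The rules on words that correspond to the flat rules in `R`, and those that remove the brackets
around a single constant. -/
inductive WordRule (F : Signature Op) (Z : Set K) (R : Set (Term Op K × Term Op K)) :
    List (Letter Op K) → List (Letter Op K) → Prop
  | const (c d : K) (τ : Option Op) (h : (Term.const c, Term.const d) ∈ R) :
      WordRule F Z R [Letter.cst τ c] [Letter.cst τ d]
  | app (g : Op) (u : List K) (d : K) (τ : Option Op) (hg : g ∉ F.assoc) (hu : u ≠ [])
      (h : (Term.ofString g u, Term.const d) ∈ R) :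
      WordRule F Z R (Letter.opn τ g :: (u.map (Letter.cst (some g)) ++ [Letter.cls]))
        [Letter.cst τ d]
  | string (f : Op) (u v : List K) (hf : f ∈ F.assoc) (hu : 2 ≤ u.length) (hv : v ≠ [])
      (h : (Term.ofString f u, Term.ofStringBar f v) ∈ R) :
      WordRule F Z R (u.map (Letter.cst (some f))) (v.map (Letter.cst (some f)))
  | bracket (f : Op) (c : K) (τ : Option Op) (hf : f ∈ F.assoc) (hc : c ∈ Z) :
      WordRule F Z R (Letter.opn τ f :: ([c].map (Letter.cst (some f)) ++ [Letter.cls]))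
        [Letter.cst τ c]

/-- One rewrite step on words. -/
def WordStep (F : Signature Op) (Z : Set K) (R : Set (Term Op K × Term Op K))
    (x y : List (Letter Op K)) : Prop :=
  ∃ a b l r, WordRule F Z R l r ∧ x = a ++ l ++ b ∧ y = a ++ r ++ b

theorem WordRule.step {R : Set (Term Op K × Term Op K)} {l r : List (Letter Op K)}
    (h : WordRule F Z R l r) : WordStep F Z R l r := ⟨[], [], l, r, h, by simp, by simp⟩

theorem WordStep.context {R : Set (Term Op K × Term Op K)} (a b : List (Letter Op K))
    {x y : List (Letter Op K)} (h : WordStep F Z R x y) :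
    WordStep F Z R (a ++ x ++ b) (a ++ y ++ b) := by
  obtain ⟨a', b', l, r, h, rfl, rfl⟩ := h
  exact ⟨a ++ a', b' ++ b, l, r, h, by simp, by simp⟩

theorem arityOK_pos {g : Op} {n : ℕ} (h : F.ArityOK g n) : 0 < n := by
  rcases h with ⟨_, h⟩ | ⟨_, rfl⟩
  · omega
  · exact F.arity_pos g

variable [LinearOrder K]

/-- A flat rule yields a rule on words below every symbol that fits. -/
theorem wordRule_of_termGT {R : Set (Term Op K × Term Op K)} {p q : Term Op K}
    (h : (p, q) ∈ R) (hgt : TermGT F p q) (hp : FlatTerm F Z p) {τ : Option Op}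
    (hfit : Fits F τ p) : WordRule F Z R (p.enc F τ) (q.enc F τ) := by
  cases hgt with
  | const c d _ =>
    rw [Term.enc_const, Term.enc_const]
    exact .const c d τ h
  | string f u v hf hu hv _ =>
    obtain rfl : τ = some f := fits_app.1 hfit hf
    rw [enc_ofString_assoc hf, enc_ofString_assoc hf]
    rw [← ofStringBar_of_two_le hv] at h
    exact .string f u v hf hu (by rintro rfl; simp at hv) h
  | app g ts c =>
    generalize ht : Term.app g ts = t at hp
    cases hp with
    | const c' _ => simp at ht
    | app g' u har hu =>
      obtain ⟨rfl, -⟩ : g = g' ∧ _ := by simpa [Term.ofString] using ht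
      rw [ht] at h hfit
      rw [Term.enc_const]
      by_cases hg : g ∈ F.assoc
      · obtain rfl : τ = some g := fits_app.1 hfit hg
        rw [enc_ofString_assoc hg]
        exact .string g u [c] hg ((arityOK_assoc hg).1 har) (by simp) h
      · rw [enc_ofString (fun h => hg h.1)]
        refine .app g u c τ hg ?_ h
        rintro rfl
        exact absurd (arityOK_pos har) (by simp)

variable {B : ℕ} {δ : K → ℕ}

theorem WordRule.weight_lt (hδ : IsDigit Z B δ) {R : Set (Eqn Op K)} (hR : FlatSet F Z R)
    {l r : List (Letter Op K)} (h : WordRule F Z (orient F R) l r) :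
    wordWeight B (letterDigit δ) r < wordWeight B (letterDigit δ) l := by
  cases h with
  | const c d τ h =>
    obtain ⟨h₁, h₂, -⟩ := hR _ _ h.1
    simpa only [Term.enc_const] using h.2.weight_lt hδ h₁ h₂ (fits_const τ c)
  | app g u d τ hg hu h =>
    exact wordWeight_lt_of_length hδ.letter_lt hδ.letter_pos (by simp)
  | string f u v hf hu hv h =>
    obtain ⟨h₁, h₂, -⟩ := hR _ _ h.1
    have := h.2.weight_lt hδ h₁ h₂ (τ := some f) (fits_app.2 fun _ => rfl)
    rwa [enc_ofString_assoc hf, enc_ofStringBar hf hv] at this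
  | bracket f c τ hf hc =>
    exact wordWeight_lt_of_length hδ.letter_lt hδ.letter_pos (by simp)

theorem WordStep.weight_lt (hδ : IsDigit Z B δ) {R : Set (Eqn Op K)} (hR : FlatSet F Z R)
    {x y : List (Letter Op K)} (h : WordStep F Z (orient F R) x y) :
    wordWeight B (letterDigit δ) y < wordWeight B (letterDigit δ) x := by
  obtain ⟨a, b, l, r, h, rfl, rfl⟩ := h
  exact wordWeight_context_lt hδ.letter_lt hδ.letter_pos a b (h.weight_lt hδ hR)

/-- The bound with `+ 1` expresses "not heavier than `m`", which weak monotonicity carries into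
contexts. -/
theorem Linked.context (hδ : IsDigit Z B δ) {R : Set (Term Op K × Term Op K)}
    {x y m : List (Letter Op K)} (a b : List (Letter Op K))
    (h : Linked (WordStep F Z R) (wordWeight B (letterDigit δ))
      (wordWeight B (letterDigit δ) m + 1) x y) :
    Linked (WordStep F Z R) (wordWeight B (letterDigit δ))
      (wordWeight B (letterDigit δ) (a ++ m ++ b) + 1) (a ++ x ++ b) (a ++ y ++ b) :=
  h.map (fun w => a ++ w ++ b) (fun _ _ h => h.context a b) fun _ hw =>
    Nat.lt_succ_iff.2 <| wordWeight_context_le hδ.letter_lt hδ.letter_pos a b <|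
      Nat.lt_succ_iff.1 hw

end WordRules

/-! ### Equations of a derivation have proofs from the persisting ones -/

section Persisting

variable {Op K : Type} {F : Signature Op} {Z : Set K} {S : ℕ → Set (Eqn Op K)}

theorem persisting_flatSet (hflat : ∀ i, FlatSet F Z (S i)) : FlatSet F Z (persisting S) := by
  rintro p q ⟨i, hi⟩
  exact hflat i p q (hi i le_rfl)

theorem exists_pair_subset {e e' : Eqn Op K} (he : e ∈ persisting S)
    (he' : e' ∈ persisting S) : ∃ i, ∀ j ≥ i, ({e, e'} : Set (Eqn Op K)) ⊆ S j := by
  obtain ⟨i, hi⟩ := he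
  obtain ⟨i', hi'⟩ := he'
  refine ⟨max i i', fun j hj => Set.insert_subset (hi j ?_) (Set.singleton_subset_iff.2 (hi' j ?_))⟩
  · exact (le_max_left _ _).trans hj
  · exact (le_max_right _ _).trans hj

variable [LinearOrder K] {B : ℕ} {δ : K → ℕ}

/-- The sum `2 ^ a + 2 ^ b` replaces the multiset `{a, b}` as an induction measure: two powers below
`2 ^ m` add up to at most `2 ^ m`. -/
theorem two_pow_add_lt {a b m n : ℕ} (ha : a < m) (hb : b < m) :
    2 ^ a + 2 ^ b < 2 ^ m + 2 ^ n := by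
  obtain ⟨k, rfl⟩ := Nat.exists_eq_add_of_lt ha
  have h₁ : 2 ^ a ≤ 2 ^ (a + k) := Nat.pow_le_pow_right (by simp) (by omega)
  have h₂ : 2 ^ b ≤ 2 ^ (a + k) := Nat.pow_le_pow_right (by simp) (by omega)
  have h₃ : 0 < 2 ^ n := by positivity
  rw [pow_succ]
  omega

theorem two_pow_add_lt_left {a b c : ℕ} (h : a < b) : 2 ^ a + 2 ^ c < 2 ^ b + 2 ^ c := by
  have := Nat.pow_lt_pow_right (a := 2) (by simp) h
  omega

theorem two_pow_add_lt_right {a b c : ℕ} (h : a < b) : 2 ^ c + 2 ^ a < 2 ^ c + 2 ^ b := by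
  have := Nat.pow_lt_pow_right (a := 2) (by simp) h
  omega

/-- The words of the sides of the equation `p ≈ q` are linked, modulo the rules of the persisting
equations, by words that are not heavier than both of them. -/
def HasProof (F : Signature Op) (Z : Set K) (B : ℕ) (δ : K → ℕ) (S : ℕ → Set (Eqn Op K))
    (τ : Option Op) (p q : Term Op K) : Prop :=
  Linked (WordStep F Z (orient F (persisting S))) (wordWeight B (letterDigit δ))
    (max (wordWeight B (letterDigit δ) (p.enc F τ)) (wordWeight B (letterDigit δ) (q.enc F τ)) + 1)
    (p.enc F τ) (q.enc F τ)

theorem HasProof.symm {τ : Option Op} {p q : Term Op K} (h : HasProof F Z B δ S τ p q) :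
    HasProof F Z B δ S τ q p := by
  rw [HasProof, max_comm]
  exact Linked.symm h

/-- An equation that is deleted by an inference has a proof if the smaller equations among the
premises and conclusions of the inference have proofs. -/
theorem Inference.hasProof (hδ : IsDigit Z B δ) {P D N : Set (Eqn Op K)}
    (hinf : Inference F P D N) (hP : FlatSet F Z P) {p q : Term Op K}
    {τ : Option Op} (hD : s(p, q) ∈ D) (hp : Fits F τ p) (hq : Fits F τ q)
    (ih : ∀ p' q' τ', s(p', q') ∈ P ∪ N → Fits F τ' p' → Fits F τ' q' →
      2 ^ wordWeight B (letterDigit δ) (p'.enc F τ') +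
        2 ^ wordWeight B (letterDigit δ) (q'.enc F τ') <
      2 ^ wordWeight B (letterDigit δ) (p.enc F τ) +
        2 ^ wordWeight B (letterDigit δ) (q.enc F τ) → HasProof F Z B δ S τ' p' q') :
    HasProof F Z B δ S τ p q := by
  set μ : List (Letter Op K) → ℕ := wordWeight B (letterDigit δ) with hμ
  cases hinf with
  | deduce => simp at hD
  | simplify f u₁ u₂ u₃ v s hf h₂ hv hgt htop =>
    wlog hpq : p = Term.ofString f (u₁ ++ u₂ ++ u₃) ∧ q = s generalizing p q with H
    · rcases Sym2.eq_iff.1 (Set.mem_singleton_iff.1 hD) with h | ⟨h₁, h₂⟩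
      · exact absurd h hpq
      · exact (H (p := q) (q := p) (hD := by rw [h₁, h₂]; exact rfl) (hp := hq) (hq := hp)
          (ih := fun p' q' τ' a b c d => ih p' q' τ' a b c (by omega)) (hpq := ⟨h₂, h₁⟩)).symm
    obtain ⟨rfl, rfl⟩ := hpq
    obtain rfl : τ = some f := fits_app.1 hp hf
    obtain ⟨a₁, a₂, a₃⟩ := hP _ _ (Set.mem_insert _ _)
    obtain ⟨b₁, b₂, -⟩ := hP _ _ (Set.mem_insert_of_mem _ (Set.mem_singleton _))
    have hne : u₁ ++ v ++ u₃ ≠ [] := by simp [hv]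
    have ih₁ := ih (Term.ofString f u₂) (Term.ofStringBar f v) (some f) (by simp)
      (fits_app.2 fun _ => rfl) (fits_ofStringBar f v)
    have ih₂ := ih (Term.ofStringBar f (u₁ ++ v ++ u₃)) q (some f) (by simp)
      (fits_ofStringBar f _) hq
    have w₁ := hgt.weight_lt hδ b₁ b₂ (τ := some f) (fits_app.2 fun _ => rfl)
    have w₂ : u₁ ++ u₃ = [] → μ ((Term.ofStringBar f v).enc F (some f)) < μ (q.enc F (some f)) :=
      fun h => (htop h).weight_lt hδ a₂ b₂ hq
    simp only [HasProof, ← hμ, enc_ofString_assoc hf, enc_ofStringBar hf hv,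
      enc_ofStringBar hf hne, List.map_append] at ih₁ ih₂ w₁ w₂ ⊢
    generalize hU₁ : u₁.map (Letter.cst (some f)) = U₁ at *
    generalize hU₂ : u₂.map (Letter.cst (some f)) = U₂ at *
    generalize hU₃ : u₃.map (Letter.cst (some f)) = U₃ at *
    generalize hV : v.map (Letter.cst (some f)) = V at *
    generalize hY : q.enc F (some f) = Y at *
    have w₃ : μ (U₁ ++ V ++ U₃) < μ (U₁ ++ U₂ ++ U₃) :=
      wordWeight_context_lt hδ.letter_lt hδ.letter_pos _ _ w₁
    have l₁ : Linked (WordStep F Z (orient F (persisting S))) μ (μ U₂ + 1) U₂ V := by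
      rw [← max_eq_left w₁.le]
      refine ih₁ ?_
      -- The simplifying equation must be smaller than the deleted one. At the root the side
      -- condition $s\succ t$ provides this; otherwise $u_2$ is a proper factor, hence shorter.
      by_cases h : u₁ ++ u₃ = []
      · have := w₂ h
        simp only [List.append_eq_nil_iff] at h
        obtain ⟨rfl, rfl⟩ := h
        simp only [List.map_nil] at hU₁ hU₃
        subst hU₁ hU₃
        rw [List.nil_append, List.append_nil]
        exact two_pow_add_lt_right this
      · have w₄ : μ U₂ < μ (U₁ ++ U₂ ++ U₃) := by
          refine wordWeight_lt_of_length hδ.letter_lt hδ.letter_pos ?_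
          have := List.length_pos_of_ne_nil h
          simp only [List.length_append, ← hU₁, ← hU₃, List.length_map] at this ⊢
          omega
        exact two_pow_add_lt w₄ (w₁.trans w₄)
    have l₂ := ih₂ (two_pow_add_lt_left w₃)
    -- The proof of the deleted equation: exchange $u_2$ for $v$ in context, then use the new
    -- equation.
    exact ((l₁.context hδ U₁ U₃).mono (by rw [← hμ]; omega)).trans (l₂.mono (by omega))
  | collapse s s' t u d hs hgt₁ hgt₂ hu htop =>
    wlog hpq : p = s ∧ q = t generalizing p q with H
    · rcases Sym2.eq_iff.1 (Set.mem_singleton_iff.1 hD) with h | ⟨h₁, h₂⟩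
      · exact absurd h hpq
      · exact (H (p := q) (q := p) (hD := by rw [h₁, h₂]; exact rfl) (hp := hq) (hq := hp)
          (ih := fun p' q' τ' a b c d => ih p' q' τ' a b c (by omega)) (hpq := ⟨h₂, h₁⟩)).symm
    obtain ⟨rfl, rfl⟩ := hpq
    obtain ⟨a₁, a₂, a₃⟩ := hP _ _ (Set.mem_insert _ _)
    obtain ⟨b₁, b₂, -⟩ := hP _ _ (Set.mem_insert_of_mem _ (Set.mem_singleton _))
    have hfu : ∀ τ', Fits F τ' u := fun τ' f hf ts h => absurd h (hu f hf ts)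
    have w₁ : ∀ τ', μ ((Term.const d).enc F τ') < μ (u.enc F τ') := fun τ' =>
      hgt₂.weight_lt hδ b₁ b₂ (hfu τ')
    rcases a₁.replace_cases hs with ⟨rfl, rfl⟩ | ⟨g, xs, c, ys, rfl, rfl, rfl⟩
    -- At the root the deleted equation $u\approx t$ is split at `d`; both halves are smaller
    -- because $t\succ d$ and $u\succ d$.
    · have w₂ := (htop rfl).weight_lt hδ a₂ b₂ hq
      have l₁ := ih p (Term.const d) τ (by simp) hp (fits_const _ _) (two_pow_add_lt_right w₂)
      have l₂ := ih (Term.const d) q τ (by simp) (fits_const _ _) hq (two_pow_add_lt_left (w₁ τ))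
      have := w₁ τ
      simp only [HasProof, ← hμ] at l₁ l₂ ⊢
      exact (l₁.mono (by omega)).trans (l₂.mono (by omega))
    · obtain ⟨A, A', hA⟩ := Term.exists_enc_app (F := F) (K := K) g τ
      have e : Term.app g (xs.map Term.const ++ Term.const d :: ys.map Term.const) =
        Term.ofString g (xs ++ d :: ys) := by simp [Term.ofString]
      have e' : ∀ c, (Term.ofString g (xs ++ c :: ys)).enc F τ =
          (A ++ xs.map (Letter.cst (some g))) ++ (Term.const c).enc F (some g) ++
            (ys.map (Letter.cst (some g)) ++ A') := by
        intro c
        rw [Term.ofString, hA, Term.flatMap_const]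
        simp [Term.enc_const]
      rw [e] at ih
      have hfit : Fits F τ (Term.ofString g (xs ++ d :: ys)) := fits_app.2 (fits_app.1 hp)
      -- Below the root the collapsed term is an argument `c`. Its one letter weighs less than the
      -- word of the whole term, so $c\approx d$ is a smaller equation.
      have w₂ : μ ((Term.const c).enc F (some g)) <
          μ ((Term.ofString g (xs ++ c :: ys)).enc F τ) := by
        refine wordWeight_lt_of_length hδ.letter_lt hδ.letter_pos ?_
        have := FlatTerm.two_le_length_enc a₁ τ
        rw [Term.enc_const, List.length_singleton]
        exact this
      have w₃ : μ ((Term.ofString g (xs ++ d :: ys)).enc F τ) <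
          μ ((Term.ofString g (xs ++ c :: ys)).enc F τ) := by
        rw [e', e']
        exact wordWeight_context_lt hδ.letter_lt hδ.letter_pos _ _ (w₁ _)
      have l₁ := ih (Term.const c) (Term.const d) (some g) (by simp) (fits_const _ _)
        (fits_const _ _) (two_pow_add_lt w₂ ((w₁ _).trans w₂))
      have l₂ := ih (Term.ofString g (xs ++ d :: ys)) q τ (by simp) hfit hq
        (two_pow_add_lt_left w₃)
      simp only [HasProof, ← hμ] at l₁ l₂ ⊢
      rw [max_eq_left (w₁ _).le] at l₁
      have l₃ := l₁.context hδ (A ++ xs.map (Letter.cst (some g)))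
        (ys.map (Letter.cst (some g)) ++ A')
      rw [← e', ← e'] at l₃
      exact (l₃.mono (by rw [← hμ]; omega)).trans (l₂.mono (by omega))
  | compose t c d hgt₁ hgt₂ =>
    wlog hpq : p = t ∧ q = Term.const c generalizing p q with H
    · rcases Sym2.eq_iff.1 (Set.mem_singleton_iff.1 hD) with h | ⟨h₁, h₂⟩
      · exact absurd h hpq
      · exact (H (p := q) (q := p) (hD := by rw [h₁, h₂]; exact rfl) (hp := hq) (hq := hp)
          (ih := fun p' q' τ' a b c d => ih p' q' τ' a b c (by omega)) (hpq := ⟨h₂, h₁⟩)).symm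
    obtain ⟨rfl, rfl⟩ := hpq
    obtain ⟨a₁, a₂, a₃⟩ := hP _ _ (Set.mem_insert _ _)
    obtain ⟨b₁, b₂, -⟩ := hP _ _ (Set.mem_insert_of_mem _ (Set.mem_singleton _))
    have w₁ := hgt₁.weight_lt hδ a₁ a₂ hp
    have w₂ := hgt₂.weight_lt hδ b₁ b₂ (fits_const τ c)
    have l₁ := ih p (Term.const d) τ (by simp) hp (fits_const _ _) (two_pow_add_lt_right w₂)
    have l₂ := ih (Term.const c) (Term.const d) τ (by simp) (fits_const _ _) (fits_const _ _)
      (two_pow_add_lt w₁ (w₂.trans w₁))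
    simp only [HasProof, ← hμ] at l₁ l₂ w₁ w₂ ⊢
    exact (l₁.mono (by omega)).trans (l₂.symm.mono (by omega))
  | delete s =>
    have : p = q := by
      rcases Sym2.eq_iff.1 (Set.mem_singleton_iff.1 hD) with ⟨rfl, rfl⟩ | ⟨rfl, rfl⟩ <;> rfl
    subst this
    exact Linked.refl _ _

/-- Every equation that is present at some stage has a proof. -/
theorem IsDerivation.hasProof (hδ : IsDigit Z B δ) (hder : IsDerivation F S)
    (hflat : ∀ i, FlatSet F Z (S i)) {p q : Term Op K} {τ : Option Op} {i : ℕ}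
    (hpq : s(p, q) ∈ S i) (hp : Fits F τ p) (hq : Fits F τ q) :
    HasProof F Z B δ S τ p q := by
  induction hn : 2 ^ wordWeight B (letterDigit δ) (p.enc F τ) +
      2 ^ wordWeight B (letterDigit δ) (q.enc F τ) using Nat.strong_induction_on
      generalizing p q τ i with
  | _ n ih =>
    subst hn
    by_cases hpers : s(p, q) ∈ persisting S
    · obtain ⟨h₁, h₂, h₃⟩ := persisting_flatSet hflat p q hpers
      rcases termGT_trichotomy h₁ h₂ h₃ with h | rfl | h
      · exact .of_rel (wordRule_of_termGT (R := orient F (persisting S)) ⟨hpers, h⟩ h h₁ hp).step (by omega) (by omega)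
      · exact .refl _ _
      · rw [Sym2.eq_swap] at hpers
        exact (Linked.of_rel (wordRule_of_termGT (R := orient F (persisting S)) ⟨hpers, h⟩ h h₂ hq).step (by omega)
          (by omega)).symm
    -- An equation that is present once but does not persist is deleted at some stage. The induction
    -- is on the size of the equation alone, so premises and conclusions of the deleting inference
    -- may belong to any stage.
    · have hj : ∃ j, s(p, q) ∈ S j ∧ s(p, q) ∉ S (j + 1) := by
        by_contra hcon
        push Not at hcon
        exact hpers ⟨i, fun j hj => Nat.le_induction hpq (fun j _ h => hcon j h) j hj⟩
      obtain ⟨j, hj, hj'⟩ := hj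
      rcases hder j with h | ⟨P, D, N, hinf, hP, h⟩
      · exact absurd (h ▸ hj) hj'
      · have hD : s(p, q) ∈ D := by
          by_contra hD
          exact hj' (h ▸ .inl ⟨hj, hD⟩)
        refine hinf.hasProof hδ ((hflat j).mono hP) hD hp hq ?_
        rintro p' q' τ' (h' | h') hp' hq' hlt
        · exact ih _ hlt (hP h') hp' hq' rfl
        · exact ih _ hlt (i := j + 1) (h ▸ .inr h') hp' hq' rfl

/-- In a fair derivation the conclusions of inferences from persisting equations are present at
some stage. -/
theorem IsFair.exists_mem (hfair : IsFair F S) {P D N : Set (Eqn Op K)}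
    (hinf : Inference F P D N) (hP : ∃ i, ∀ j ≥ i, P ⊆ S j) {e : Eqn Op K} (he : e ∈ N) :
    ∃ j, e ∈ S j := by
  obtain ⟨i, hi⟩ := hP
  -- Either the inference is without effect at some late stage, so that its conclusions are already
  -- there, or it stays enabled and fairness has it applied.
  by_cases h : ∃ j ≥ i, S j \ D ∪ N = S j
  · obtain ⟨j, -, h⟩ := h
    exact ⟨j, h ▸ .inr he⟩
  · push Not at h
    obtain ⟨j, -, h'⟩ := hfair P D N hinf ⟨i, fun j hj => ⟨hi j hj, h j hj⟩⟩
    exact ⟨j + 1, h' ▸ .inr he⟩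

end Persisting

/-! ### Critical pairs -/

section Peaks

variable {Op K : Type} {F : Signature Op} {Z : Set K} [LinearOrder K] {B : ℕ} {δ : K → ℕ}
  {R : Set (Eqn Op K)}

theorem Linked.context_lt (hδ : IsDigit Z B δ) {R : Set (Term Op K × Term Op K)}
    {x y m : List (Letter Op K)} (a b : List (Letter Op K))
    (h : Linked (WordStep F Z R) (wordWeight B (letterDigit δ))
      (wordWeight B (letterDigit δ) m) x y) :
    Linked (WordStep F Z R) (wordWeight B (letterDigit δ))
      (wordWeight B (letterDigit δ) (a ++ m ++ b)) (a ++ x ++ b) (a ++ y ++ b) :=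
  h.map (fun w => a ++ w ++ b) (fun _ _ h => h.context a b) fun _ hw =>
    wordWeight_context_lt hδ.letter_lt hδ.letter_pos a b hw

/-- Two occurrences of left-hand sides are disjoint, nested or properly overlapping. Disjoint steps
commute; the other two cases are the critical pairs `hin` and `hov`, placed in a context. -/
theorem peak_linked (hδ : IsDigit Z B δ) (hR : FlatSet F Z R)
    (hin : ∀ l r l' r' k m, WordRule F Z (orient F R) l r → WordRule F Z (orient F R) l' r' →
      l = k ++ l' ++ m → Linked (WordStep F Z (orient F R)) (wordWeight B (letterDigit δ))
        (wordWeight B (letterDigit δ) l) r (k ++ r' ++ m))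
    (hov : ∀ l₁ l₂ l₃ r r', l₁ ≠ [] → l₂ ≠ [] → l₃ ≠ [] →
      WordRule F Z (orient F R) (l₁ ++ l₂) r → WordRule F Z (orient F R) (l₂ ++ l₃) r' →
      Linked (WordStep F Z (orient F R)) (wordWeight B (letterDigit δ))
        (wordWeight B (letterDigit δ) (l₁ ++ l₂ ++ l₃)) (r ++ l₃) (l₁ ++ r'))
    {x y z : List (Letter Op K)} (hy : WordStep F Z (orient F R) x y)
    (hz : WordStep F Z (orient F R) x z) :
    Linked (WordStep F Z (orient F R)) (wordWeight B (letterDigit δ))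
      (wordWeight B (letterDigit δ) x) y z := by
  have hdec := fun {x y} => WordStep.weight_lt (x := x) (y := y) hδ hR
  obtain ⟨a, b, l, r, h, hx, rfl⟩ := hy
  obtain ⟨a', b', l', r', h', hx', rfl⟩ := hz
  wlog hlen : a.length ≤ a'.length generalizing a b l r a' b' l' r' with H
  · exact (H a' b' l' r' h' hx' a b l r h hx (by omega)).symm
  have heq : a ++ (l ++ b) = a' ++ (l' ++ b') := by
    rw [← List.append_assoc, ← hx, hx', List.append_assoc]
  obtain ⟨k, rfl, hk⟩ : ∃ k, a' = a ++ k ∧ l ++ b = k ++ (l' ++ b') := by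
    rcases List.append_eq_append_iff.1 heq with ⟨k, h₁, h₂⟩ | ⟨k, h₁, h₂⟩
    · exact ⟨k, h₁, h₂⟩
    · have : k = [] := by
        have := congrArg List.length h₁
        simp only [List.length_append] at this
        exact List.eq_nil_of_length_eq_zero (by omega)
      subst this
      exact ⟨[], by simpa using h₁.symm, by simpa using h₂.symm⟩
  rcases List.append_eq_append_iff.1 hk with ⟨m, rfl, rfl⟩ | ⟨l₂, rfl, hb⟩
  · have h₁ : WordStep F Z (orient F R) (a ++ r ++ (m ++ (l' ++ b')))
        (a ++ r ++ (m ++ (r' ++ b'))) := by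
      simpa using h'.step.context (a ++ r ++ m) b'
    have h₂ : WordStep F Z (orient F R) (a ++ (l ++ m) ++ r' ++ b')
        (a ++ r ++ (m ++ (r' ++ b'))) := by
      simpa using h.step.context a (m ++ r' ++ b')
    have w₁ := hdec ⟨_, _, _, _, h, hx, rfl⟩
    have w₂ := hdec ⟨_, _, _, _, h', hx', rfl⟩
    exact (Linked.of_rel h₁ w₁ ((hdec h₁).trans w₁)).trans
      (Linked.of_rel h₂ w₂ ((hdec h₂).trans w₂)).symm
  -- Now `l = k ++ l₂`, and `l'` either reaches at least to the end of `l` or lies inside it. In the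
  -- first case an empty `k` or `m` means nesting, an empty `l₂` means that the redexes merely
  -- touch; otherwise the overlap is proper.
  · rcases List.append_eq_append_iff.1 hb.symm with ⟨m, rfl, rfl⟩ | ⟨m, rfl, rfl⟩
    · by_cases hk' : k = []
      · subst hk'
        have := (hin _ _ _ _ [] m h' h (by simp)).context_lt hδ a b'
        subst hx
        simpa using this.symm
      by_cases hl₂ : l₂ = []
      · subst hl₂
        have h₁ : WordStep F Z (orient F R) (a ++ r ++ (m ++ b')) (a ++ r ++ (r' ++ b')) := by
          simpa using h'.step.context (a ++ r) b'
        have h₂ : WordStep F Z (orient F R) (a ++ k ++ r' ++ b') (a ++ r ++ (r' ++ b')) := by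
          simpa using h.step.context a (r' ++ b')
        have w₁ := hdec ⟨_, _, _, _, h, hx, rfl⟩
        have w₂ := hdec ⟨_, _, _, _, h', hx', rfl⟩
        exact (Linked.of_rel h₁ w₁ ((hdec h₁).trans w₁)).trans
          (Linked.of_rel h₂ w₂ ((hdec h₂).trans w₂)).symm
      by_cases hm : m = []
      · subst hm
        have := (hin _ _ l₂ _ k [] h (by simpa using h') (by simp)).context_lt hδ a b'
        subst hx
        simpa using this
      have := (hov k l₂ m r r' hk' hl₂ hm h h').context_lt hδ a b'
      subst hx
      simpa using this
    · have := (hin _ _ l' _ k m h h' (by simp)).context_lt hδ a b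
      subst hx
      simpa using this

end Peaks

-- Factors of strings and of bracketed strings

section Infixes

variable {Op K : Type}

theorem string_eq_append {σ σ' : Option Op} {u u' : List K} {k m : List (Letter Op K)}
    (hu' : u' ≠ []) (h : u.map (Letter.cst σ) = k ++ u'.map (Letter.cst σ') ++ m) :
    σ = σ' ∧ ∃ u₁ u₃, u = u₁ ++ u' ++ u₃ ∧ k = u₁.map (Letter.cst σ) ∧
      m = u₃.map (Letter.cst σ) := by
  obtain ⟨w, u₃, rfl, h₁, rfl⟩ := List.map_eq_append_iff.1 h
  obtain ⟨u₁, u₂, rfl, rfl, h₂⟩ := List.map_eq_append_iff.1 h₁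
  have hσ : σ = σ' ∧ u₂ = u' := by
    clear h h₁
    induction u₂ generalizing u' with
    | nil =>
      cases u' with
      | nil => exact absurd rfl hu'
      | cons => simp at h₂
    | cons c u₂ ih =>
      cases u' with
      | nil => exact absurd rfl hu'
      | cons c' u' =>
        simp only [List.map_cons, List.cons.injEq, Option.some.injEq, Prod.mk.injEq,
          Sum.inl.injEq] at h₂
        obtain ⟨⟨rfl, rfl⟩, h₂⟩ := h₂
        refine ⟨rfl, ?_⟩
        rw [List.map_injective_iff.2 (fun a b h => by simpa using h) h₂]
  obtain ⟨rfl, rfl⟩ := hσ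
  exact ⟨rfl, u₁, u₃, rfl, rfl, rfl⟩

theorem bracket_not_mem_string {σ τ : Option Op} {u : List K} {g : Op} :
    Letter.opn τ g ∉ u.map (Letter.cst σ) := by simp

theorem bracket_eq_append_string {σ σ' τ : Option Op} {g : Op} {u u' : List K}
    {k m : List (Letter Op K)} (hu' : u' ≠ [])
    (h : Letter.opn τ g :: (u.map (Letter.cst σ) ++ [Letter.cls]) =
      k ++ u'.map (Letter.cst σ') ++ m) :
    σ = σ' ∧ ∃ u₁ u₃, u = u₁ ++ u' ++ u₃ ∧ k = Letter.opn τ g :: u₁.map (Letter.cst σ) ∧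
      m = u₃.map (Letter.cst σ) ++ [Letter.cls] := by
  cases k with
  | nil =>
    cases u' with
    | nil => exact absurd rfl hu'
    | cons c u' => simp at h
  | cons x k =>
    simp only [List.cons_append, List.cons.injEq] at h
    obtain ⟨rfl, h⟩ := h
    rcases List.eq_nil_or_concat m with rfl | ⟨m, y, rfl⟩
    · rcases List.eq_nil_or_concat u' with rfl | ⟨u', y, rfl⟩
      · exact absurd rfl hu'
      · rw [List.concat_eq_append, List.map_append, List.append_nil, ← List.append_assoc] at h
        have := (List.append_inj' h rfl).2
        simp at this
    · rw [List.concat_eq_append, ← List.append_assoc] at h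
      obtain ⟨h, h'⟩ := List.append_inj' h rfl
      obtain ⟨rfl, u₁, u₃, rfl, rfl, rfl⟩ := string_eq_append hu' h
      refine ⟨rfl, u₁, u₃, rfl, rfl, ?_⟩
      rw [List.concat_eq_append, h']

/-- The interior of a flat bracketed word contains constants only, so a bracketed factor must be the
whole word. -/
theorem bracket_eq_append_bracket {σ σ' τ τ' : Option Op} {g g' : Op} {u u' : List K}
    {k m : List (Letter Op K)}
    (h : Letter.opn τ g :: (u.map (Letter.cst σ) ++ [Letter.cls]) =
      k ++ (Letter.opn τ' g' :: (u'.map (Letter.cst σ') ++ [Letter.cls])) ++ m) :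
    k = [] ∧ m = [] ∧ τ = τ' ∧ g = g' ∧
      u.map (Letter.cst σ) = u'.map (Letter.cst σ') := by
  cases k with
  | cons x k =>
    simp only [List.cons_append, List.cons.injEq] at h
    have : Letter.opn τ' g' ∈ u.map (Letter.cst σ) ++ [Letter.cls] := by
      rw [h.2]; simp
    simp at this
  | nil =>
    simp only [List.nil_append, List.cons_append, List.cons.injEq, Option.some.injEq,
      Prod.mk.injEq, Sum.inr.injEq] at h
    obtain ⟨⟨rfl, rfl⟩, h⟩ := h
    rcases List.eq_nil_or_concat m with rfl | ⟨m, y, rfl⟩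
    · rw [List.append_nil] at h
      exact ⟨rfl, rfl, rfl, rfl, (List.append_inj' h rfl).1⟩
    · rw [List.concat_eq_append, ← List.append_assoc] at h
      have h₁ := (List.append_inj' h rfl).1
      have : (Letter.cls : Letter Op K) ∈ u.map (Letter.cst σ) := by rw [h₁]; simp
      simp at this

theorem cst_map_injective {σ : Option Op} {u u' : List K}
    (h : u.map (Letter.cst (Op := Op) σ) = u'.map (Letter.cst σ)) : u = u' :=
  List.map_injective_iff.2 (fun a b h => by simpa using h) h

theorem singleton_eq_append {α : Type} {a : α} {k l m : List α} (hl : l ≠ [])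
    (h : [a] = k ++ l ++ m) : k = [] ∧ m = [] ∧ l = [a] := by
  have h' := congrArg List.length h
  have := List.length_pos_of_ne_nil hl
  simp only [List.length_append, List.length_singleton] at h'
  obtain rfl := List.eq_nil_of_length_eq_zero (show k.length = 0 by omega)
  obtain rfl := List.eq_nil_of_length_eq_zero (show m.length = 0 by omega)
  exact ⟨rfl, rfl, by simpa using h.symm⟩

variable {F : Signature Op} {Z : Set K}

/-- A left-hand side of a rule on words is a string of constants, or such a string in brackets. -/
theorem WordRule.lhs_cases {R : Set (Term Op K × Term Op K)} {l r : List (Letter Op K)}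
    (h : WordRule F Z R l r) : (∃ σ, ∃ u : List K, u ≠ [] ∧ l = u.map (Letter.cst σ)) ∨
      ∃ τ g σ, ∃ u : List K, l = Letter.opn τ g :: (u.map (Letter.cst σ) ++ [Letter.cls]) := by
  cases h with
  | const c d τ h => exact .inl ⟨τ, [c], by simp, rfl⟩
  | app g u d τ hg hu h => exact .inr ⟨_, _, _, _, rfl⟩
  | string f u v hf hu hv h => exact .inl ⟨_, u, by rintro rfl; simp at hu, rfl⟩
  | bracket f c τ hf hc => exact .inr ⟨_, _, _, _, rfl⟩

theorem WordRule.string_cases {R : Set (Term Op K × Term Op K)} {σ : Option Op} {u : List K}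
    {r : List (Letter Op K)} (h : WordRule F Z R (u.map (Letter.cst σ)) r)
    (hu : 2 ≤ u.length) : ∃ f v, f ∈ F.assoc ∧ σ = some f ∧ v ≠ [] ∧
      r = v.map (Letter.cst (some f)) ∧ (Term.ofString f u, Term.ofStringBar f v) ∈ R := by
  generalize hl : u.map (Letter.cst σ) = l at h
  cases h with
  | const c d τ h =>
    have := congrArg List.length hl
    simp only [List.length_map, List.length_singleton] at this
    omega
  | app g w d τ hg hw h =>
    exact absurd (hl ▸ List.mem_cons_self) (bracket_not_mem_string (u := u) (σ := σ))
  | string f w v hf hw hv h =>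
    have hne : w ≠ [] := by rintro rfl; simp at hw
    obtain ⟨rfl, -⟩ := string_eq_append (k := []) (m := []) hne (by simpa using hl)
    obtain rfl := cst_map_injective hl
    exact ⟨f, v, hf, rfl, hv, rfl, h⟩
  | bracket f c τ hf hc =>
    exact absurd (hl ▸ List.mem_cons_self) (bracket_not_mem_string (u := u) (σ := σ))

end Infixes

/-! ### Convergence of the persisting rules -/

section Convergence

variable {Op K : Type} {F : Signature Op} {Z : Set K} [LinearOrder K] {B : ℕ} {δ : K → ℕ}
  {S : ℕ → Set (Eqn Op K)}

/-- The form used for critical pairs: `M` is the weight of the peak, and both sides of the equation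
lie below it. -/
theorem IsDerivation.linked (hδ : IsDigit Z B δ) (hder : IsDerivation F S)
    (hflat : ∀ i, FlatSet F Z (S i)) {p q : Term Op K} (τ : Option Op)
    (hpq : ∃ i, s(p, q) ∈ S i) (hp : Fits F τ p) (hq : Fits F τ q) {M : ℕ}
    (hpM : wordWeight B (letterDigit δ) (p.enc F τ) < M)
    (hqM : wordWeight B (letterDigit δ) (q.enc F τ) < M) :
    Linked (WordStep F Z (orient F (persisting S))) (wordWeight B (letterDigit δ)) M
      (p.enc F τ) (q.enc F τ) := by
  obtain ⟨i, hi⟩ := hpq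
  exact Linked.mono (by omega) (hder.hasProof hδ hflat hi hp hq)

/-- COLLAPSE at the root: from $u\approx d$ and $u\approx d'$ with $d\succ d'$ it produces
$d'\approx d$. Its side condition is the reason for assuming an order between `d` and `d'`. -/
theorem linked_of_same_lhs (hδ : IsDigit Z B δ) (hder : IsDerivation F S) (hfair : IsFair F S)
    (hflat : ∀ i, FlatSet F Z (S i)) {u : Term Op K} {d d' : K}
    (hu : ∀ f ∈ F.assoc, ∀ ts : List (Term Op K), u ≠ Term.app f ts)
    (h : (u, Term.const d) ∈ orient F (persisting S))
    (h' : (u, Term.const d') ∈ orient F (persisting S)) (τ : Option Op) {M : ℕ}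
    (hM : wordWeight B (letterDigit δ) [Letter.cst τ d] < M)
    (hM' : wordWeight B (letterDigit δ) [Letter.cst τ d'] < M) :
    Linked (WordStep F Z (orient F (persisting S))) (wordWeight B (letterDigit δ)) M
      [Letter.cst τ d] [Letter.cst τ d'] := by
  wlog hlt : d' < d generalizing d d' with H
  · rcases lt_or_eq_of_le (not_lt.1 hlt) with hlt | rfl
    · exact (H h' h hM' hM hlt).symm
    · exact .refl _ _
  have hinf := Inference.collapse u (Term.const d') (Term.const d) u d' .top h.2 h'.2 hu
    (fun _ => .const _ _ hlt)
  have hex := hfair.exists_mem hinf (exists_pair_subset h.1 h'.1) (Set.mem_singleton _)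
  simp only [← Term.enc_const (F := F)] at hM hM' ⊢
  exact (hder.linked hδ hflat τ hex (fits_const _ _) (fits_const _ _) hM' hM).symm

/-- COLLAPSE below the root, where a constant rule acts on an argument of a left-hand side. -/
theorem collapse_linked (hδ : IsDigit Z B δ) (hder : IsDerivation F S) (hfair : IsFair F S)
    (hflat : ∀ i, FlatSet F Z (S i)) {g : Op} {xs ys : List K} {c d : K} {t : Term Op K}
    (h : (Term.ofString g (xs ++ [c] ++ ys), t) ∈ orient F (persisting S))
    (h' : (Term.const c, Term.const d) ∈ orient F (persisting S)) {τ : Option Op}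
    (hg : g ∈ F.assoc → τ = some g) (ht : Fits F τ t) {M : ℕ}
    (hM : wordWeight B (letterDigit δ) ((Term.ofString g (xs ++ [d] ++ ys)).enc F τ) < M)
    (hM' : wordWeight B (letterDigit δ) (t.enc F τ) < M) :
    Linked (WordStep F Z (orient F (persisting S))) (wordWeight B (letterDigit δ)) M
      (t.enc F τ) ((Term.ofString g (xs ++ [d] ++ ys)).enc F τ) := by
  have e : ∀ c : K, Term.ofString g (xs ++ [c] ++ ys) =
      Term.app g (xs.map Term.const ++ Term.const c :: ys.map Term.const) := by
    simp [Term.ofString]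
  have hinf := Inference.collapse (F := F) (Term.ofString g (xs ++ [c] ++ ys))
    (Term.ofString g (xs ++ [d] ++ ys)) t (Term.const c) d
    (by rw [e, e]; exact .arg _ _ _ _ _ .top) h.2 h'.2 (by simp)
    (fun h => by rw [e] at h; simp at h)
  have hex := hfair.exists_mem hinf (exists_pair_subset h.1 h'.1) (Set.mem_singleton _)
  exact (hder.linked hδ hflat τ hex (fits_app.2 hg) ht hM hM').symm

theorem simplify_linked (hδ : IsDigit Z B δ) (hder : IsDerivation F S) (hfair : IsFair F S)
    (hflat : ∀ i, FlatSet F Z (S i)) {f : Op} (hf : f ∈ F.assoc) {u₁ u₂ u₃ v w : List K}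
    (hu : 2 ≤ u₂.length) (hv : v ≠ []) (hw : w ≠ [])
    (h : (Term.ofString f (u₁ ++ u₂ ++ u₃), Term.ofStringBar f w) ∈ orient F (persisting S))
    (h' : (Term.ofString f u₂, Term.ofStringBar f v) ∈ orient F (persisting S)) {M : ℕ}
    (hM : wordWeight B (letterDigit δ) ((u₁ ++ v ++ u₃).map (Letter.cst (some f))) < M)
    (hM' : wordWeight B (letterDigit δ) (w.map (Letter.cst (some f))) < M) :
    Linked (WordStep F Z (orient F (persisting S))) (wordWeight B (letterDigit δ)) M
      (w.map (Letter.cst (some f))) ((u₁ ++ v ++ u₃).map (Letter.cst (some f))) := by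
  have key : ∀ {u₁ u₃ v w : List K}, v ≠ [] → w ≠ [] →
      (Term.ofString f (u₁ ++ u₂ ++ u₃), Term.ofStringBar f w) ∈ orient F (persisting S) →
      (Term.ofString f u₂, Term.ofStringBar f v) ∈ orient F (persisting S) →
      wordWeight B (letterDigit δ) ((u₁ ++ v ++ u₃).map (Letter.cst (some f))) < M →
      wordWeight B (letterDigit δ) (w.map (Letter.cst (some f))) < M →
      (u₁ ++ u₃ = [] → TermGT F (Term.ofStringBar f w) (Term.ofStringBar f v)) →
      Linked (WordStep F Z (orient F (persisting S))) (wordWeight B (letterDigit δ)) M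
        (w.map (Letter.cst (some f))) ((u₁ ++ v ++ u₃).map (Letter.cst (some f))) := by
    intro u₁ u₃ v w hv hw h h' hM hM' htop
    have hne : u₁ ++ v ++ u₃ ≠ [] := by simp [hv]
    have hinf := Inference.simplify f u₁ u₂ u₃ v (Term.ofStringBar f w) hf hu hv h'.2 htop
    have hex := hfair.exists_mem hinf (exists_pair_subset h.1 h'.1) (Set.mem_singleton _)
    rw [← enc_ofStringBar hf hw] at hM' ⊢
    rw [← enc_ofStringBar hf hne] at hM ⊢
    exact (hder.linked hδ hflat (some f) hex (fits_ofStringBar _ _) (fits_ofStringBar _ _)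
      hM hM').symm
  by_cases htop : u₁ ++ u₃ = []
  · simp only [List.append_eq_nil_iff] at htop
    obtain ⟨rfl, rfl⟩ := htop
    have h₁ : FlatTerm F Z (Term.ofStringBar f w) := (persisting_flatSet hflat _ _ h.1).2.1
    have h₂ : FlatTerm F Z (Term.ofStringBar f v) := (persisting_flatSet hflat _ _ h'.1).2.1
    simp only [List.nil_append, List.append_nil] at h hM ⊢
    -- With equal left-hand sides SIMPLIFY may only replace the rule with the greater right-hand
    -- side, so the roles of the rules depend on the comparison.
    rcases termGT_trichotomy h₁ h₂ (sameSort_ofStringBar hf hw hv) with hgt | heq | hgt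
    · simpa using key (u₁ := []) (u₃ := []) hv hw (by simpa using h) h' (by simpa using hM) hM'
        fun _ => hgt
    · rw [← enc_ofStringBar hf hw, heq, enc_ofStringBar hf hv]
      exact .refl _ _
    · refine Linked.symm ?_
      simpa using key (u₁ := []) (u₃ := []) hw hv (by simpa using h') h (by simpa using hM') hM
        fun _ => hgt
  · exact key hv hw h h' hM hM' fun h => absurd h htop

/-- A constant inside a flat left-hand side is handled by COLLAPSE, as are equal left-hand sides
with a nonassociative head; a string inside a string is handled by SIMPLIFY. Most other combinations
are excluded by brackets, tags or lengths. Bracket rules need no inference. -/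
theorem inclusion_linked (hδ : IsDigit Z B δ) (hder : IsDerivation F S) (hfair : IsFair F S)
    (hflat : ∀ i, FlatSet F Z (S i)) {l r l' r' k m : List (Letter Op K)}
    (h : WordRule F Z (orient F (persisting S)) l r)
    (h' : WordRule F Z (orient F (persisting S)) l' r') (hl : l = k ++ l' ++ m) :
    Linked (WordStep F Z (orient F (persisting S))) (wordWeight B (letterDigit δ))
      (wordWeight B (letterDigit δ) l) r (k ++ r' ++ m) := by
  have hR := persisting_flatSet hflat
  have w₁ := h.weight_lt hδ hR
  have w₂ : wordWeight B (letterDigit δ) (k ++ r' ++ m) < wordWeight B (letterDigit δ) l :=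
    hl ▸ (h'.step.context k m).weight_lt hδ hR
  cases h' with
  | const c' d' τ' h' =>
    change l = k ++ [c'].map (Letter.cst τ') ++ m at hl
    cases h with
    | const c d τ h =>
      obtain ⟨rfl, rfl, hc⟩ := singleton_eq_append (by simp) hl
      simp only [List.map_cons, List.map_nil, List.cons.injEq, Option.some.injEq, Prod.mk.injEq,
        Sum.inl.injEq, and_true] at hc
      obtain ⟨rfl, rfl⟩ := hc
      exact linked_of_same_lhs hδ hder hfair hflat (by simp) h h' _ w₁ (by simpa using w₂)
    | app g u d τ hg hu h =>
      obtain ⟨rfl, xs, ys, rfl, rfl, rfl⟩ := bracket_eq_append_string (by simp) hl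
      have e : Letter.opn τ g :: xs.map (Letter.cst (some g)) ++ [Letter.cst (some g) d'] ++
          (ys.map (Letter.cst (some g)) ++ [Letter.cls]) =
          (Term.ofString g (xs ++ [d'] ++ ys)).enc F τ := by
        rw [enc_ofString (fun h => hg h.1)]
        simp
      have e' : [Letter.cst τ d] = (Term.const d).enc F τ := by rw [Term.enc_const]
      rw [e] at w₂ ⊢
      rw [e'] at w₁ ⊢
      exact collapse_linked hδ hder hfair hflat h h' (fun h => absurd h hg) (fits_const _ _) w₂ w₁
    | string f u v hf hu hv h =>
      obtain ⟨rfl, xs, ys, rfl, rfl, rfl⟩ := string_eq_append (by simp) hl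
      have e : xs.map (Letter.cst (some f)) ++ [Letter.cst (some f) d'] ++
          ys.map (Letter.cst (some f)) = (Term.ofString f (xs ++ [d'] ++ ys)).enc F (some f) := by
        rw [enc_ofString_assoc hf]
        simp
      rw [e] at w₂ ⊢
      rw [← enc_ofStringBar hf hv] at w₁ ⊢
      exact collapse_linked hδ hder hfair hflat h h' (fun _ => rfl) (fits_ofStringBar _ _) w₂ w₁
    | bracket f c τ hf hc =>
      obtain ⟨rfl, xs, ys, hxy, rfl, rfl⟩ := bracket_eq_append_string (by simp) hl
      obtain ⟨rfl, rfl, hcc⟩ := singleton_eq_append (by simp) hxy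
      simp only [List.cons.injEq, and_true] at hcc
      subst hcc
      -- Removing the brackets and rewriting the constant commute: since `d'` lies in `Z`, its
      -- bracket rule exists, and both sides reach `d'` below `τ`.
      have hd : d' ∈ Z := flatTerm_const.1 (hR _ _ h'.1).2.1
      have s₁ := (WordRule.const (F := F) (Z := Z) c' d' τ h').step
      have s₂ := (WordRule.bracket (F := F) (Z := Z) (R := orient F (persisting S))
        f d' τ hf hd).step
      have w₃ := s₁.weight_lt hδ hR
      exact (Linked.of_rel s₁ w₁ (w₃.trans w₁)).trans
        (Linked.of_rel s₂ w₂ (w₃.trans w₁)).symm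
  | app g' u' d' τ' hg' hu' h' =>
    cases h with
    | const c d τ h =>
      obtain ⟨-, -, hc⟩ := singleton_eq_append (by simp) hl
      simp at hc
    | app g u d τ hg hu h =>
      obtain ⟨rfl, rfl, rfl, rfl, hu⟩ := bracket_eq_append_bracket hl
      obtain rfl := cst_map_injective hu
      refine linked_of_same_lhs hδ hder hfair hflat (fun f hf ts hts => ?_) h h' _ w₁
        (by simpa using w₂)
      simp only [Term.ofString, Term.app.injEq] at hts
      exact hg (hts.1 ▸ hf)
    | string f u v hf hu hv h =>
      refine absurd ?_ (bracket_not_mem_string (σ := some f) (τ := τ') (u := u) (g := g'))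
      rw [hl]
      simp
    | bracket f c τ hf hc =>
      obtain ⟨-, -, -, rfl, -⟩ := bracket_eq_append_bracket hl
      exact absurd hf hg'
  | string f' u' v' hf' hu' hv' h' =>
    have hne : u' ≠ [] := by rintro rfl; simp at hu'
    cases h with
    | const c d τ h =>
      obtain ⟨-, -, hc⟩ := singleton_eq_append (by simpa using hne) hl
      have := congrArg List.length hc
      simp only [List.length_map, List.length_singleton] at this
      omega
    | app g u d τ hg hu h =>
      obtain ⟨hgf, -⟩ := bracket_eq_append_string hne hl
      exact absurd (Option.some.inj hgf ▸ hf') hg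
    | string f u v hf hu hv h =>
      obtain ⟨hff, xs, ys, rfl, rfl, rfl⟩ := string_eq_append hne hl
      obtain rfl := Option.some.inj hff
      simp only [← List.map_append] at w₂ ⊢
      exact simplify_linked hδ hder hfair hflat hf hu' hv' hv h h' w₂ w₁
    | bracket f c τ hf hc =>
      obtain ⟨-, xs, ys, hxy, -⟩ := bracket_eq_append_string hne hl
      have := congrArg List.length hxy
      simp only [List.length_append, List.length_singleton] at this
      omega
  | bracket f' c' τ' hf' hc' =>
    cases h with
    | const c d τ h =>
      obtain ⟨-, -, hc⟩ := singleton_eq_append (by simp) hl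
      simp at hc
    | app g u d τ hg hu h =>
      obtain ⟨-, -, -, rfl, -⟩ := bracket_eq_append_bracket hl
      exact absurd hf' hg
    | string f u v hf hu hv h =>
      refine absurd ?_ (bracket_not_mem_string (σ := some f) (τ := τ') (u := u) (g := f'))
      rw [hl]
      simp
    | bracket f c τ hf hc =>
      obtain ⟨rfl, rfl, rfl, rfl, hcc⟩ := bracket_eq_append_bracket hl
      obtain rfl := List.singleton_inj.1 (cst_map_injective hcc)
      simpa using Linked.refl _ _

/-- A bracketed left-hand side has its only brackets at its two ends, so it has no proper overlap
with another left-hand side. Two overlapping strings share a tag `f`, and their critical pair is the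
conclusion of DEDUCE. -/
theorem overlap_linked (hδ : IsDigit Z B δ) (hder : IsDerivation F S) (hfair : IsFair F S)
    (hflat : ∀ i, FlatSet F Z (S i)) {l₁ l₂ l₃ r r' : List (Letter Op K)} (h₁ : l₁ ≠ [])
    (h₂ : l₂ ≠ []) (h₃ : l₃ ≠ []) (h : WordRule F Z (orient F (persisting S)) (l₁ ++ l₂) r)
    (h' : WordRule F Z (orient F (persisting S)) (l₂ ++ l₃) r') :
    Linked (WordStep F Z (orient F (persisting S))) (wordWeight B (letterDigit δ))
      (wordWeight B (letterDigit δ) (l₁ ++ l₂ ++ l₃)) (r ++ l₃) (l₁ ++ r') := by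
  have hR := persisting_flatSet hflat
  have w₁ : wordWeight B (letterDigit δ) (r ++ l₃) <
      wordWeight B (letterDigit δ) (l₁ ++ l₂ ++ l₃) := by
    simpa using (h.step.context [] l₃).weight_lt hδ hR
  have w₂ : wordWeight B (letterDigit δ) (l₁ ++ r') <
      wordWeight B (letterDigit δ) (l₁ ++ l₂ ++ l₃) := by
    simpa using (h'.step.context l₁ []).weight_lt hδ hR
  have hl' : ∃ σ', ∃ u' : List K, u' ≠ [] ∧ l₂ ++ l₃ = u'.map (Letter.cst σ') := by
    refine h'.lhs_cases.resolve_right ?_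
    rintro ⟨τ, g, σ, u, hu⟩
    obtain ⟨a, l₂, rfl⟩ := List.exists_cons_of_ne_nil h₂
    simp only [List.cons_append, List.cons.injEq] at hu
    obtain ⟨rfl, -⟩ := hu
    rcases h.lhs_cases with ⟨σ', u', -, hu'⟩ | ⟨τ', g', σ', u', hu'⟩
    · refine absurd ?_ (bracket_not_mem_string (σ := σ') (τ := τ) (u := u') (g := g))
      rw [← hu']
      simp
    · obtain ⟨b, l₁, rfl⟩ := List.exists_cons_of_ne_nil h₁
      simp only [List.cons_append, List.cons.injEq] at hu'
      have : Letter.opn τ g ∈ u'.map (Letter.cst σ') ++ [Letter.cls] := by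
        rw [← hu'.2]; simp
      simp at this
  obtain ⟨σ', u', -, hu'⟩ := hl'
  obtain ⟨x₂, x₃, rfl, rfl, rfl⟩ := List.map_eq_append_iff.1 hu'.symm
  have hl : ∃ σ, ∃ u : List K, u ≠ [] ∧ l₁ ++ x₂.map (Letter.cst σ') = u.map (Letter.cst σ) := by
    refine h.lhs_cases.resolve_right ?_
    rintro ⟨τ, g, σ, u, hu⟩
    have hx : x₂ ≠ [] := by simpa using h₂
    obtain ⟨-, u₁, u₃, -, -, h⟩ := bracket_eq_append_string (m := []) hx (by simpa using hu.symm)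
    simp at h
  obtain ⟨σ, u, -, hu⟩ := hl
  obtain ⟨rfl, x₁, x₃', rfl, rfl, hx₃'⟩ :=
    string_eq_append (m := []) (by simpa using h₂) (by simpa using hu.symm)
  rw [← List.map_append] at h h'
  have n₁ := List.length_pos_of_ne_nil h₁
  have n₂ := List.length_pos_of_ne_nil h₂
  have n₃ := List.length_pos_of_ne_nil h₃
  rw [List.length_map] at n₁ n₂ n₃
  obtain ⟨f, w, hf, rfl, hw, rfl, hr⟩ := h.string_cases (by simp; omega)
  obtain ⟨f', v, -, hff, hv, rfl, hr'⟩ := h'.string_cases (by simp; omega)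
  obtain rfl := Option.some.inj hff
  have hinf := Inference.deduce f x₁ x₂ x₃ v w hf (by simpa using h₁) (by simpa using h₂)
    (by simpa using h₃) hv hw hr.2 hr'.2
  have hex := hfair.exists_mem hinf (exists_pair_subset hr.1 hr'.1) (Set.mem_singleton _)
  generalize wordWeight B (letterDigit δ) (_ ++ _ ++ _) = M at w₁ w₂ ⊢
  rw [← List.map_append, ← enc_ofString_assoc hf] at w₁ w₂
  rw [← List.map_append, ← List.map_append, ← enc_ofString_assoc hf, ← enc_ofString_assoc hf]
  exact (hder.linked hδ hflat (some f) hex (fits_app.2 fun _ => rfl) (fits_app.2 fun _ => rfl)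
    w₂ w₁).symm

theorem persisting_peak_linked (hδ : IsDigit Z B δ) (hder : IsDerivation F S)
    (hfair : IsFair F S) (hflat : ∀ i, FlatSet F Z (S i)) {x y z : List (Letter Op K)}
    (hy : WordStep F Z (orient F (persisting S)) x y)
    (hz : WordStep F Z (orient F (persisting S)) x z) :
    Linked (WordStep F Z (orient F (persisting S))) (wordWeight B (letterDigit δ))
      (wordWeight B (letterDigit δ) x) y z :=
  peak_linked hδ (persisting_flatSet hflat)
    (fun _ _ _ _ _ _ h h' hl => inclusion_linked hδ hder hfair hflat h h' hl)
    (fun _ _ _ _ _ h₁ h₂ h₃ h h' => overlap_linked hδ hder hfair hflat h₁ h₂ h₃ h h') hy hz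

end Convergence

/-! ### Soundness in models -/

section Soundness

variable {Op K : Type} {F : Signature Op}

/-- The algebra with the same carrier and operations and new values of the constants. -/
def Alg.withCst {K' : Type} (M : Alg Op K) (a : K' → M.carrier) : Alg Op K' where
  carrier := M.carrier
  cst := a
  op := M.op

theorem Alg.ModelsA.withCst {K' : Type} {M : Alg Op K} (h : M.ModelsA F)
    (a : K' → M.carrier) : (M.withCst a).ModelsA F := h

theorem Alg.eval_withCst_map {K' : Type} (M : Alg Op K) (a : K' → M.carrier) (h : K → K')
    (ha : ∀ c, a (h c) = M.cst c) (t : Term Op K) :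
    (M.withCst a).eval (t.map h) = M.eval t := by
  induction t using Term.induction with
  | hc c =>
    rw [Term.map, Alg.eval, Alg.eval]
    exact ha c
  | ha g ts ih =>
    rw [Term.map, Term.mapArgs_eq, Alg.eval_app, Alg.eval_app, List.map_map]
    exact congrArg (M.op g) (List.map_congr_left ih)

theorem Alg.eval_withCst_congr {K' : Type} (M : Alg Op K) (a b : K' → M.carrier)
    (t : Term Op K') (h : ∀ c, Term.HasConst c t → a c = b c) :
    (M.withCst a).eval t = (M.withCst b).eval t := by
  induction t using Term.induction with
  | hc c =>
    rw [Alg.eval, Alg.eval]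
    exact h c .here
  | ha g ts ih =>
    rw [Alg.eval_app, Alg.eval_app]
    exact congrArg (M.op g) (List.map_congr_left fun t ht => ih t ht fun c hc =>
      h c (.arg g ts t ht hc))

/-- The equations in `S` hold in `M`. -/
def Alg.Models (M : Alg Op K) (S : Set (Eqn Op K)) : Prop :=
  ∀ p q : Term Op K, s(p, q) ∈ S → M.eval p = M.eval q

theorem Alg.models_singleton {M : Alg Op K} {p q : Term Op K} :
    M.Models {s(p, q)} ↔ M.eval p = M.eval q := by
  refine ⟨fun h => h p q rfl, fun h p' q' h' => ?_⟩
  rcases Sym2.eq_iff.1 (Set.mem_singleton_iff.1 h') with ⟨rfl, rfl⟩ | ⟨rfl, rfl⟩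
  · exact h
  · exact h.symm

theorem Alg.models_union {M : Alg Op K} {S S' : Set (Eqn Op K)} :
    M.Models (S ∪ S') ↔ M.Models S ∧ M.Models S' :=
  ⟨fun h => ⟨fun p q h' => h p q (.inl h'), fun p q h' => h p q (.inr h')⟩,
    fun h p q h' => h'.elim (h.1 p q) (h.2 p q)⟩

theorem Alg.Models.mono {M : Alg Op K} {S S' : Set (Eqn Op K)} (h : M.Models S)
    (h' : S' ⊆ S) : M.Models S' := fun p q hpq => h p q (h' hpq)

/-- For a one-letter string both sides agree trivially. Otherwise this is an axiom instance, whose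
outer arity is admissible because of the further argument required by `h`. -/
theorem Alg.op_ofStringBar {M : Alg Op K} (hM : M.ModelsA F) {f : Op} (hf : f ∈ F.assoc)
    {v : List K} (hv : v ≠ []) (xs zs : List M.carrier) (h : 0 < xs.length + zs.length) :
    M.op f (xs ++ M.eval (Term.ofStringBar f v) :: zs) = M.op f (xs ++ v.map M.cst ++ zs) := by
  rcases ofStringBar_cases f v hv with ⟨c, rfl, e⟩ | ⟨hl, e⟩
  · rw [e]
    simp [Alg.eval]
  · rw [e, Alg.eval_ofString]
    exact hM f hf xs _ zs (by simpa using hl) (by omega)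

theorem Inference.models [LinearOrder K] {P D N : Set (Eqn Op K)} (hinf : Inference F P D N)
    {M : Alg Op K} (hM : M.ModelsA F) (hP : M.Models P) : M.Models N := by
  cases hinf with
  | deduce f u₁ u₂ u₃ v w hf h₁ h₂ h₃ hv hw hgt₁ hgt₂ =>
    rw [Alg.models_singleton]
    have e₁ := hP _ _ (Set.mem_insert _ _)
    have e₂ := hP _ _ (Set.mem_insert_of_mem _ (Set.mem_singleton _))
    have n₁ := List.length_pos_of_ne_nil h₁
    have n₂ := List.length_pos_of_ne_nil h₂
    have n₃ := List.length_pos_of_ne_nil h₃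
    -- Both sides of the new equation are shown to equal $f(u_1u_2u_3)$, grouped once on the left
    -- and once on the right.
    rw [← ofStringBar_of_two_le (by simp; omega)] at e₁ e₂
    have a₁ := Alg.op_ofStringBar hM hf (v := u₁ ++ u₂) (by simp [h₁]) [] (u₃.map M.cst)
      (by simp; omega)
    have a₂ := Alg.op_ofStringBar hM hf (v := u₂ ++ u₃) (by simp [h₂]) (u₁.map M.cst) []
      (by simp; omega)
    rw [e₁, Alg.op_ofStringBar hM hf hw _ _ (by simp; omega)] at a₁
    rw [e₂, Alg.op_ofStringBar hM hf hv _ _ (by simp; omega)] at a₂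
    rw [Alg.eval_ofString, Alg.eval_ofString]
    simp only [List.nil_append, List.append_nil, List.map_append, List.append_assoc] at a₁ a₂ ⊢
    rw [a₁, a₂]
  | simplify f u₁ u₂ u₃ v s hf h₂ hv hgt htop =>
    rw [Alg.models_singleton]
    have e₁ := hP _ _ (Set.mem_insert _ _)
    have e₂ := hP _ _ (Set.mem_insert_of_mem _ (Set.mem_singleton _))
    have nv := List.length_pos_of_ne_nil hv
    by_cases h : u₁ ++ u₃ = []
    · simp only [List.append_eq_nil_iff] at h
      obtain ⟨rfl, rfl⟩ := h
      simp only [List.nil_append, List.append_nil] at e₁ ⊢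
      rw [← e₁, e₂]
    · have n := List.length_pos_of_ne_nil h
      rw [List.length_append] at n
      have hu₂ : u₂ ≠ [] := by rintro rfl; simp at h₂
      rw [ofStringBar_of_two_le (by simp; omega), ← e₁, Alg.eval_ofString, Alg.eval_ofString]
      rw [← ofStringBar_of_two_le h₂] at e₂
      simp only [List.map_append]
      rw [← Alg.op_ofStringBar hM hf hv _ _ (by simpa using n), ← e₂,
        Alg.op_ofStringBar hM hf hu₂ _ _ (by simpa using n)]
  | collapse s s' t u d hs hgt₁ hgt₂ hu htop =>
    rw [Alg.models_singleton]
    have e₁ := hP _ _ (Set.mem_insert _ _)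
    have e₂ := hP _ _ (Set.mem_insert_of_mem _ (Set.mem_singleton _))
    rw [← M.eval_replace hs e₂, e₁]
  | compose t c d hgt₁ hgt₂ =>
    rw [Alg.models_singleton]
    have e₁ := hP _ _ (Set.mem_insert _ _)
    have e₂ := hP _ _ (Set.mem_insert_of_mem _ (Set.mem_singleton _))
    rw [e₁, e₂]
  | delete s => exact fun p q h => absurd h (Set.notMem_empty _)

theorem IsDerivation.models [LinearOrder K] {S : ℕ → Set (Eqn Op K)} (hder : IsDerivation F S)
    {M : Alg Op K} (hM : M.ModelsA F) (h₀ : M.Models (S 0)) (i : ℕ) : M.Models (S i) := by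
  induction i with
  | zero => exact h₀
  | succ i ih =>
    rcases hder i with h | ⟨P, D, N, hinf, hP, h⟩
    · exact h ▸ ih
    · rw [h, Alg.models_union]
      exact ⟨ih.mono Set.sdiff_subset, hinf.models hM (ih.mono hP)⟩

theorem RewriteModA.eval {R : Set (Term Op K × Term Op K)} {M : Alg Op K} (hM : M.ModelsA F)
    (hR : ∀ ρ ∈ R, M.eval ρ.1 = M.eval ρ.2) {p q : Term Op K} (h : RewriteModA F R p q) :
    M.eval p = M.eval q := by
  obtain ⟨s, t, h₁, ⟨ρ, hρ, h₂⟩, h₃⟩ := h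
  rw [h₁.eval M hM, M.eval_replace h₂ (hR ρ hρ), h₃.eval M hM]

theorem SameNormalForm.eval {R : Set (Term Op K × Term Op K)} {M : Alg Op K}
    (hM : M.ModelsA F) (hR : ∀ ρ ∈ R, M.eval ρ.1 = M.eval ρ.2) {p q : Term Op K}
    (h : SameNormalForm F R p q) : M.eval p = M.eval q := by
  have key : ∀ {p q : Term Op K}, Relation.ReflTransGen (RewriteModA F R) p q →
      M.eval p = M.eval q := by
    intro p q h
    induction h with
    | refl => rfl
    | tail _ h ih => exact ih.trans (h.eval hM hR)
  obtain ⟨⟨p', hp⟩, ⟨q', hq⟩, hpq⟩ := h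
  rw [key hp.1, key hq.1, (hpq p' q' hp hq).eval M hM]

end Soundness

/-! ### Flattening -/

section Flattening

variable {Op C₀ : Type} {F : Signature Op}

theorem Term.Replace.hasConst_sub {K : Type} {u v s s' : Term Op K}
    (h : Term.Replace u v s s') {c : K} (hc : Term.HasConst c u) : Term.HasConst c s := by
  induction h with
  | top => exact hc
  | arg g xs ys a b h ih => exact .arg g _ a (by simp) ih

theorem Term.Replace.hasConst {K : Type} {u v s s' : Term Op K} (h : Term.Replace u v s s')
    {c : K} (hc : Term.HasConst c s') : Term.HasConst c s ∨ Term.HasConst c v := by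
  induction h with
  | top => exact .inr hc
  | arg g xs ys a b h ih =>
    cases hc with
    | arg _ _ t ht hc =>
      simp only [List.mem_append, List.mem_cons] at ht
      rcases ht with ht | rfl | ht
      · exact .inl (.arg g _ t (by simp [ht]) hc)
      · exact (ih hc).imp (fun h => .arg g _ a (by simp) h) id
      · exact .inl (.arg g _ t (by simp [ht]) hc)

/-- All terms in `S` are well-formed and have their constants in `Z`. -/
def TermsIn {K : Type} (F : Signature Op) (Z : Set K) (S : Set (Eqn Op K)) : Prop :=
  ∀ e ∈ S, ∀ t ∈ e, F.WF t ∧ ∀ c, Term.HasConst c t → c ∈ Z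

/-- A step brings in at most one new constant, which keeps the set of constants finite. -/
theorem FlattenStep.termsIn {S S' : Set (Eqn Op (Const C₀))} (h : FlattenStep F S S')
    {Z : Set (Const C₀)} (hS : TermsIn F Z S) :
    ∃ i, TermsIn F (insert (newConst i) Z) S' := by
  have key : ∀ (p p' q : Term Op (Const C₀)) (g : Op) (u : List (Const C₀)) (i : ℕ),
      s(p, q) ∈ S →
      Term.Replace (Term.ofString g u) (Term.const (newConst i)) p p' →
      TermsIn F (insert (newConst i) Z)
        ((S \ {s(p, q)}) ∪ {s(p', q), s(Term.ofString g u, Term.const (newConst i))}) := by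
    intro p p' q g u i he hp
    obtain ⟨wp, cp⟩ := hS _ he p (by simp)
    obtain ⟨wq, cq⟩ := hS _ he q (by simp)
    rintro e (he' | rfl | rfl) t ht
    · exact ⟨(hS e he'.1 t ht).1, fun c hc => .inr ((hS e he'.1 t ht).2 c hc)⟩
    · rcases Sym2.mem_iff.1 ht with rfl | rfl
      · refine ⟨hp.wf wp (.const _), fun c hc => ?_⟩
        rcases hp.hasConst hc with hc | hc
        · exact .inr (cp c hc)
        · cases hc
          exact .inl rfl
      · exact ⟨wq, fun c hc => .inr (cq c hc)⟩
    · rcases Sym2.mem_iff.1 ht with rfl | rfl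
      · exact ⟨hp.wf_sub wp, fun c hc => .inr (cp c (hp.hasConst_sub hc))⟩
      · refine ⟨.const _, fun c hc => ?_⟩
        cases hc
        exact .inl rfl
  cases h with
  | name p p' q g u i he hA hfresh hp => exact ⟨i, key p p' q g u i he hp⟩
  | reuse p p' q g u i he hA hmem hne hp =>
    refine ⟨i, fun e he' => key p p' q g u i he hp e ?_⟩
    rcases he' with h | h
    · exact .inl h
    · exact .inr (.inl h)

/-- The replaced equation follows from the new one together with $t\approx c$. When a name is
reused, `hne` guarantees that $t\approx c$ is not the equation being removed. -/
theorem FlattenStep.cc {S S' : Set (Eqn Op (Const C₀))} (h : FlattenStep F S S')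
    (hS : ∀ e ∈ S, ∀ t ∈ e, F.WF t) {s t : Term Op (Const C₀)} (hst : CC F S s t) :
    CC F S' s t := by
  have key : ∀ (S' : Set (Eqn Op (Const C₀))) (p p' q u v : Term Op (Const C₀)),
      s(p, q) ∈ S → S \ {s(p, q)} ⊆ S' → s(p', q) ∈ S' → CC F S' u v →
      Term.Replace u v p p' → CC F S' s t := by
    intro S' p p' q u v he hsub hp' huv hp
    have hpq : CC F S' p q :=
      .trans _ _ _ (CC.replace hp huv (hS _ he p (by simp))) (.base _ _ hp')
    refine hst.mono fun a b hab => ?_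
    by_cases hab' : s(a, b) = s(p, q)
    · rcases Sym2.eq_iff.1 hab' with ⟨rfl, rfl⟩ | ⟨rfl, rfl⟩
      · exact hpq
      · exact .symm _ _ hpq
    · exact .base _ _ (hsub ⟨hab, hab'⟩)
  cases h with
  | name p p' q g u i he hA hfresh hp =>
    exact key _ p p' q _ _ he Set.subset_union_left (.inr (.inl rfl))
      (.base _ _ (.inr (.inr rfl))) hp
  | reuse p p' q g u i he hA hmem hne hp =>
    exact key _ p p' q _ _ he Set.subset_union_left (.inr rfl)
      (.base _ _ (.inl ⟨hmem, fun h => hne h.symm⟩)) hp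

/-- A fresh constant can be given the value of the term it names without disturbing the old
equations. Original constants keep their values. -/
theorem FlattenStep.models {S S' : Set (Eqn Op (Const C₀))} (h : FlattenStep F S S')
    (M : Alg Op C₀) (hS : ∃ a : Const C₀ → M.carrier, (∀ c, a (Sum.inlₗ c) = M.cst c) ∧
      (M.withCst a).Models S) :
    ∃ a : Const C₀ → M.carrier, (∀ c, a (Sum.inlₗ c) = M.cst c) ∧ (M.withCst a).Models S' := by
  classical
  obtain ⟨a, ha, hS⟩ := hS
  cases h with
  | name p p' q g u i he hA hfresh hp =>
    let b := Function.update a (newConst i) ((M.withCst a).eval (Term.ofString g u))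
    have hb : ∀ t, ¬ Term.HasConst (newConst i) t →
        (M.withCst b).eval t = (M.withCst a).eval t := by
      intro t ht
      refine M.eval_withCst_congr b a t fun c hc => ?_
      exact Function.update_of_ne (by rintro rfl; exact ht hc) _ _
    have hS' : (M.withCst b).Models S := by
      intro p q h
      rw [hb p (hfresh _ h p (by simp)), hb q (hfresh _ h q (by simp)), hS p q h]
    have hu : (M.withCst b).eval (Term.ofString g u) =
        (M.withCst b).eval (Term.const (newConst i)) := by
      rw [hb _ fun hc => hfresh _ he p (by simp) (hp.hasConst_sub hc)]
      simp [Alg.eval, Alg.withCst, b]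
    refine ⟨b, fun c => ?_, ?_⟩
    · rw [← ha c]
      exact Function.update_of_ne (by simp [newConst]) _ _
    · rw [Set.insert_eq, Alg.models_union, Alg.models_union, Alg.models_singleton,
        Alg.models_singleton]
      exact ⟨hS'.mono Set.sdiff_subset,
        ((M.withCst b).eval_replace hp hu).symm.trans (hS' p q he), hu⟩
  | reuse p p' q g u i he hA hmem hne hp =>
    refine ⟨a, ha, ?_⟩
    rw [Alg.models_union, Alg.models_singleton]
    exact ⟨hS.mono Set.sdiff_subset,
      ((M.withCst a).eval_replace hp (hS _ _ hmem)).symm.trans (hS p q he)⟩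

theorem flatSet_of_termsIn {Z : Set (Const C₀)} {S : Set (Eqn Op (Const C₀))}
    (hS : TermsIn F Z S) (hflat : ∀ e ∈ S, ConstEqn e ∨ DFlatEqn e ∨ AFlatEqn F e) :
    FlatSet F Z S := by
  have hstr : ∀ (g : Op) (u : List (Const C₀)), F.WF (Term.ofString g u) →
      (∀ c, Term.HasConst c (Term.ofString g u) → c ∈ Z) →
      FlatTerm F Z (Term.ofString g u) := by
    intro g u h₁ h₂
    exact .app g u (wf_ofString.1 h₁) fun c hc =>
      h₂ c (.arg g _ (Term.const c) (List.mem_map_of_mem hc) .here)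
  intro p q hpq
  obtain ⟨wp, cp⟩ := hS _ hpq p (by simp)
  obtain ⟨wq, cq⟩ := hS _ hpq q (by simp)
  rcases hflat _ hpq with ⟨c, d, h⟩ | ⟨g, u, c, h⟩ | ⟨f, hf, u, v, h⟩
  · rcases Sym2.eq_iff.1 h with ⟨rfl, rfl⟩ | ⟨rfl, rfl⟩ <;>
      exact ⟨.const _ (cp _ .here), .const _ (cq _ .here), .left _ _⟩
  · rcases Sym2.eq_iff.1 h with ⟨rfl, rfl⟩ | ⟨rfl, rfl⟩
    · exact ⟨hstr _ _ wp cp, .const _ (cq _ .here), .right _ _⟩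
    · exact ⟨.const _ (cp _ .here), hstr _ _ wq cq, .left _ _⟩
  · rcases Sym2.eq_iff.1 h with ⟨rfl, rfl⟩ | ⟨rfl, rfl⟩ <;>
      exact ⟨hstr _ _ wp cp, hstr _ _ wq cq, .app _ _ _ hf⟩

theorem CC.map {K K' : Type} (h : K → K') {E : Set (Eqn Op K)} {E' : Set (Eqn Op K')}
    (hE : ∀ p q, s(p, q) ∈ E → CC F E' (p.map h) (q.map h)) {s t : Term Op K}
    (hst : CC F E s t) : CC F E' (s.map h) (t.map h) := by
  induction hst with
  | base s t hs => exact hE s t hs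
  | assoc f xs ys zs hf hl =>
    have := Term.map_wf h hl
    simp only [Term.map, Term.mapArgs_eq, List.map_append, List.map_cons] at this ⊢
    exact .assoc f _ _ _ hf this
  | refl s hs => exact .refl _ (Term.map_wf h hs)
  | symm s t _ ih => exact .symm _ _ ih
  | trans s t u _ _ ih₁ ih₂ => exact .trans _ _ _ ih₁ ih₂
  | congr g ss ts har hlen _ ih =>
    simp only [Term.map, Term.mapArgs_eq]
    refine .congr g _ _ (by simpa using har) (by simpa using hlen) fun i hi => ?_
    simpa using ih i (by simpa using hi)

theorem Term.hasConst_map {K K' : Type} {h : K → K'} {t : Term Op K} {c : K'}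
    (hc : Term.HasConst c (t.map h)) : c ∈ Set.range h := by
  induction t using Term.induction with
  | hc d =>
    rw [Term.map] at hc
    cases hc
    exact ⟨d, rfl⟩
  | ha g ts ih =>
    rw [Term.map, Term.mapArgs_eq] at hc
    cases hc with
    | arg _ _ t ht hc =>
      obtain ⟨t', ht', rfl⟩ := List.mem_map.1 ht
      exact ih t' ht' hc

theorem Term.hasConst_flatten {K : Type} {t : Term Op K} {c : K}
    (hc : Term.HasConst c (t.flatten F)) : Term.HasConst c t := by
  induction t using Term.induction with
  | hc d => simpa [Term.flatten] using hc
  | ha g ts ih =>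
    rw [Term.flatten, Term.flattenArgs_eq] at hc
    cases hc with
    | arg _ _ t ht hc =>
      obtain ⟨t', ht', hmem⟩ := List.mem_flatMap.1 ht
      refine .arg g ts t' ht' (ih t' ht' ?_)
      generalize t'.flatten F = s at hmem
      cases s with
      | const d =>
        simp only [Term.splice, List.mem_singleton] at hmem
        exact hmem ▸ hc
      | app g' us =>
        simp only [Term.splice] at hmem
        split_ifs at hmem
        · exact .arg _ _ t hmem hc
        · simp only [List.mem_singleton] at hmem
          exact hmem ▸ hc

/-- What is needed to know about a set obtained from `E` by flattening. -/
theorem FlatteningOf.spec [Finite C₀] {E : Set (Eqn Op C₀)}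
    (hE : ∀ e ∈ E, ∀ t ∈ e, F.WF t) {S : Set (Eqn Op (Const C₀))} (h : FlatteningOf F E S) :
    (∃ Z : Set (Const C₀), Z.Finite ∧ FlatSet F Z S) ∧
    (∀ s t : Term Op C₀, CC F E s t → CC F S (lift s) (lift t)) ∧
    ∀ M : Alg Op C₀, Nonempty M.carrier → M.ModelsA F → M.Models E →
      ∃ a : Const C₀ → M.carrier, (∀ c, a (Sum.inlₗ c) = M.cst c) ∧
        (M.withCst a).Models S := by
  obtain ⟨h, hflat⟩ := h
  -- Intermediate sets need not be flat; the invariant along the steps is well-formedness over a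
  -- finite set of constants.
  suffices H : (∃ Z : Set (Const C₀), Z.Finite ∧ TermsIn F Z S) ∧
      (∀ s t : Term Op C₀, CC F E s t → CC F S (lift s) (lift t)) ∧
      ∀ M : Alg Op C₀, Nonempty M.carrier → M.ModelsA F → M.Models E →
        ∃ a : Const C₀ → M.carrier, (∀ c, a (Sum.inlₗ c) = M.cst c) ∧
          (M.withCst a).Models S by
    obtain ⟨⟨Z, hZ, h₁⟩, h₂⟩ := H
    exact ⟨⟨Z, hZ, flatSet_of_termsIn h₁ hflat⟩, h₂⟩
  clear hflat
  induction h with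
  | refl =>
    refine ⟨⟨Set.range Sum.inlₗ, Set.finite_range _, ?_⟩, fun s t hst => ?_, fun M ⟨x⟩ hM hME => ?_⟩
    · rintro _ ⟨e, he, rfl⟩ t ht
      obtain ⟨t', ht', rfl⟩ := Sym2.mem_map.1 ht
      refine ⟨(eqA_flatten (Term.map_wf _ (hE e he t' ht'))).wf.2, fun c hc => ?_⟩
      exact Term.hasConst_map (Term.hasConst_flatten hc)
    · refine CC.map _ (fun p q hpq => ?_) hst
      have hp := eqA_flatten (Term.map_wf (Sum.inlₗ : C₀ → Const C₀) (hE _ hpq p (by simp)))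
      have hq := eqA_flatten (Term.map_wf (Sum.inlₗ : C₀ → Const C₀) (hE _ hpq q (by simp)))
      refine .trans _ _ _ hp.cc (.trans _ _ _ (.base _ _ ?_) hq.symm.cc)
      exact ⟨s(p, q), hpq, rfl⟩
    -- New constants do not occur yet, so any value `x` will do.
    · refine ⟨fun c => Sum.elim M.cst (fun _ => x) (ofLex c), fun c => rfl, ?_⟩
      have key : ∀ t, F.WF t → (M.withCst fun c : Const C₀ =>
          Sum.elim M.cst (fun _ => x) (ofLex c)).eval ((lift t).flatten F) = M.eval t := by
        intro t ht
        exact ((eqA_flatten (Term.map_wf Sum.inlₗ ht)).eval _ (hM.withCst _)).symm.trans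
          (M.eval_withCst_map _ Sum.inlₗ (fun c => rfl) t)
      rintro p q ⟨e, he, heq⟩
      induction e using Sym2.ind with
      | _ p₀ q₀ =>
        have hp := key p₀ (hE _ he p₀ (by simp))
        have hq := key q₀ (hE _ he q₀ (by simp))
        have := hME p₀ q₀ he
        rcases Sym2.eq_iff.1 heq with ⟨rfl, rfl⟩ | ⟨rfl, rfl⟩
        · rw [hp, hq, this]
        · rw [hp, hq, this]
  | tail _ hstep ih =>
    obtain ⟨⟨Z, hZ, h₁⟩, h₂, h₃⟩ := ih
    refine ⟨?_, fun s t hst => hstep.cc (fun e he t ht => (h₁ e he t ht).1) (h₂ s t hst),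
      fun M hx hM hME => hstep.models M (h₃ M hx hM hME)⟩
    obtain ⟨i, hi⟩ := hstep.termsIn h₁
    exact ⟨_, hZ.insert _, hi⟩

end Flattening

/-! ### Rewriting modulo associativity and rewriting of words -/

section Correspondence

variable {Op K : Type} {F : Signature Op} {Z : Set K}

theorem RewriteModA.arg {R : Set (Term Op K × Term Op K)} {a b : Term Op K}
    (h : RewriteModA F R a b) (g : Op) (xs ys : List (Term Op K))
    (hwf : F.WF (Term.app g (xs ++ a :: ys))) :
    RewriteModA F R (Term.app g (xs ++ a :: ys)) (Term.app g (xs ++ b :: ys)) := by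
  obtain ⟨s, t, h₁, ⟨ρ, hρ, h₂⟩, h₃⟩ := h
  have e₁ : EqA F _ _ := CC.congr_arg g xs ys h₁ hwf
  refine ⟨_, _, e₁, ⟨ρ, hρ, .arg g xs ys s t h₂⟩, CC.congr_arg g xs ys h₃ ?_⟩
  have := e₁.wf.2
  rw [Signature.WF.app_iff] at this ⊢
  simp only [List.mem_append, List.mem_cons, List.length_append, List.length_cons] at this ⊢
  refine ⟨this.1, ?_⟩
  rintro x (hx | rfl | hx)
  · exact this.2 x (.inl hx)
  · exact h₃.wf.1
  · exact this.2 x (.inr (.inr hx))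

theorem Subterm.rewriteModA {R : Set (Term Op K × Term Op K)} {s s' t : Term Op K}
    (h : Subterm s t) (ht : F.WF t) (hs : RewriteModA F R s s') :
    ∃ t', RewriteModA F R t t' := by
  induction h with
  | refl => exact ⟨s', hs⟩
  | arg g ts t hmem h ih =>
    obtain ⟨xs, ys, rfl⟩ := List.append_of_mem hmem
    obtain ⟨t', ht'⟩ := ih ((Signature.WF.app_iff.1 ht).2 t hmem)
    exact ⟨_, ht'.arg g xs ys ht⟩

theorem rewriteModA_of_mem {R : Set (Term Op K × Term Op K)} {l r : Term Op K}
    (h : (l, r) ∈ R) (hl : F.WF l) (hr : F.WF r) : RewriteModA F R l r :=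
  ⟨l, r, .refl hl, ⟨(l, r), h, .top⟩, .refl hr⟩

/-- Here bracket rules are needed: below a symbol other than `f` the word of $f(u)$ has brackets,
but that of a constant has none. -/
theorem bracket_enc {R : Set (Term Op K × Term Op K)} {f : Op} (hf : f ∈ F.assoc)
    {τ : Option Op} (hτ : τ ≠ some f) {u : List K} (hu : u ≠ [])
    (hflat : FlatTerm F Z (Term.ofStringBar f u)) :
    Relation.ReflTransGen (WordStep F Z R)
      ([Letter.opn τ f] ++ (Term.ofStringBar f u).enc F (some f) ++ [Letter.cls])
      ((Term.ofStringBar f u).enc F τ) := by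
  rw [enc_ofStringBar hf hu]
  rcases ofStringBar_cases f u hu with ⟨c, rfl, h⟩ | ⟨_, h⟩
  · rw [h] at hflat ⊢
    rw [Term.enc_const]
    exact .single (WordRule.bracket f c τ hf (flatTerm_const.1 hflat)).step
  · rw [h, enc_ofString fun h => hτ h.2]
    exact .refl

/-- Either the symbol `τ` fits both sides of a flat equation, or these are `f̄(u)` and `f̄(v)` with
`f` associative and different from `τ`. -/
theorem fits_or {p q : Term Op K} (hp : FlatTerm F Z p) (hq : FlatTerm F Z q)
    (h : SameSort F p q) (τ : Option Op) : (Fits F τ p ∧ Fits F τ q) ∨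
      ∃ f ∈ F.assoc, τ ≠ some f ∧ ∃ u v, u ≠ [] ∧ v ≠ [] ∧ p = Term.ofStringBar f u ∧
        q = Term.ofStringBar f v := by
  by_cases h₁ : Fits F τ p
  · by_cases h₂ : Fits F τ q
    · exact .inl ⟨h₁, h₂⟩
    · right
      simp only [Fits, not_forall] at h₂
      obtain ⟨f, hf, ts, rfl, hτ⟩ := h₂
      obtain ⟨v, hv, e⟩ := exists_ofStringBar hf hq (.app f ts ts hf)
      obtain ⟨u, hu, e'⟩ := exists_ofStringBar hf hp h.symm
      exact ⟨f, hf, hτ, u, v, hu, hv, e', e⟩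
  · right
    simp only [Fits, not_forall] at h₁
    obtain ⟨f, hf, ts, rfl, hτ⟩ := h₁
    obtain ⟨u, hu, e⟩ := exists_ofStringBar hf hp (.app f ts ts hf)
    obtain ⟨v, hv, e'⟩ := exists_ofStringBar hf hq h
    exact ⟨f, hf, hτ, u, v, hu, hv, e, e'⟩

theorem wf_of_reflTransGen {R : Set (Term Op K × Term Op K)} {p q : Term Op K} (hp : F.WF p)
    (h : Relation.ReflTransGen (RewriteModA F R) p q) : F.WF q := by
  induction h with
  | refl => exact hp
  | tail _ h ih =>
    obtain ⟨s, t, -, -, h₃⟩ := h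
    exact h₃.wf.2

theorem WordStep.eqvGen_context {R : Set (Term Op K × Term Op K)} (a b : List (Letter Op K))
    {x y : List (Letter Op K)} (h : Relation.EqvGen (WordStep F Z R) x y) :
    Relation.EqvGen (WordStep F Z R) (a ++ x ++ b) (a ++ y ++ b) := by
  induction h with
  | rel x y h => exact .rel _ _ (h.context a b)
  | refl x => exact .refl _
  | symm x y _ ih => exact .symm _ _ ih
  | trans x y z _ _ ih₁ ih₂ => exact .trans _ _ _ ih₁ ih₂

variable [LinearOrder K] {R : Set (Eqn Op K)}

/-- If the word of a term can be rewritten, then so can the term. -/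
theorem exists_rewriteModA_of_wordStep (hR : FlatSet F Z R) {q : Term Op K} (hq : F.WF q)
    {w : List (Letter Op K)} (h : WordStep F Z (orient F R) (q.enc F none) w) :
    ∃ q', RewriteModA F (orient F R) q q' := by
  have hqf := eqA_flatten hq
  suffices H : ∃ q', RewriteModA F (orient F R) (q.flatten F) q' by
    obtain ⟨q', s, t, h₁, h₂⟩ := H
    exact ⟨q', s, t, hqf.trans h₁, h₂⟩
  have hwf := hqf.wf.2
  obtain ⟨a, b, l, r, h, hl, -⟩ := h
  cases h with
  | const c d τ h =>
    exact (exists_subterm_of_cst hl).rewriteModA hwf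
      (rewriteModA_of_mem h (.const _) (.const _))
  | app g u d τ hg hu h =>
    have hs := exists_subterm_of_bracket hu hl
    exact hs.rewriteModA hwf (rewriteModA_of_mem h (hs.wf hwf) (.const _))
  | string f u v hf hu hv h =>
    obtain ⟨xs, ys, hs⟩ := exists_subterm_of_string (by rintro rfl; simp at hu) hl
    have hswf := hs.wf hwf
    have hrule := rewriteModA_of_mem h
      (wf_ofString.2 ((arityOK_assoc hf).2 hu)) (hR _ _ h.1).2.1.wf
    -- The match may be a proper stretch of the arguments of `f`. Then the axiom, used from right to
    -- left, groups it into a subterm $f(u)$; this needs a further argument, as `f` cannot be unary.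
    by_cases hne : xs ++ ys = []
    · simp only [List.append_eq_nil_iff] at hne
      obtain ⟨rfl, rfl⟩ := hne
      simp only [List.nil_append, List.append_nil] at hs
      exact hs.rewriteModA hwf hrule
    · have hwf' : F.WF (Term.app f (xs ++ Term.ofString f u :: ys)) := by
        have hpos := List.length_pos_of_ne_nil hne
        rw [Signature.WF.app_iff, arityOK_assoc hf] at hswf ⊢
        simp only [List.mem_append, List.mem_cons, List.length_append, List.length_cons]
          at hswf hpos ⊢
        refine ⟨by omega, ?_⟩
        rintro x (hx | rfl | hx)
        · exact hswf.2 x (.inl (.inl hx))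
        · exact wf_ofString.2 ((arityOK_assoc hf).2 hu)
        · exact hswf.2 x (.inr hx)
      obtain ⟨s, t, h₁, h₂⟩ := hrule.arg f xs ys hwf'
      exact hs.rewriteModA hwf ⟨s, t, (EqA.symm (CC.assoc f xs _ ys hf hwf')).trans h₁, h₂⟩
  | bracket f c τ hf hc =>
    -- A bracket rule never applies to the word of a well-formed term, since an associative symbol
    -- has at least two arguments.
    have hs := exists_subterm_of_bracket (by simp) hl
    have := (arityOK_assoc hf).1 (wf_ofString.1 (hs.wf hwf))
    simp at this

/-- One rule application may take two word steps: below a symbol that does not fit, the string rule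
acts inside brackets, and these are then removed if a single constant remains. -/
theorem transGen_wordStep_of_rule (hR : FlatSet F Z R) {l r : Term Op K}
    (h : (l, r) ∈ orient F R) (τ : Option Op) :
    Relation.TransGen (WordStep F Z (orient F R)) (l.enc F τ) (r.enc F τ) := by
  obtain ⟨h₁, h₂, h₃⟩ := hR _ _ h.1
  simp only at h₁ h₂ h₃
  by_cases hl : Fits F τ l
  · exact .single (wordRule_of_termGT h h.2 h₁ hl).step
  · simp only [Fits, not_forall] at hl
    obtain ⟨f, hf, ts, rfl, hτ⟩ := hl
    obtain ⟨v, hv, rfl⟩ := exists_ofStringBar hf h₂ h₃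
    obtain ⟨u, hu, e⟩ := exists_ofStringBar hf h₁ (.app f ts ts hf)
    rw [e] at h h₁ ⊢
    have hu₂ : 2 ≤ u.length := by
      rcases ofStringBar_cases f u hu with ⟨c, -, e'⟩ | ⟨hl, -⟩
      · rw [e'] at e
        simp at e
      · exact hl
    have hstep := ((wordRule_of_termGT h h.2 h₁ (fits_ofStringBar f u)).step).context
      [Letter.opn τ f] [Letter.cls]
    have e : [Letter.opn τ f] ++ (Term.ofStringBar f u).enc F (some f) ++ [Letter.cls] =
        (Term.ofStringBar f u).enc F τ := by
      rw [enc_ofStringBar hf hu, ofStringBar_of_two_le hu₂, enc_ofString fun h => hτ h.2]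
      rfl
    rw [e] at hstep
    exact .trans_left (.single hstep) (bracket_enc hf hτ hv h₂)

theorem RewriteModA.transGen (hR : FlatSet F Z R) {p q : Term Op K}
    (h : RewriteModA F (orient F R) p q) :
    Relation.TransGen (WordStep F Z (orient F R)) (p.enc F none) (q.enc F none) := by
  obtain ⟨s, t, h₁, ⟨ρ, hρ, h₂⟩, h₃⟩ := h
  rw [h₁.enc, ← h₃.enc]
  obtain ⟨τ, A, B, e₁, e₂⟩ := h₂.enc (F := F) none
  rw [e₁, e₂]
  exact (transGen_wordStep_of_rule hR (l := ρ.1) (r := ρ.2) hρ τ).lift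
    (fun w => A ++ w ++ B) fun _ _ h => h.context A B

variable {B : ℕ} {δ : K → ℕ}

theorem RewriteModA.weight_lt (hδ : IsDigit Z B δ) (hR : FlatSet F Z R) {p q : Term Op K}
    (h : RewriteModA F (orient F R) p q) :
    wordWeight B (letterDigit δ) (q.enc F none) < wordWeight B (letterDigit δ) (p.enc F none) := by
  have := h.transGen hR
  generalize q.enc F none = w at this
  induction this with
  | single h => exact h.weight_lt hδ hR
  | tail _ h ih => exact (h.weight_lt hδ hR).trans ih

theorem reflTransGen_wordStep (hR : FlatSet F Z R) {p q : Term Op K}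
    (h : Relation.ReflTransGen (RewriteModA F (orient F R)) p q) :
    Relation.ReflTransGen (WordStep F Z (orient F R)) (p.enc F none) (q.enc F none) := by
  induction h with
  | refl => exact .refl
  | tail _ h ih => exact ih.trans (h.transGen hR).to_reflTransGen

theorem IsNormalFormOf.word (hR : FlatSet F Z R) {p q : Term Op K} (hp : F.WF p)
    (h : IsNormalFormOf F (orient F R) p q) :
    Relation.ReflTransGen (WordStep F Z (orient F R)) (p.enc F none) (q.enc F none) ∧
      ∀ w, ¬ WordStep F Z (orient F R) (q.enc F none) w := by
  refine ⟨reflTransGen_wordStep hR h.1, fun w hw => ?_⟩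
  obtain ⟨q', hq'⟩ := exists_rewriteModA_of_wordStep hR (wf_of_reflTransGen hp h.1) hw
  exact h.2 q' hq'

variable {S : ℕ → Set (Eqn Op K)}

/-- Two terms have the same normal form if and only if their words are equivalent modulo the rules
of the persisting equations. -/
theorem sameNormalForm_iff (hδ : IsDigit Z B δ) (hder : IsDerivation F S) (hfair : IsFair F S)
    (hflat : ∀ i, FlatSet F Z (S i)) {p q : Term Op K} (hp : F.WF p) (hq : F.WF q) :
    SameNormalForm F (orient F (persisting S)) p q ↔
      Relation.EqvGen (WordStep F Z (orient F (persisting S))) (p.enc F none)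
        (q.enc F none) := by
  have hR := persisting_flatSet hflat
  have toEqv := Relation.EqvGen.reflTransGen_le_eqvGen
    (WordStep F Z (orient F (persisting S)))
  constructor
  · rintro ⟨⟨p', hp'⟩, ⟨q', hq'⟩, h⟩
    have := (h p' q' hp' hq').enc none
    have hq₁ := (hq'.word hR hq).1
    rw [← this] at hq₁
    exact .trans _ _ _ (toEqv _ _ (hp'.word hR hp).1) (.symm _ _ (toEqv _ _ hq₁))
  · intro h
    have hex := exists_normal (Q := RewriteModA F (orient F (persisting S)))
      (μ := fun t => wordWeight B (letterDigit δ) (t.enc F none))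
      (fun _ _ h => h.weight_lt hδ hR)
    refine ⟨hex p, hex q, fun p' q' hp' hq' => ?_⟩
    refine eqA_of_enc (wf_of_reflTransGen hp hp'.1) (wf_of_reflTransGen hq hq'.1) ?_
    exact normal_eq_of_eqvGen (fun _ _ h => h.weight_lt hδ hR)
      (fun _ _ _ => persisting_peak_linked hδ hder hfair hflat) h (hp'.word hR hp).1
      (hp'.word hR hp).2 (hq'.word hR hq).1 (hq'.word hR hq).2

/-- Proofs are available below fitting symbols only. For any other `τ` the proof below `f` is put in
brackets, and bracket rules connect its ends to the words below `τ`. -/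
theorem eqvGen_of_mem (hδ : IsDigit Z B δ) (hder : IsDerivation F S)
    (hflat : ∀ i, FlatSet F Z (S i)) {p q : Term Op K} {i : ℕ} (h : s(p, q) ∈ S i)
    (τ : Option Op) : Relation.EqvGen (WordStep F Z (orient F (persisting S)))
      (p.enc F τ) (q.enc F τ) := by
  obtain ⟨h₁, h₂, h₃⟩ := hflat i p q h
  rcases fits_or h₁ h₂ h₃ τ with ⟨hp, hq⟩ | ⟨f, hf, hτ, u, v, hu, hv, rfl, rfl⟩
  · exact Linked.eqvGen (hder.hasProof hδ hflat h hp hq)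
  · have e := Linked.eqvGen (hder.hasProof hδ hflat h (fits_ofStringBar f u)
      (fits_ofStringBar f v))
    have e₁ := Relation.EqvGen.reflTransGen_le_eqvGen _ _ _
      (bracket_enc (R := orient F (persisting S)) hf hτ hu h₁)
    have e₂ := Relation.EqvGen.reflTransGen_le_eqvGen _ _ _
      (bracket_enc (R := orient F (persisting S)) hf hτ hv h₂)
    exact .trans _ _ _ (.symm _ _ e₁) (.trans _ _ _ (WordStep.eqvGen_context _ _ e) e₂)

theorem IsFair.sameNormalForm_of_cc (hfair : IsFair F S) (hδ : IsDigit Z B δ)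
    (hder : IsDerivation F S) (hflat : ∀ i, FlatSet F Z (S i)) {p q : Term Op K}
    (h : CC F (S 0) p q) : SameNormalForm F (orient F (persisting S)) p q := by
  have hwf := h.wf fun e he t ht => by
    induction e using Sym2.ind with
    | _ a b =>
      rcases Sym2.mem_iff.1 ht with rfl | rfl
      · exact (hflat 0 _ _ he).1.wf
      · exact (hflat 0 _ _ he).2.1.wf
  rw [sameNormalForm_iff hδ hder hfair hflat hwf.1 hwf.2]
  exact CC.enc (Relation.EqvGen.is_equivalence _) (fun _ _ _ _ h => WordStep.eqvGen_context _ _ h)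
    (fun _ _ h τ => eqvGen_of_mem hδ hder hflat h τ) h none

/-- For a finite set of constants, digits exist. -/
theorem exists_isDigit (hZ : Z.Finite) : ∃ (B : ℕ) (δ : K → ℕ), IsDigit Z B δ := by
  classical
  -- The digit of `c` is its rank in `Z` plus one, to avoid zero; ranks are at most `card`, so base
  -- `card + 2` suffices.
  refine ⟨hZ.toFinset.card + 2, fun c => (hZ.toFinset.filter (· < c)).card + 1,
    by omega, fun c => by omega, fun c => ?_, fun c hc d hd h => ?_⟩
  · have := Finset.card_filter_le hZ.toFinset (· < c)
    omega
  · have : (hZ.toFinset.filter (· < c)).card < (hZ.toFinset.filter (· < d)).card := by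
      refine Finset.card_lt_card ((Finset.ssubset_iff_of_subset fun x hx => ?_).2 ⟨c, ?_, ?_⟩)
      · simp only [Finset.mem_filter] at hx ⊢
        exact ⟨hx.1, hx.2.trans h⟩
      · simpa using ⟨hc, h⟩
      · simp
    omega

end Correspondence

-- Congruence closure and equality of normal forms

section Completion

variable {Op C₀ : Type} {F : Signature Op}

/-- There are no nullary symbols. A constant is wanted to see that carriers of models are nonempty.
-/
theorem exists_const_of_wf {K : Type} {t : Term Op K} (ht : F.WF t) : Nonempty K := by
  induction t using Term.induction with
  | hc c => exact ⟨c⟩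
  | ha g ts ih =>
    rw [Signature.WF.app_iff] at ht
    obtain ⟨t, h⟩ := List.exists_mem_of_length_pos (arityOK_pos ht.1)
    exact ih t h (ht.2 t h)

/-- Congruence modulo `E` and associativity is equality of normal forms. -/
theorem cc_iff_sameNormalForm [Finite C₀] [LinearOrder C₀] {E : Set (Eqn Op C₀)}
    (hE : ∀ e ∈ E, ∀ t ∈ e, F.WF t) {S : ℕ → Set (Eqn Op (Const C₀))}
    (hS₀ : FlatteningOf F E (S 0)) (hder : IsDerivation F S) (hfair : IsFair F S)
    {s t : Term Op C₀} (hs : F.WF s) (ht : F.WF t) :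
    CC F E s t ↔ SameNormalForm F (orient F (persisting S)) (lift s) (lift t) := by
  obtain ⟨⟨Z, hZ, hflat₀⟩, hcc, hmod⟩ := hS₀.spec hE
  obtain ⟨B, δ, hδ⟩ := exists_isDigit hZ
  have hflat := hder.flatSet hflat₀
  refine ⟨fun h => hfair.sameNormalForm_of_cc hδ hder hflat (hcc s t h), fun h => ?_⟩
  -- New constants make a syntactic translation back to $E$ awkward; in a model they simply receive
  -- values.
  rw [← follows_iff_cc hE hs ht]
  intro M hM hME
  obtain ⟨c⟩ := exists_const_of_wf hs
  obtain ⟨a, ha, haS⟩ := hmod M ⟨M.cst c⟩ hM hME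
  have hpers : (M.withCst a).Models (persisting S) := by
    rintro p q ⟨i, hi⟩
    exact hder.models (hM.withCst a) haS i p q (hi i le_rfl)
  have := h.eval (hM.withCst a) fun ρ hρ => hpers _ _ hρ.1
  rw [lift, lift] at this
  exact ((M.eval_withCst_map a _ ha s).symm.trans this).trans (M.eval_withCst_map a _ ha t)

end Completion

/-! ### Finite string rewriting systems are computable -/

section StringRewriting

variable {α : Type}

/-- One rewrite step by one of the rules in `L`. -/
def ListStep (L : List (List α × List α)) (x y : List α) : Prop :=
  ∃ a b, ∃ ρ ∈ L, x = a ++ ρ.1 ++ b ∧ y = a ++ ρ.2 ++ b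

open Classical in
/-- Rewriting a prefix of a word by the first rule that applies. -/
noncomputable def rewritePrefix : List (List α × List α) → List α → Option (List α)
  | [], _ => none
  | ρ :: L, w => if w.take ρ.1.length = ρ.1 then some (ρ.2 ++ w.drop ρ.1.length)
      else rewritePrefix L w

/-- Rewriting a word at the first position where a rule applies. -/
noncomputable def rewriteOnce (L : List (List α × List α)) : List α → Option (List α)
  | [] => rewritePrefix L []
  | a :: w => rewritePrefix L (a :: w) <|> (rewriteOnce L w).map (List.cons a)

/-- The result of `Bⁿ` rewrite steps from a word of length `n`. -/
noncomputable def rewriteMany (L : List (List α × List α)) (B : ℕ) (w : List α) : List α :=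
  (fun w => (rewriteOnce L w).getD w)^[w.foldr (fun _ n => B * n) 1] w

variable {L : List (List α × List α)}

theorem listStep_of_rewritePrefix {w w' : List α} (h : rewritePrefix L w = some w') :
    ListStep L w w' := by
  induction L with
  | nil => simp [rewritePrefix] at h
  | cons ρ L ih =>
    rw [rewritePrefix] at h
    split_ifs at h with hp
    · obtain rfl := Option.some.inj h
      refine ⟨[], w.drop ρ.1.length, ρ, List.mem_cons_self, ?_, rfl⟩
      conv_lhs => rw [← List.take_append_drop ρ.1.length w, hp]
      rfl
    · obtain ⟨a, b, ρ', hρ', h⟩ := ih h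
      exact ⟨a, b, ρ', List.mem_cons_of_mem _ hρ', h⟩

theorem rewritePrefix_ne_none {ρ : List α × List α} (hρ : ρ ∈ L) (b : List α) :
    rewritePrefix L (ρ.1 ++ b) ≠ none := by
  induction L with
  | nil => simp at hρ
  | cons ρ' L ih =>
    rw [rewritePrefix]
    split_ifs with hp
    · simp
    · rcases List.mem_cons.1 hρ with rfl | hρ
      · simp at hp
      · exact ih hρ

theorem listStep_of_rewriteOnce {w w' : List α} (h : rewriteOnce L w = some w') :
    ListStep L w w' := by
  induction w generalizing w' with
  | nil => exact listStep_of_rewritePrefix h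
  | cons c w ih =>
    rw [rewriteOnce] at h
    cases hp : rewritePrefix L (c :: w) with
    | some x =>
      rw [hp] at h
      obtain rfl : x = w' := by simpa using h
      exact listStep_of_rewritePrefix hp
    | none =>
      rw [hp] at h
      obtain ⟨y, hy, rfl⟩ : ∃ y, rewriteOnce L w = some y ∧ c :: y = w' := by simpa using h
      obtain ⟨a, b, ρ, hρ, rfl, rfl⟩ := ih hy
      exact ⟨c :: a, b, ρ, hρ, rfl, rfl⟩

theorem rewriteOnce_ne_none {w w' : List α} (h : ListStep L w w') : rewriteOnce L w ≠ none := by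
  obtain ⟨a, b, ρ, hρ, rfl, -⟩ := h
  induction a with
  | nil =>
    have h := rewritePrefix_ne_none hρ b
    generalize he : [] ++ ρ.1 ++ b = w
    have he' : ρ.1 ++ b = w := by simpa using he
    rw [he'] at h
    obtain ⟨x, hx⟩ := Option.ne_none_iff_exists'.1 h
    cases w with
    | nil => simp [rewriteOnce, hx]
    | cons c w => simp [rewriteOnce, hx]
  | cons c a ih =>
    obtain ⟨y, hy⟩ := Option.ne_none_iff_exists'.1 ih
    rw [List.cons_append, List.cons_append, rewriteOnce, hy]
    cases rewritePrefix L (c :: (a ++ ρ.1 ++ b)) <;> simp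

/-- The default `getD w` makes normal forms fixed points, so superfluous iterations are harmless,
and the weight bounds the effective ones. -/
theorem iterate_rewriteOnce_spec {μ : List α → ℕ} (hμ : ∀ x y, ListStep L x y → μ y < μ x)
    (n : ℕ) (w : List α) (hn : μ w ≤ n) :
    Relation.ReflTransGen (ListStep L) w ((fun w => (rewriteOnce L w).getD w)^[n] w) ∧
      ∀ y, ¬ ListStep L ((fun w => (rewriteOnce L w).getD w)^[n] w) y := by
  induction n generalizing w with
  | zero =>
    refine ⟨.refl, fun y hy => ?_⟩
    have := hμ _ _ hy
    simp only [Function.iterate_zero, id] at this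
    omega
  | succ n ih =>
    rw [Function.iterate_succ_apply]
    cases h : rewriteOnce L w with
    | none =>
      have hfix : ∀ k : ℕ, (fun w => (rewriteOnce L w).getD w)^[k] w = w := fun k =>
        Function.iterate_fixed (by simp [h]) k
      rw [Option.getD_none, hfix]
      exact ⟨.refl, fun y hy => rewriteOnce_ne_none hy h⟩
    | some x =>
      have hx := listStep_of_rewriteOnce h
      have := hμ _ _ hx
      obtain ⟨h₁, h₂⟩ := ih x (by omega)
      exact ⟨.head hx h₁, h₂⟩

theorem rewriteMany_spec {μ : List α → ℕ} (hμ : ∀ x y, ListStep L x y → μ y < μ x) {B : ℕ}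
    (hB : ∀ w, μ w ≤ B ^ w.length) (w : List α) :
    Relation.ReflTransGen (ListStep L) w (rewriteMany L B w) ∧
      ∀ y, ¬ ListStep L (rewriteMany L B w) y := by
  refine iterate_rewriteOnce_spec hμ _ w ?_
  have : w.foldr (fun _ n => B * n) 1 = B ^ w.length := by
    induction w with
    | nil => rfl
    | cons a w ih => simp [ih, pow_succ, mul_comm]
  rw [this]
  exact hB w

variable [Primcodable α]

/-- The rule list is a fixed parameter: induction on it builds a finite nest of case distinctions.
-/
theorem primrec_rewritePrefix (L : List (List α × List α)) : Primrec (rewritePrefix L) := by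
  classical
  induction L with
  | nil => exact Primrec.const none
  | cons ρ L ih =>
    have h₁ : PrimrecPred fun w : List α => w.take ρ.1.length = ρ.1 :=
      Primrec.eq.comp (Primrec.list_take.comp (Primrec.const _) .id) (Primrec.const _)
    have h₂ : Primrec fun w : List α => some (ρ.2 ++ w.drop ρ.1.length) :=
      Primrec.option_some.comp (Primrec.list_append.comp (Primrec.const _)
        (Primrec.list_drop.comp (Primrec.const _) .id))
    exact (Primrec.ite h₁ h₂ ih).of_eq fun w => by rw [rewritePrefix]

theorem primrec_rewriteOnce (L : List (List α × List α)) : Primrec (rewriteOnce L) := by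
  have h : Primrec₂ fun (_ : List α) (p : α × List α × Option (List α)) =>
      rewritePrefix L (p.1 :: p.2.1) <|> p.2.2.map (List.cons p.1) := by
    have h₁ : Primrec fun p : List α × α × List α × Option (List α) =>
        rewritePrefix L (p.2.1 :: p.2.2.1) :=
      (primrec_rewritePrefix L).comp (Primrec.list_cons.comp (Primrec.fst.comp Primrec.snd)
        (Primrec.fst.comp (Primrec.snd.comp Primrec.snd)))
    have h₂ : Primrec fun p : List α × α × List α × Option (List α) =>
        p.2.2.2.map (List.cons p.2.1) :=
      Primrec.option_map (Primrec.snd.comp (Primrec.snd.comp Primrec.snd))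
        (Primrec.list_cons.comp (Primrec.fst.comp (Primrec.snd.comp Primrec.fst)) Primrec.snd).to₂
    exact Primrec.option_orElse.comp h₁ h₂
  refine (Primrec.list_rec .id (Primrec.const (rewritePrefix L [])) h).of_eq fun w => ?_
  induction w with
  | nil => rfl
  | cons a w ih =>
    rw [rewriteOnce, ← ih]
    rfl

theorem primrec_rewriteMany (L : List (List α × List α)) (B : ℕ) :
    Primrec (rewriteMany L B) := by
  refine Primrec.nat_iterate ?_ .id ?_
  · exact Primrec.list_foldr .id (Primrec.const 1)
      (Primrec.nat_mul.comp (Primrec.const B) (Primrec.snd.comp Primrec.snd)).to₂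
  · exact (Primrec.option_getD.comp ((primrec_rewriteOnce L).comp Primrec.snd) Primrec.snd).to₂

end StringRewriting

/-! ### Computing the word of a term -/

section Reading

variable {Op C K : Type} (F : Signature Op) (ι : C → K)

open Classical in
/-- The letters to be written when the symbol `g` opens below `τ`. -/
noncomputable def openLetters (p : Option Op × Op) : List (Letter Op K) :=
  if p.2 ∈ F.assoc ∧ p.1 = some p.2 then [] else [Letter.opn p.1 p.2]

open Classical in
/-- The letters to be written when the symbol on top of the stack closes. -/
noncomputable def closeLetters (p : Option Op × Option Op) : List (Letter Op K) :=
  if ∃ g ∈ F.assoc, p.1 = some g ∧ p.2 = some g then [] else [Letter.cls]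

/-- Reading one letter of a term written as a word, with a stack of the open symbols and the
output so far. -/
noncomputable def readLetter (s : List Op × List (Letter Op K)) (a : Op ⊕ C ⊕ Unit) :
    List Op × List (Letter Op K) :=
  Sum.casesOn a (fun g => (g :: s.1, s.2 ++ openLetters F (s.1.head?, g)))
    (fun b => Sum.casesOn b (fun c => (s.1, s.2 ++ [Letter.cst s.1.head? (ι c)]))
      (fun _ => (s.1.tail, s.2 ++ closeLetters F (s.1.head?, s.1.tail.head?))))

/-- The word of a term, computed from the term written as a word. -/
noncomputable def readWord (w : List (Op ⊕ C ⊕ Unit)) : List (Letter Op K) :=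
  (w.foldl (readLetter F ι) ([], [])).2

/-- Reading a complete term restores the stack, and the output depends on the stack only through its
top, which is the tag. -/
theorem foldl_readLetter (t : Term Op C) (σ : List Op) (out : List (Letter Op K)) :
    t.word.foldl (readLetter F ι) (σ, out) = (σ, out ++ (t.map ι).enc F σ.head?) := by
  induction t using Term.induction generalizing σ out with
  | hc c => simp [Term.word, Term.map, Term.enc_const, readLetter]
  | ha g ts ih =>
    have hargs : ∀ out : List (Letter Op K),
        (ts.flatMap Term.word).foldl (readLetter F ι) (g :: σ, out) =
          (g :: σ, out ++ (ts.map (Term.map ι)).flatMap (Term.enc F (some g))) := by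
      induction ts with
      | nil => simp
      | cons t ts ih' =>
        intro out
        rw [List.flatMap_cons, List.foldl_append, ih t (by simp),
          ih' fun t ht => ih t (by simp [ht])]
        simp
    rw [Term.word, Term.wordArgs_eq, Term.map, Term.mapArgs_eq, List.foldl_cons,
      List.foldl_append]
    simp only [readLetter, hargs, List.foldl_cons, List.foldl_nil, List.head?_cons,
      List.tail_cons]
    by_cases h : g ∈ F.assoc ∧ σ.head? = some g
    · obtain ⟨hg, hσ⟩ := h
      rw [hσ, Term.enc_app_merge hg]
      simp [openLetters, closeLetters, hg]
    · rw [Term.enc_app h]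
      have h' : ¬ ∃ g' ∈ F.assoc, some g = some g' ∧ σ.head? = some g' := by
        rintro ⟨g', hg', h₁, h₂⟩
        obtain rfl := Option.some.inj h₁
        exact h ⟨hg', h₂⟩
      simp only [openLetters, closeLetters, if_neg h, if_neg h']
      simp

theorem readWord_word (t : Term Op C) : readWord F ι t.word = (t.map ι).enc F none := by
  rw [readWord, foldl_readLetter]
  simp

/-- All decisions that involve `F.assoc` or `ι` are functions on finite types, hence finite tables;
no algorithm for membership has to be supplied. -/
theorem primrec_readWord [Finite Op] [Finite C] [Primcodable Op] [Primcodable C]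
    [Primcodable K] : Primrec (readWord F ι) := by
  have hstack : Primrec fun s : List Op × List (Letter Op K) => s.1.head? :=
    Primrec.list_head?.comp Primrec.fst
  have hopen : Primrec₂ fun (s : List Op × List (Letter Op K)) (g : Op) =>
      (g :: s.1, s.2 ++ openLetters (K := K) F (s.1.head?, g)) := by
    refine Primrec.pair (Primrec.list_cons.comp Primrec.snd (Primrec.fst.comp Primrec.fst))
      (Primrec.list_append.comp (Primrec.snd.comp Primrec.fst) ?_)
    exact (Primrec.dom_finite (openLetters F)).comp
      (Primrec.pair (hstack.comp Primrec.fst) Primrec.snd)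
  have hcst : Primrec₂ fun (s : List Op × List (Letter Op K)) (c : C) =>
      (s.1, s.2 ++ [Letter.cst s.1.head? (ι c)]) := by
    refine Primrec.pair (Primrec.fst.comp Primrec.fst)
      (Primrec.list_append.comp (Primrec.snd.comp Primrec.fst) ?_)
    exact (Primrec.dom_finite fun p : Option Op × C => [Letter.cst p.1 (ι p.2)]).comp
      (Primrec.pair (hstack.comp Primrec.fst) Primrec.snd)
  have hclose : Primrec₂ fun (s : List Op × List (Letter Op K)) (_ : Unit) =>
      (s.1.tail, s.2 ++ closeLetters (K := K) F (s.1.head?, s.1.tail.head?)) := by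
    have htail : Primrec fun p : (List Op × List (Letter Op K)) × Unit => p.1.1.tail :=
      Primrec.list_tail.comp (Primrec.fst.comp Primrec.fst)
    refine Primrec.pair htail (Primrec.list_append.comp (Primrec.snd.comp Primrec.fst) ?_)
    exact (Primrec.dom_finite (closeLetters F)).comp
      (Primrec.pair (hstack.comp Primrec.fst) (Primrec.list_head?.comp htail))
  have hinner : Primrec₂ fun (s : List Op × List (Letter Op K)) (b : C ⊕ Unit) =>
      (Sum.casesOn b (fun c => (s.1, s.2 ++ [Letter.cst s.1.head? (ι c)]))
        (fun _ => (s.1.tail, s.2 ++ closeLetters F (s.1.head?, s.1.tail.head?))) :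
          List Op × List (Letter Op K)) :=
    Primrec.sumCasesOn Primrec.snd (hcst.comp (Primrec.fst.comp Primrec.fst) Primrec.snd)
      (hclose.comp (Primrec.fst.comp Primrec.fst) Primrec.snd)
  have hread : Primrec₂ (readLetter F ι) :=
    Primrec.sumCasesOn Primrec.snd (hopen.comp (Primrec.fst.comp Primrec.fst) Primrec.snd)
      (hinner.comp (Primrec.fst.comp Primrec.fst) Primrec.snd)
  exact Primrec.snd.comp (Primrec.list_foldl .id (Primrec.const ([], []))
    (hread.comp (Primrec.fst.comp Primrec.snd) (Primrec.snd.comp Primrec.snd)).to₂)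

end Reading

/-! ### Deciding the word problem -/

section Decision

variable {Op K : Type} {F : Signature Op} {Z : Set K}

/-- Each rule gives at most one word rule per tag, and there are finitely many tags. Bracket rules
are finitely many because they are restricted to `Z`. -/
theorem wordRule_finite [Finite Op] (hZ : Z.Finite) {R : Set (Term Op K × Term Op K)}
    (hR : R.Finite) : {ρ : List (Letter Op K) × List (Letter Op K) |
      WordRule F Z R ρ.1 ρ.2}.Finite := by
  have h₁ : ((fun p : (Term Op K × Term Op K) × Option Op =>
      (p.1.1.enc F p.2, p.1.2.enc F p.2)) '' (R ×ˢ Set.univ)).Finite :=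
    (hR.prod Set.finite_univ).image _
  have h₂ : ((fun p : (Op × K) × Option Op =>
      ((Letter.opn p.2 p.1.1 :: ([p.1.2].map (Letter.cst (some p.1.1)) ++ [Letter.cls]),
        [Letter.cst p.2 p.1.2]) : List (Letter Op K) × List (Letter Op K))) ''
      ((Set.univ ×ˢ Z) ×ˢ Set.univ)).Finite :=
    ((Set.finite_univ.prod hZ).prod Set.finite_univ).image _
  refine (h₁.union h₂).subset ?_
  rintro ⟨l, r⟩ h
  simp only [Set.mem_ofPred_eq] at h
  cases h with
  | const c d τ h =>
    exact .inl ⟨((_, _), τ), ⟨h, trivial⟩, by simp [Term.enc_const]⟩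
  | app g u d τ hg hu h =>
    refine .inl ⟨((_, _), τ), ⟨h, trivial⟩, ?_⟩
    simp only [Term.enc_const, enc_ofString fun h => hg h.1]
  | string f u v hf hu hv h =>
    refine .inl ⟨((_, _), some f), ⟨h, trivial⟩, ?_⟩
    simp only [enc_ofString_assoc hf, enc_ofStringBar hf hv]
  | bracket f c τ hf hc => exact .inr ⟨((f, c), τ), ⟨⟨trivial, hc⟩, trivial⟩, rfl⟩

theorem orient_finite [LinearOrder K] {S : Set (Eqn Op K)} (hS : S.Finite) :
    (orient F S).Finite := by
  have h : ∀ e : Eqn Op K, {ρ : Term Op K × Term Op K | s(ρ.1, ρ.2) = e}.Finite := by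
    intro e
    induction e using Sym2.ind with
    | _ a b =>
      refine (Set.toFinite {(a, b), (b, a)}).subset ?_
      rintro ⟨x, y⟩ hxy
      rcases Sym2.eq_iff.1 hxy with ⟨rfl, rfl⟩ | ⟨rfl, rfl⟩ <;> simp
  refine (hS.biUnion fun e _ => h e).subset ?_
  rintro ρ ⟨hρ, -⟩
  exact Set.mem_biUnion hρ rfl

/-- Equality of normal forms is decidable if there are finitely many persisting equations. -/
theorem decidable_sameNormalForm [Finite Op] [LinearOrder K] {B : ℕ} {δ : K → ℕ}
    {S : ℕ → Set (Eqn Op K)} (hZ : Z.Finite) (hδ : IsDigit Z B δ) (hder : IsDerivation F S)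
    (hfair : IsFair F S) (hflat : ∀ i, FlatSet F Z (S i)) (hfin : (persisting S).Finite)
    {C : Type} [Finite C] [Primcodable Op] [Primcodable C] [Primcodable K] (ι : C → K) :
    DecidableOnTerms F fun s t : Term Op C =>
      SameNormalForm F (orient F (persisting S)) (s.map ι) (t.map ι) := by
  have hR := persisting_flatSet hflat
  have hfinite := wordRule_finite (F := F) hZ (orient_finite (F := F) hfin)
  -- The list `L` and the base `B` are constants built into the algorithm, so the derivation itself
  -- need not be computable.
  let L := hfinite.toFinset.toList
  have hL : ∀ x y, ListStep L x y ↔ WordStep F Z (orient F (persisting S)) x y := by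
    intro x y
    constructor
    · rintro ⟨a, b, ρ, hρ, h⟩
      exact ⟨a, b, ρ.1, ρ.2, by simpa [L] using hρ, h⟩
    · rintro ⟨a, b, l, r, h, h'⟩
      exact ⟨a, b, (l, r), by simpa [L] using h, h'⟩
  have hL' : ListStep L = WordStep F Z (orient F (persisting S)) := by
    ext x y
    exact hL x y
  have spec := rewriteMany_spec (L := L) (μ := wordWeight B (letterDigit δ))
    (fun x y h => ((hL x y).1 h).weight_lt hδ hR)
    (fun w => (wordWeight_lt_pow hδ.letter_lt w).le)
  rw [hL'] at spec
  refine ⟨fun p => rewriteMany L B (readWord F ι p.1) = rewriteMany L B (readWord F ι p.2),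
    PrimrecPred.computablePred ?_, fun s t hs ht => ?_⟩
  · have h := (primrec_rewriteMany L B).comp (primrec_readWord F ι)
    exact Primrec.eq.comp (h.comp Primrec.fst) (h.comp Primrec.snd)
  · beta_reduce
    rw [sameNormalForm_iff hδ hder hfair hflat (Term.map_wf ι hs) (Term.map_wf ι ht)]
    simp only [readWord_word]
    obtain ⟨s₁, s₂⟩ := spec ((s.map ι).enc F none)
    obtain ⟨t₁, t₂⟩ := spec ((t.map ι).enc F none)
    have toEqv := Relation.EqvGen.reflTransGen_le_eqvGen
      (WordStep F Z (orient F (persisting S)))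
    constructor
    · intro h
      rw [← h] at t₁
      exact .trans _ _ _ (toEqv _ _ s₁) (.symm _ _ (toEqv _ _ t₁))
    · intro h
      exact normal_eq_of_eqvGen (fun _ _ h => h.weight_lt hδ hR)
        (fun _ _ _ => persisting_peak_linked hδ hder hfair hflat) h s₁ s₂ t₁ t₂

end Decision

theorem lemma4p2 {Op C₀ : Type} [Finite Op] [Finite C₀] [LinearOrder C₀]
    [Primcodable Op] [Primcodable C₀] (F : Signature Op)
    (E : Set (Eqn Op C₀)) (hEfin : E.Finite) (hE : ∀ e ∈ E, ∀ t ∈ e, F.WF t)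
    (S : ℕ → Set (Eqn Op (Const C₀))) (hS₀ : FlatteningOf F E (S 0))
    (hder : IsDerivation F S) (hfair : IsFair F S) :
    (∀ s₀ t₀ : Term Op C₀, F.WF s₀ → F.WF t₀ →
      (CC F E s₀ t₀ ↔
        SameNormalForm F (orient F (persisting S)) (lift s₀) (lift t₀))) ∧
    ((persisting S).Finite → DecidableOnTerms F (Follows F E)) := by
  refine ⟨fun s₀ t₀ hs ht => cc_iff_sameNormalForm hE hS₀ hder hfair hs ht, fun hfin => ?_⟩
  obtain ⟨⟨Z, hZ, hflat₀⟩, -⟩ := hS₀.spec hE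
  obtain ⟨B, δ, hδ⟩ := exists_isDigit hZ
  let e : Const C₀ ≃ C₀ ⊕ ℕ :=
    ofLex.trans (Equiv.sumCongr (Equiv.refl C₀) OrderDual.ofDual)
  -- A coding of all constants is needed for the intermediate words only; the input words use `C₀`.
  let : Primcodable (Const C₀) := Primcodable.ofEquiv (C₀ ⊕ ℕ) e
  obtain ⟨P, hP, h⟩ := decidable_sameNormalForm hZ hδ hder hfair (hder.flatSet hflat₀) hfin
    (Sum.inlₗ : C₀ → Const C₀)
  refine ⟨P, hP, fun s t hs ht => ?_⟩
  rw [h s t hs ht, follows_iff_cc hE hs ht]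
  exact (cc_iff_sameNormalForm hE hS₀ hder hfair hs ht).symm
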